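/- **Setting.** Let $M$ be a connected paracompact smooth $n$-manifold, $\pi:T^*M\to M$, $\boldsymbol s(\ell)=\ell\circ\pi_*$ the Liouville form, $\sigma=d\boldsymbol s$ ($=\sum_i dp_i\wedge dq_i$ in canonical coordinates), and let the Hamiltonian vector $\vec h$ of a function $h$ on $T^*M$ be defined by $\langle dh(\ell),\cdot\rangle=\sigma_\ell(\cdot,\vec h(\ell))$. Consider the problem of minimising $c_0(\xi(0))+c_f(\xi(T))+\int_0^Tf^0(\xi,\upsilon)\,dt$ subject to $\dot\xi=f(\xi,\upsilon)$ a.e., $\xi(0)\in N_0$, $\xi(T)\in N_f$, $\upsilon\in L^\infty([0,T],U)$, $U\subseteq\mathbb R^m$, with $T$ fixed or variable, $N_0,N_f\subseteq M$ connected embedded submanifolds, and $c_0,c_f,f^0,f$ smooth on open sets. Let $(\hat T,\hat\xi,\hat\upsilon)$ be admissible with $\hat T>0$ and put $\hat x_0=\hat\xi(0)$, $\hat x_f=\hat\xi(\hat T)$, $\hat f_t=f(\cdot,\hat\upsilon(t))$, $\hat f^0_t=f^0(\cdot,\hat\upsilon(t))$. For $p_0\in\{0,1\}$ put $F(\ell,u)=\langle\ell,f(\pi\ell,u)\rangle-p_0f^0(\pi\ell,u)$,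 $\hat F_t(\ell)=F(\ell,\hat\upsilon(t))$, $F_{\max}(\ell)=\sup_{u\in U}F(\ell,u)$. Assume that $(p_0,\hat\lambda)\ne 0$ satisfies the Pontryagin Maximum Principle: $\hat\lambda:[0,\hat T]\to T^*M$ is absolutely continuous, $\pi\hat\lambda=\hat\xi$, $\dot{\hat\lambda}=\vec{\hat F}_t(\hat\lambda)$ a.e., $\hat\lambda(0)=p_0\,dc_0$ on $T_{\hat x_0}N_0$, $\hat\lambda(\hat T)=-p_0\,dc_f$ on $T_{\hat x_f}N_f$, $\hat F_t(\hat\lambda(t))=F_{\max}(\hat\lambda(t))$ a.e., and $\hat F_t(\hat\lambda(t))$ is a.e. constant, the constant being $0$ if the final time is variable. Put $\hat\ell_0=\hat\lambda(0)$, $\hat\ell_f=\hat\lambda(\hat T)$. Let $\alpha$, $\beta$ be smooth functions on open neighbourhoods $A\ni\hat x_0$, $B\ni\hat x_f$ with $\alpha=p_0c_0$ on $N_0\cap A$, $\beta=p_0c_f$ on $N_f\cap B$, $\hat\ell_0=d\alpha(\hat x_0)$, $\hat\ell_f=-d\beta(\hat x_f)$, and let $\Lambda=\{d\alpha(x):x\in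 A\}$. **Assumptions.** Let $J\supseteq[0,\hat T]$ be an open interval, $\mathcal O\supseteq\Lambda$ an open subset of $T^*M$, and $H:J\times\mathcal O\to\mathbb R$. 1. $H_t$ is locally Lipschitz on $\mathcal O$ for a.e. $t$. The flow $\mathcal H$ of $\vec H_t$ from time $0$ is well defined on $J\times\Lambda$ with values in $\mathcal O$: for every $\ell\in\Lambda$, for a.e. $t\in J$, $H_t$ is differentiable at $\mathcal H_t(\ell)$ and $\frac{d}{dt}\mathcal H_t(\ell)=\vec H_t(\mathcal H_t(\ell))$; $\mathcal H_0(\ell)=\ell$; and absolutely continuous solutions starting from points of $\Lambda$ are unique. $\mathcal H$ is locally Lipschitz in $(t,\ell)\in J\times\Lambda$. The function $(t,\ell)\mapsto\langle\mathcal H_t(\ell),\pi_*\vec H_t(\mathcal H_t(\ell))\rangle-H_t(\mathcal H_t(\ell))$ on $J\times\Lambda$ coincides, for each $\ell$ and a.e. $t$, with a Lipschitz-Carathéodory function: one that is bounded and measurable in $t$, and locally Lipschitz in $\ell$ with local Lipschitz constants essentially bounded in $t$. 2. $\hat\lambda$ takes values in $\mathcal O$; $H_t\ge F_{\max}$ at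 $\mathcal H_t(\ell)$ for all $\ell\in\Lambda$ and all $t\in J$ for which $\pi\mathcal H_t(\ell)$ lies in the state domain of $f,f^0$; for a.e. $t\in[0,\hat T]$, $H_t=\hat F_t=F_{\max}$ at $\hat\lambda(t)$, $H_t$ is differentiable at $\hat\lambda(t)$ and $\vec H_t(\hat\lambda(t))=\vec{\hat F}_t(\hat\lambda(t))$. 3. For some $T_1>\hat T$ with $I=[0,T_1]\subset J$, the map $(t,\ell)\mapsto(t,\pi\mathcal H_t(\ell))$ is injective on $I\times\Lambda$, locally Lipschitz with locally Lipschitz inverse, and its image $\mathcal U$ is open in $I\times M$ and contains the graph of $\hat\xi$. 4. $H$ is differentiable at $(\hat T,\hat\ell_f)$ as a function of $(t,\ell)$, and $\vec H_{\hat T}(\hat\ell_f)=\vec{\hat F}_{\hat T}(\hat\ell_f)$. Put $\theta(t,\ell)=\alpha(\pi\ell)+\int_0^t\big(\langle\mathcal H_s(\ell),\pi_*\vec H_s(\mathcal H_s(\ell))\rangle-H_s(\mathcal H_s(\ell))\big)ds$, $\alpha_t=\theta_t\circ(\pi\mathcal H_t)^{-1}$ and $\Phi(t,x)=\beta(x)+\alpha_t(x)$.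 Assume that $\Phi$ is $C^2$ in a neighbourhood of $(\hat T,\hat x_f)$. **Conclusion.** Near $\hat x_f$ one has $d\alpha_{\hat T}=\mathcal H_{\hat T}\circ(\pi\mathcal H_{\hat T})^{-1}$, and $d\alpha_{\hat T}(\hat x_f)=\hat\ell_f$. For every $\delta x\in T_{\hat x_f}M$, at $(\hat T,\hat x_f)$: $$\partial_{xx}\Phi[\delta x]^2=D^2(\beta+\alpha_{\hat T})(\hat x_f)[\delta x]^2=\sigma\big((d\alpha_{\hat T})_*\delta x,\;d(-\beta)_*\delta x\big),$$ $$\partial_{tx}\Phi\,\delta x=-L_{\delta x}\big(L_{\hat f_{\hat T}}\alpha_{\hat T}-p_0\hat f^0_{\hat T}\big)(\hat x_f)=\sigma\big(\vec H_{\hat T}(\hat\ell_f),\;(d\alpha_{\hat T})_*\delta x\big),$$ $$\partial_{tt}\Phi=-\partial_tH(\hat T,\hat\ell_f)+L_{\hat f_{\hat T}}\big(L_{\hat f_{\hat T}}\alpha_{\hat T}-p_0\hat f^0_{\hat T}\big)(\hat x_f)=-\partial_tH(\hat T,\hat\ell_f)+\sigma\big((d\alpha_{\hat T})_*\hat f_{\hat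 T}(\hat x_f),\;\vec H_{\hat T}(\hat\ell_f)\big).$$ Moreover, if $\mathcal H_{\hat T}|_\Lambda$ is differentiable at $\hat\ell_0$, then $(\pi\mathcal H_{\hat T})^{-1}$ is differentiable at $\hat x_f$ and $(d\alpha_{\hat T})_*=\mathcal H_{\hat T*}\,(\pi\mathcal H_{\hat T})^{-1}_*$ on $T_{\hat x_f}M$. -/

import Mathlib

open scoped Manifold ContDiff Topology
open Set MeasureTheory

namespace HamOC

noncomputable section

/-! ### Calculus on manifolds -/

section Manifolds

variable {E' : Type*} [NormedAddCommGroup E'] [NormedSpace ℝ E']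
  {H' : Type*} [TopologicalSpace H'] {I' : ModelWithCorners ℝ E' H'}
  {N : Type*} [TopologicalSpace N] [ChartedSpace H' N]

/-- The coordinate expression, in the preferred chart at `x`, of a 1-form on `N`. -/
def oneFormInChart (η : ∀ y : N, TangentSpace I' y →L[ℝ] ℝ) (x : N) (z : E') : E' →L[ℝ] ℝ :=
  (η ((extChartAt I' x).symm z)).comp (mfderiv 𝓘(ℝ, E') I' (extChartAt I' x).symm z)

/-- The derivative `L_v φ(x) = ⟨dφ(x), v⟩`. -/
def lieDeriv (I' : ModelWithCorners ℝ E' H') (φ : N → ℝ) (x : N) (v : TangentSpace I' x) : ℝ :=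
  mfderiv I' 𝓘(ℝ, ℝ) φ x v

/-- The exterior derivative at `x` of a 1-form, computed in the preferred chart at `x` (which is
also the chart that identifies `TangentSpace I' x` with the model space):
`dη(v, w) = (D_v η) w - (D_w η) v`. -/
def extDerivOneForm (η : ∀ y : N, TangentSpace I' y →L[ℝ] ℝ) (x : N)
    (v w : TangentSpace I' x) : ℝ :=
  fderiv ℝ (oneFormInChart η x) (extChartAt I' x x) v w
    - fderiv ℝ (oneFormInChart η x) (extChartAt I' x x) w v

/-- Second derivative `D²φ(x)(v, w)` of a `C²` function, computed in the preferred chart at `x`.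
It does not depend on the chart when `dφ(x) = 0`. On a product `ℝ × M`, where the preferred chart
is a product chart, its `tt` and `tx` components at `(t, x)` are always independent of the chart
of `M`, and its `xx` component is when the `M`-differential vanishes at `(t, x)`. -/
def secondDeriv (I' : ModelWithCorners ℝ E' H') (φ : N → ℝ) (x : N)
    (v w : TangentSpace I' x) : ℝ :=
  fderiv ℝ (fun z : E' => fderiv ℝ (φ ∘ (extChartAt I' x).symm) z) (extChartAt I' x x) v w

/-- The curve `γ` is differentiable at `t` with velocity `v`. -/
def HasVelocity (I' : ModelWithCorners ℝ E' H') (γ : ℝ → N) (t : ℝ)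
    (v : TangentSpace I' (γ t)) : Prop :=
  HasMFDerivAt 𝓘(ℝ, ℝ) I' γ t ((1 : ℝ →L[ℝ] ℝ).smulRight v)

/-- Absolutely continuous curves `[a, b] → N`. -/
def IsAbsContCurve (I' : ModelWithCorners ℝ E' H') (γ : ℝ → N) (a b : ℝ) : Prop :=
  ContinuousOn γ (Icc a b) ∧
    ∀ φ : N → ℝ, ContMDiff I' 𝓘(ℝ, ℝ) ∞ φ → AbsolutelyContinuousOnInterval (φ ∘ γ) a b

/-- Locally Lipschitz maps between manifolds, on a subset `s`: near every point of `s` the map is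
Lipschitz in coordinates (equivalently: for the distances of any Riemannian metrics). -/
def LocLipOn {E'' : Type*} [NormedAddCommGroup E''] [NormedSpace ℝ E'']
    {H'' : Type*} [TopologicalSpace H''] (I' : ModelWithCorners ℝ E' H')
    (I'' : ModelWithCorners ℝ E'' H'') {N' : Type*} [TopologicalSpace N'] [ChartedSpace H'' N']
    (g : N → N') (s : Set N) : Prop :=
  ∀ x ∈ s, ∃ K : ℝ, ∃ u ∈ 𝓝[s] x, u ⊆ (extChartAt I' x).source ∧
    MapsTo g u (extChartAt I'' (g x)).source ∧
    ∀ y ∈ u, ∀ z ∈ u, ‖extChartAt I'' (g x) (g y) - extChartAt I'' (g x) (g z)‖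
      ≤ K * ‖extChartAt I' x y - extChartAt I' x z‖

/-- Real valued Lipschitz-Carathéodory maps on `J × s`. -/
structure IsLipCaratheodory (I' : ModelWithCorners ℝ E' H') (G : ℝ → N → ℝ)
    (J : Set ℝ) (s : Set N) : Prop where
  locLip : ∀ᵐ t : ℝ, t ∈ J → LocLipOn I' 𝓘(ℝ, ℝ) (G t) s
  aemeasurable : ∀ x ∈ s, AEMeasurable (fun t => G t x) (volume.restrict J)
  bounded : ∀ x ∈ s, ∃ C : ℝ, ∀ᵐ t : ℝ, t ∈ J → |G t x| ≤ C
  /-- Near every point the Lipschitz constants in `x` are essentially bounded in `t`. -/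
  lip : ∀ x ∈ s, ∃ K : ℝ, ∃ u ∈ 𝓝[s] x, u ⊆ (extChartAt I' x).source ∧
    ∀ᵐ t : ℝ, t ∈ J → ∀ y ∈ u, ∀ z ∈ u,
      |G t y - G t z| ≤ K * ‖extChartAt I' x y - extChartAt I' x z‖

end Manifolds

/-! ### The cotangent bundle and its symplectic structure -/

/-- The cotangent bundle of a manifold `M` modelled on `E`. -/
abbrev Cotangent (E : Type*) [NormedAddCommGroup E] [NormedSpace ℝ E]
    (M : Type*) [TopologicalSpace M] [ChartedSpace E M] [IsManifold 𝓘(ℝ, E) ∞ M] :=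
  Bundle.TotalSpace (E →L[ℝ] ℝ)
    (fun x : M => TangentSpace 𝓘(ℝ, E) x →L[ℝ] Bundle.Trivial M ℝ x)

/-- The model with corners of the cotangent bundle. -/
abbrev cotModel (E : Type*) [NormedAddCommGroup E] [NormedSpace ℝ E] :=
  (𝓘(ℝ, E)).prod 𝓘(ℝ, E →L[ℝ] ℝ)

section Symplectic

variable {E : Type*} [NormedAddCommGroup E] [NormedSpace ℝ E]
  {M : Type*} [TopologicalSpace M] [ChartedSpace E M] [IsManifold 𝓘(ℝ, E) ∞ M]

instance [h : Nonempty M] : Nonempty (Cotangent E M) := h.map fun x => ⟨x, 0⟩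

/-- A point `ℓ` of the cotangent bundle as a linear form on the tangent space at `π ℓ`. -/
def covec (ℓ : Cotangent E M) : TangentSpace 𝓘(ℝ, E) ℓ.proj →L[ℝ] ℝ := ℓ.snd

/-- The Liouville 1-form `s(ℓ) = ℓ ∘ π_*`. -/
def liouville (ℓ : Cotangent E M) : TangentSpace (cotModel E) ℓ →L[ℝ] ℝ :=
  (covec ℓ).comp
    (mfderiv (cotModel E) 𝓘(ℝ, E) (Bundle.TotalSpace.proj : Cotangent E M → M) ℓ)

/-- The canonical symplectic form `σ = ds`. -/
def symplForm (ℓ : Cotangent E M) (v w : TangentSpace (cotModel E) ℓ) : ℝ :=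
  extDerivOneForm (I' := cotModel E) liouville ℓ v w

/-- In canonical coordinates `(q, p)`, `σ = ∑ dpᵢ ∧ dqᵢ`. -/
theorem symplForm_apply (ℓ : Cotangent E M) (v w : E × (E →L[ℝ] ℝ)) :
    symplForm ℓ v w = v.2 w.1 - w.2 v.1 := by
  have hchart : ∀ z ∈ (extChartAt (cotModel E) ℓ).target,
      ((extChartAt (cotModel E) ℓ).symm z).proj ∈ (chartAt E ℓ.proj).source ∧
      z = (chartAt E ℓ.proj ((extChartAt (cotModel E) ℓ).symm z).proj,
        ContinuousLinearMap.inCoordinates E (TangentSpace 𝓘(ℝ, E)) ℝ (Bundle.Trivial M ℝ)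
          ℓ.proj ((extChartAt (cotModel E) ℓ).symm z).proj
          ℓ.proj ((extChartAt (cotModel E) ℓ).symm z).proj
          ((extChartAt (cotModel E) ℓ).symm z).snd) := by
    intro z hz
    have hsrc := (extChartAt (cotModel E) ℓ).map_target hz
    have hback := (extChartAt (cotModel E) ℓ).right_inv hz
    generalize (extChartAt (cotModel E) ℓ).symm z = ℓ' at hsrc hback ⊢
    constructor
    · rw [extChartAt_source, FiberBundle.chartedSpace_chartAt] at hsrc
      have h := hsrc.2
      rw [mem_preimage, OpenPartialHomeomorph.prod_source] at h
      simpa [hom_trivializationAt_apply] using h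
    · rw [← hom_chart ℓ ℓ', ← hback]
      rfl
  have key : ∀ᶠ z in 𝓝 (extChartAt (cotModel E) ℓ ℓ),
      oneFormInChart (I' := cotModel E) liouville ℓ z =
        (z.2 : E →L[ℝ] ℝ).comp (ContinuousLinearMap.fst ℝ E (E →L[ℝ] ℝ)) := by
    filter_upwards [eventually_mem_nhds_iff.2 (extChartAt_target_mem_nhds (I := cotModel E) ℓ)]
      with z hz'
    have hz := mem_of_mem_nhds hz'
    have hmd : MDifferentiableAt 𝓘(ℝ, E × (E →L[ℝ] ℝ)) (cotModel E)
        (extChartAt (cotModel E) ℓ).symm z := by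
      have h := mdifferentiableWithinAt_extChartAt_symm (I := cotModel E) hz
      have hr : range (cotModel E) = univ := ModelWithCorners.Boundaryless.range_eq_univ
      rw [hr, mdifferentiableWithinAt_univ] at h
      exact h
    have hev : (Bundle.TotalSpace.proj : Cotangent E M → M) ∘ (extChartAt (cotModel E) ℓ).symm
        =ᶠ[𝓝 z] (extChartAt 𝓘(ℝ, E) ℓ.proj).symm ∘ Prod.fst := by
      filter_upwards [hz'] with y hy
      obtain ⟨hb, hc⟩ := hchart y hy
      have h1 : y.1 = extChartAt 𝓘(ℝ, E) ℓ.proj ((extChartAt (cotModel E) ℓ).symm y).proj := by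
        conv_lhs => rw [hc]
        rfl
      rw [Function.comp_apply, Function.comp_apply, h1, (extChartAt 𝓘(ℝ, E) ℓ.proj).left_inv]
      rwa [extChartAt_source]
    obtain ⟨hb, hc⟩ := hchart z hz
    unfold oneFormInChart liouville
    set ℓ' := (extChartAt (cotModel E) ℓ).symm z with hℓ'
    have h1 : z.1 = extChartAt 𝓘(ℝ, E) ℓ.proj ℓ'.proj := by
      rw [hc]; rfl
    have ht1 : z.1 ∈ (extChartAt 𝓘(ℝ, E) ℓ.proj).target := by
      rw [h1]; exact (extChartAt 𝓘(ℝ, E) ℓ.proj).map_source (by rwa [extChartAt_source])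
    have hproj : MDifferentiableAt (cotModel E) 𝓘(ℝ, E)
        (Bundle.TotalSpace.proj : Cotangent E M → M) ℓ' :=
      (Bundle.contMDiff_proj (n := 1) _).mdifferentiable one_ne_zero ℓ'
    have hmd1 : MDifferentiableAt 𝓘(ℝ, E) 𝓘(ℝ, E) (extChartAt 𝓘(ℝ, E) ℓ.proj).symm z.1 := by
      have h := mdifferentiableWithinAt_extChartAt_symm (I := 𝓘(ℝ, E)) ht1
      rwa [modelWithCornersSelf_coe, range_id, mdifferentiableWithinAt_univ] at h
    have hcomp := mfderiv_comp z hproj hmd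
    rw [hev.mfderiv_eq, mfderiv_comp (I' := 𝓘(ℝ, E)) z hmd1
      (by exact differentiableAt_fst.mdifferentiableAt)] at hcomp
    have h := TangentBundle.symmL_trivializationAt (I := 𝓘(ℝ, E)) hb
    simp only [modelWithCornersSelf_coe, range_id, mfderivWithin_univ] at h
    refine ContinuousLinearMap.ext fun v => ?_
    have hv := congrArg (fun A : E × (E →L[ℝ] ℝ) →L[ℝ] E => A v) hcomp
    have hfst : mfderiv 𝓘(ℝ, E × (E →L[ℝ] ℝ)) 𝓘(ℝ, E) (Prod.fst : E × (E →L[ℝ] ℝ) → E) z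
        = ContinuousLinearMap.fst ℝ E (E →L[ℝ] ℝ) := by
      rw [mfderiv_eq_fderiv]; exact fderiv_fst
    have hv2 : mfderiv (cotModel E) 𝓘(ℝ, E) (Bundle.TotalSpace.proj : Cotangent E M → M) ℓ'
        (mfderiv 𝓘(ℝ, E × (E →L[ℝ] ℝ)) (cotModel E) (extChartAt (cotModel E) ℓ).symm z v)
        = Bundle.Trivialization.symmL ℝ
          (trivializationAt E (TangentSpace 𝓘(ℝ, E)) ℓ.proj) ℓ'.proj v.1 := by
      rw [h, ← h1]
      refine Eq.trans hv.symm ?_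
      exact congrArg (mfderiv 𝓘(ℝ, E) 𝓘(ℝ, E) (extChartAt 𝓘(ℝ, E) ℓ.proj).symm z.1)
        (congrArg (fun A : E × (E →L[ℝ] ℝ) →L[ℝ] E => A v) hfst)
    refine Eq.trans (congrArg (covec ℓ') hv2) ?_
    have hc2 := congrArg (fun y : E × (E →L[ℝ] ℝ) => y.2 v.1) hc
    refine Eq.trans ?_ hc2.symm
    simp [ContinuousLinearMap.inCoordinates, covec]
  have hval : HasFDerivAt (oneFormInChart (I' := cotModel E) (liouville (E := E) (M := M)) ℓ)
      ((ContinuousLinearMap.precomp ℝ (ContinuousLinearMap.fst ℝ E (E →L[ℝ] ℝ))).comp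
        (ContinuousLinearMap.snd ℝ E (E →L[ℝ] ℝ))) (extChartAt (cotModel E) ℓ ℓ) :=
    (ContinuousLinearMap.hasFDerivAt _).congr_of_eventuallyEq key
  unfold symplForm extDerivOneForm
  rw [hval.fderiv]
  rfl

/-- Every differential has a unique symplectic dual vector. -/
theorem existsUnique_symplDual [FiniteDimensional ℝ E] (ℓ : Cotangent E M)
    (A : TangentSpace (cotModel E) ℓ →L[ℝ] ℝ) :
    ∃! v : TangentSpace (cotModel E) ℓ, ∀ w, A w = symplForm ℓ w v := by
  change ∃! v : E × (E →L[ℝ] ℝ), ∀ w : E × (E →L[ℝ] ℝ), A w = symplForm ℓ w v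
  simp only [symplForm_apply]
  obtain ⟨B, hB⟩ : ∃ B : E × (E →L[ℝ] ℝ) →L[ℝ] ℝ, ∀ w, B w = A w := ⟨A, fun _ => rfl⟩
  simp only [← hB]
  let φ : Module.Dual ℝ (Module.Dual ℝ E) :=
    (B : E × (E →L[ℝ] ℝ) →ₗ[ℝ] ℝ) ∘ₗ LinearMap.inr ℝ E (E →L[ℝ] ℝ) ∘ₗ
      (LinearMap.toContinuousLinearMap : (E →ₗ[ℝ] ℝ) ≃ₗ[ℝ] (E →L[ℝ] ℝ)).toLinearMap
  have hq : ∀ p : E →L[ℝ] ℝ, p ((Module.evalEquiv ℝ E).symm φ) = B (0, p) := by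
    intro p
    have h := Module.apply_evalEquiv_symm_apply ℝ E (p : E →ₗ[ℝ] ℝ) φ
    refine Eq.trans h ?_
    simp only [φ, LinearMap.comp_apply, LinearMap.inr_apply]
    rfl
  refine ⟨((Module.evalEquiv ℝ E).symm φ, -(B.comp (ContinuousLinearMap.inl ℝ E _))), ?_, ?_⟩
  · rintro ⟨q, p⟩
    have h : ((q, p) : E × (E →L[ℝ] ℝ)) = (q, 0) + (0, p) := by simp
    rw [h, map_add, ← hq]
    simp [add_comm]
  · rintro ⟨q, p⟩ h
    refine Prod.ext ?_ ?_
    · refine sub_eq_zero.1 ((Module.forall_dual_apply_eq_zero_iff ℝ _).1 fun g => ?_)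
      have h1 := h (0, LinearMap.toContinuousLinearMap g)
      rw [← hq] at h1
      simp only [map_zero, sub_zero] at h1
      rw [map_sub]
      exact sub_eq_zero.2 h1.symm
    · ext x
      have h1 := h (x, 0)
      simp at h1
      simp [h1]

/-- The Hamiltonian vector field of `h`, at `ℓ`: the vector with `⟨dh(ℓ), ·⟩ = σ(·, hamVec h ℓ)`. -/
def hamVec [FiniteDimensional ℝ E] (h : Cotangent E M → ℝ) (ℓ : Cotangent E M) :
    TangentSpace (cotModel E) ℓ :=
  (existsUnique_symplDual ℓ (mfderiv (cotModel E) 𝓘(ℝ, ℝ) h ℓ)).choose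

/-- The differential of `φ` as a section `x ↦ dφ(x)` of the cotangent bundle. -/
def dSection (E : Type*) [NormedAddCommGroup E] [NormedSpace ℝ E]
    {M : Type*} [TopologicalSpace M] [ChartedSpace E M] [IsManifold 𝓘(ℝ, E) ∞ M]
    (φ : M → ℝ) (x : M) : Cotangent E M :=
  ⟨x, mfderiv 𝓘(ℝ, E) 𝓘(ℝ, ℝ) φ x⟩

/-- `φ_* δx` for a section `φ : M → T^*M` of the cotangent bundle. -/
def sectionPush (φ : M → Cotangent E M) (x : M) (δx : TangentSpace 𝓘(ℝ, E) x) :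
    TangentSpace (cotModel E) (φ x) :=
  mfderiv 𝓘(ℝ, E) (cotModel E) φ x δx

/-- Carathéodory solutions on `[a, b]` of the Hamiltonian system of `H`. -/
def IsHamSolution [FiniteDimensional ℝ E] (H : ℝ → Cotangent E M → ℝ) (γ : ℝ → Cotangent E M)
    (a b : ℝ) : Prop :=
  IsAbsContCurve (cotModel E) γ a b ∧
    ∀ᵐ t : ℝ, t ∈ Icc a b → MDifferentiableAt (cotModel E) 𝓘(ℝ, ℝ) (H t) (γ t) ∧
      HasVelocity (cotModel E) γ t (hamVec (H t) (γ t))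

end Symplectic

/-! ### The optimal control problem -/

section Problem

/-- Connected embedded submanifolds (of some dimension `k`), through slice charts. -/
def IsEmbeddedSubmanifold (E : Type*) [NormedAddCommGroup E] [NormedSpace ℝ E]
    {M : Type*} [TopologicalSpace M] [ChartedSpace E M] (N : Set M) : Prop :=
  IsConnected N ∧ ∃ k : ℕ, ∀ x ∈ N, ∃ e ∈ IsManifold.maximalAtlas 𝓘(ℝ, E) ∞ M,
    ∃ S : Submodule ℝ E, Module.finrank ℝ S = k ∧ x ∈ e.source ∧
      ∀ y ∈ e.source, y ∈ N ↔ e y ∈ S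

/-- Tangent vectors at `x` to a submanifold `N`: velocities of smooth curves lying in `N`. -/
def tangentVectors {E : Type*} [NormedAddCommGroup E] [NormedSpace ℝ E]
    {M : Type*} [TopologicalSpace M] [ChartedSpace E M] (N : Set M) (x : M) :
    Set (TangentSpace 𝓘(ℝ, E) x) :=
  {v | ∃ γ : ℝ → M, γ 0 = x ∧ ContMDiffAt 𝓘(ℝ, ℝ) 𝓘(ℝ, E) ∞ γ 0 ∧
    (∀ᶠ s in 𝓝 (0 : ℝ), γ s ∈ N) ∧ HasVelocity 𝓘(ℝ, E) γ 0 v}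

/-- Data of the Bolza problem: minimise `c₀(ξ(0)) + c_f(ξ(T)) + ∫₀ᵀ f⁰(ξ, υ) dt` subject to
`ξ' = f(ξ, υ)`, `ξ(0) ∈ N₀`, `ξ(T) ∈ N_f`, `υ ∈ L^∞([0, T], U)`, `T` fixed or variable. All the
data are smooth on open sets. -/
structure ControlProblem (E : Type*) [NormedAddCommGroup E] [NormedSpace ℝ E]
    (M : Type*) [TopologicalSpace M] [ChartedSpace E M] [IsManifold 𝓘(ℝ, E) ∞ M] (m : ℕ) where
  /-- the control set, and an open neighbourhood of it -/
  U : Set (EuclideanSpace ℝ (Fin m))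
  V : Set (EuclideanSpace ℝ (Fin m))
  isOpen_V : IsOpen V
  U_subset : U ⊆ V
  /-- the open set of states where `f` and `f⁰` are defined -/
  D : Set M
  isOpen_D : IsOpen D
  f : (x : M) → EuclideanSpace ℝ (Fin m) → TangentSpace 𝓘(ℝ, E) x
  f0 : M → EuclideanSpace ℝ (Fin m) → ℝ
  f_smooth : ContMDiffOn (𝓘(ℝ, E).prod 𝓘(ℝ, EuclideanSpace ℝ (Fin m))) 𝓘(ℝ, E).tangent ∞
    (fun z : M × EuclideanSpace ℝ (Fin m) => (⟨z.1, f z.1 z.2⟩ : TangentBundle 𝓘(ℝ, E) M))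
    (D ×ˢ V)
  f0_smooth : ContMDiffOn (𝓘(ℝ, E).prod 𝓘(ℝ, EuclideanSpace ℝ (Fin m))) 𝓘(ℝ, ℝ) ∞
    (fun z : M × EuclideanSpace ℝ (Fin m) => f0 z.1 z.2) (D ×ˢ V)
  N0 : Set M
  Nf : Set M
  N0_submanifold : IsEmbeddedSubmanifold E N0
  Nf_submanifold : IsEmbeddedSubmanifold E Nf
  c0 : M → ℝ
  cf : M → ℝ
  c0_smooth : ∃ W : Set M, IsOpen W ∧ N0 ⊆ W ∧ ContMDiffOn 𝓘(ℝ, E) 𝓘(ℝ, ℝ) ∞ c0 W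
  cf_smooth : ∃ W : Set M, IsOpen W ∧ Nf ⊆ W ∧ ContMDiffOn 𝓘(ℝ, E) 𝓘(ℝ, ℝ) ∞ cf W
  /-- whether the final time is variable -/
  freeTime : Prop

variable {E : Type*} [NormedAddCommGroup E] [NormedSpace ℝ E] [FiniteDimensional ℝ E]
  {M : Type*} [TopologicalSpace M] [ChartedSpace E M] [IsManifold 𝓘(ℝ, E) ∞ M] {m : ℕ}

/-- The pre-Hamiltonian `F(ℓ, u) = ⟨ℓ, f(πℓ, u)⟩ - p₀ f⁰(πℓ, u)`. -/
def ControlProblem.preHam (P : ControlProblem E M m) (p0 : ℝ) (ℓ : Cotangent E M)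
    (u : EuclideanSpace ℝ (Fin m)) : ℝ :=
  covec ℓ (P.f ℓ.proj u) - p0 * P.f0 ℓ.proj u

/-- The reference Hamiltonian `F̂_t(ℓ) = F(ℓ, υ̂(t))`. -/
def ControlProblem.refHam (P : ControlProblem E M m) (p0 : ℝ)
    (u : ℝ → EuclideanSpace ℝ (Fin m)) (t : ℝ) (ℓ : Cotangent E M) : ℝ :=
  P.preHam p0 ℓ (u t)

/-- The maximised Hamiltonian, which may be `+∞`. -/
def ControlProblem.maxHam (P : ControlProblem E M m) (p0 : ℝ) (ℓ : Cotangent E M) : EReal :=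
  ⨆ u ∈ P.U, ((P.preHam p0 ℓ u : ℝ) : EReal)

/-- Admissible triples `(T, ξ, υ)`. -/
structure ControlProblem.IsAdmissible (P : ControlProblem E M m) (T : ℝ) (ξ : ℝ → M)
    (u : ℝ → EuclideanSpace ℝ (Fin m)) : Prop where
  T_pos : 0 < T
  u_mem : ∀ t ∈ Icc 0 T, u t ∈ P.U
  u_aemeasurable : AEMeasurable u (volume.restrict (Icc 0 T))
  u_bounded : ∃ C : ℝ, ∀ᵐ t : ℝ, t ∈ Icc 0 T → ‖u t‖ ≤ C
  mem_D : ∀ t ∈ Icc 0 T, ξ t ∈ P.D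
  absCont : IsAbsContCurve 𝓘(ℝ, E) ξ 0 T
  velocity : ∀ᵐ t : ℝ, t ∈ Icc 0 T → HasVelocity 𝓘(ℝ, E) ξ t (P.f (ξ t) (u t))
  initial : ξ 0 ∈ P.N0
  final : ξ T ∈ P.Nf

/-- `(p₀, λ̂)` satisfies the Pontryagin Maximum Principle along `(T, ξ, υ)`. -/
structure ControlProblem.IsPontryagin (P : ControlProblem E M m) (p0 T : ℝ) (ξ : ℝ → M)
    (u : ℝ → EuclideanSpace ℝ (Fin m)) (lam : ℝ → Cotangent E M) : Prop where
  p0_mem : p0 = 0 ∨ p0 = 1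
  nontrivial : p0 ≠ 0 ∨ ∃ t ∈ Icc 0 T, covec (lam t) ≠ 0
  lift : ∀ t ∈ Icc 0 T, (lam t).proj = ξ t
  solution : IsHamSolution (P.refHam p0 u) lam 0 T
  transversality_initial : ∀ v ∈ tangentVectors (E := E) P.N0 (ξ 0),
    covec (lam 0) v = p0 * lieDeriv 𝓘(ℝ, E) P.c0 (ξ 0) v
  transversality_final : ∀ v ∈ tangentVectors (E := E) P.Nf (ξ T),
    covec (lam T) v = -(p0 * lieDeriv 𝓘(ℝ, E) P.cf (ξ T) v)
  maximality : ∀ᵐ t : ℝ, t ∈ Icc 0 T →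
    ∀ v ∈ P.U, P.preHam p0 (lam t) v ≤ P.refHam p0 u t (lam t)
  constant : ∃ c : ℝ, (P.freeTime → c = 0) ∧
    ∀ᵐ t : ℝ, t ∈ Icc 0 T → P.refHam p0 u t (lam t) = c

/-- `L_{f̂_t} φ - p₀ f̂⁰_t`, where `f̂_t = f(·, υ̂(t))` and `f̂⁰_t = f⁰(·, υ̂(t))`. -/
def ControlProblem.lieRef (P : ControlProblem E M m) (p0 : ℝ)
    (u : ℝ → EuclideanSpace ℝ (Fin m)) (t : ℝ) (φ : M → ℝ) (x : M) : ℝ :=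
  lieDeriv 𝓘(ℝ, E) φ x (P.f x (u t)) - p0 * P.f0 x (u t)

/-- `φ` is a smooth function on the open set `A` which extends `p₀ c` from `N`. -/
structure IsCostExtension (E : Type*) [NormedAddCommGroup E] [NormedSpace ℝ E]
    {M : Type*} [TopologicalSpace M] [ChartedSpace E M]
    (p0 : ℝ) (c : M → ℝ) (N : Set M) (φ : M → ℝ) (A : Set M) : Prop where
  isOpen : IsOpen A
  smooth : ContMDiffOn 𝓘(ℝ, E) 𝓘(ℝ, ℝ) ∞ φ A
  extends_cost : ∀ x ∈ N ∩ A, φ x = p0 * c x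

end Problem

/-! ### The flow, the Cartan form and the function `Φ` -/

section Flow

variable {E : Type*} [NormedAddCommGroup E] [NormedSpace ℝ E] [FiniteDimensional ℝ E]
  {M : Type*} [TopologicalSpace M] [ChartedSpace E M] [IsManifold 𝓘(ℝ, E) ∞ M] {m : ℕ}

/-- `⟨flow_t(ℓ), π_* H⃗_t(flow_t(ℓ))⟩ - H_t(flow_t(ℓ))`, the Cartan form along the flow. -/
def cartanAlong (H : ℝ → Cotangent E M → ℝ) (flow : ℝ → Cotangent E M → Cotangent E M)
    (t : ℝ) (ℓ : Cotangent E M) : ℝ :=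
  liouville (flow t ℓ) (hamVec (H t) (flow t ℓ)) - H t (flow t ℓ)

/-- Regularity of the Hamiltonian `H : J × O → ℝ` and of its flow, issued from `Λ ⊆ O`. -/
structure IsRegularFlow (H : ℝ → Cotangent E M → ℝ) (J : Set ℝ) (O Λ : Set (Cotangent E M))
    (flow : ℝ → Cotangent E M → Cotangent E M) : Prop where
  /-- Almost every `H_t` is locally Lipschitz on `O`. -/
  locLip_H : ∀ᵐ t : ℝ, t ∈ J → LocLipOn (cotModel E) 𝓘(ℝ, ℝ) (H t) O
  /-- The flow is well defined on `J × Λ`: solutions exist on `J` and are unique. -/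
  flow_zero : ∀ ℓ ∈ Λ, flow 0 ℓ = ℓ
  flow_mem : ∀ t ∈ J, ∀ ℓ ∈ Λ, flow t ℓ ∈ O
  flow_ode : ∀ ℓ ∈ Λ, ∀ᵐ t : ℝ, t ∈ J →
    MDifferentiableAt (cotModel E) 𝓘(ℝ, ℝ) (H t) (flow t ℓ) ∧
      HasVelocity (cotModel E) (fun s => flow s ℓ) t (hamVec (H t) (flow t ℓ))
  flow_unique : ∀ ℓ ∈ Λ, ∀ b ∈ J, ∀ γ : ℝ → Cotangent E M, γ 0 = ℓ →
    (∀ t ∈ Icc 0 b, γ t ∈ O) → IsHamSolution H γ 0 b → ∀ t ∈ Icc 0 b, γ t = flow t ℓ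
  /-- The flow is Lipschitz in `(t, ℓ)`. -/
  flow_locLip : LocLipOn (𝓘(ℝ, ℝ).prod (cotModel E)) (cotModel E)
    (fun z : ℝ × Cotangent E M => flow z.1 z.2) (J ×ˢ Λ)
  /-- The Cartan form along the flow agrees, for a.e. `t`, with a Lipschitz-Carathéodory map. -/
  cartan_lipCaratheodory : ∃ G : ℝ → Cotangent E M → ℝ, IsLipCaratheodory (cotModel E) G J Λ ∧
    ∀ ℓ ∈ Λ, ∀ᵐ t : ℝ, t ∈ J → cartanAlong H flow t ℓ = G t ℓ

/-- `H` is a super-Hamiltonian along the flow, and coincides to first order with the reference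
Hamiltonian along the Pontryagin extremal. -/
structure IsSuperHamiltonian (P : ControlProblem E M m) (p0 T : ℝ)
    (u : ℝ → EuclideanSpace ℝ (Fin m)) (lam : ℝ → Cotangent E M)
    (H : ℝ → Cotangent E M → ℝ) (J : Set ℝ) (O Λ : Set (Cotangent E M))
    (flow : ℝ → Cotangent E M → Cotangent E M) : Prop where
  lam_mem : ∀ t ∈ Icc 0 T, lam t ∈ O
  ge_max : ∀ ℓ ∈ Λ, ∀ t ∈ J, (flow t ℓ).proj ∈ P.D →
    P.maxHam p0 (flow t ℓ) ≤ ((H t (flow t ℓ) : ℝ) : EReal)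
  eq_ref : ∀ᵐ t : ℝ, t ∈ Icc 0 T → H t (lam t) = P.refHam p0 u t (lam t) ∧
    ((P.refHam p0 u t (lam t) : ℝ) : EReal) = P.maxHam p0 (lam t)
  vec_eq_ref : ∀ᵐ t : ℝ, t ∈ Icc 0 T →
    MDifferentiableAt (cotModel E) 𝓘(ℝ, ℝ) (H t) (lam t) ∧
      hamVec (H t) (lam t) = hamVec (P.refHam p0 u t) (lam t)

/-- The map `id × π flow`. -/
def projFlow (flow : ℝ → Cotangent E M → Cotangent E M) (z : ℝ × Cotangent E M) : ℝ × M :=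
  (z.1, (flow z.1 z.2).proj)

/-- `(π flow_t)⁻¹ : π flow_t(Λ) → Λ`. -/
def projFlowInv [Nonempty M] (flow : ℝ → Cotangent E M → Cotangent E M)
    (Λ : Set (Cotangent E M)) (t : ℝ) (x : M) : Cotangent E M :=
  Function.invFunOn (fun ℓ => (flow t ℓ).proj) Λ x

/-- With `I = [0, T₁]`, the map `id × π flow` is bi-Lipschitz from `I × Λ` onto an open subset of
`I × M` which contains the graph of `ξ : [0, T] → M`. -/
structure IsProjBiLipschitz [Nonempty M] (T T₁ : ℝ) (ξ : ℝ → M) (Λ : Set (Cotangent E M))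
    (flow : ℝ → Cotangent E M → Cotangent E M) : Prop where
  injOn : InjOn (projFlow flow) (Icc 0 T₁ ×ˢ Λ)
  locLip : LocLipOn (𝓘(ℝ, ℝ).prod (cotModel E)) (𝓘(ℝ, ℝ).prod 𝓘(ℝ, E)) (projFlow flow)
    (Icc 0 T₁ ×ˢ Λ)
  locLip_inv : LocLipOn (𝓘(ℝ, ℝ).prod 𝓘(ℝ, E)) (𝓘(ℝ, ℝ).prod (cotModel E))
    (fun z : ℝ × M => (z.1, projFlowInv flow Λ z.1 z.2)) (projFlow flow '' (Icc 0 T₁ ×ˢ Λ))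
  isOpen_image : ∃ W : Set (ℝ × M), IsOpen W ∧
    projFlow flow '' (Icc 0 T₁ ×ˢ Λ) = W ∩ (Icc 0 T₁ ×ˢ univ)
  graph_mem : ∀ t ∈ Icc 0 T, (t, ξ t) ∈ projFlow flow '' (Icc 0 T₁ ×ˢ Λ)

/-- `θ(t, ℓ) = α(πℓ) + ∫` of the Cartan form along `s ↦ flow_s(ℓ)`, `s ∈ [0, t]`. -/
def theta (H : ℝ → Cotangent E M → ℝ) (flow : ℝ → Cotangent E M → Cotangent E M)
    (α : M → ℝ) (t : ℝ) (ℓ : Cotangent E M) : ℝ :=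
  α ℓ.proj + ∫ s in (0 : ℝ)..t, cartanAlong H flow s ℓ

/-- `α_t = θ_t ∘ (π flow_t)⁻¹`, with `Λ` the graph of `dα` on `A`. -/
def alphaT [Nonempty M] (H : ℝ → Cotangent E M → ℝ)
    (flow : ℝ → Cotangent E M → Cotangent E M) (α : M → ℝ) (A : Set M) (t : ℝ) (x : M) : ℝ :=
  theta H flow α t (projFlowInv flow (dSection E α '' A) t x)

/-- `Φ(t, x) = β(x) + α_t(x)`. -/
def Phi [Nonempty M] (H : ℝ → Cotangent E M → ℝ)
    (flow : ℝ → Cotangent E M → Cotangent E M) (α : M → ℝ) (A : Set M) (β : M → ℝ)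
    (z : ℝ × M) : ℝ :=
  β z.2 + alphaT H flow α A z.1 z.2

end Flow

end

end HamOC

open HamOC

/-! The theorem rests on two facts about `α_t`: its differential is the section `flow_t ∘ (π
flow_t)⁻¹`, and it solves a Hamilton–Jacobi equation that may be differentiated at the final point.

In the smooth case both follow from the exactness of the Poincaré–Cartan form `p dq - H dt` on the
flow-out of `Λ`. Here the flow is only Lipschitz and `H` need not be continuous in `t`, so exactness
is proved on curves. For a Lipschitz curve `γ` in `Λ`, let `D(t)` be the integral of the Liouville
form along `flow_t ∘ γ`. In a chart `D(t) = ∫ P ∂ₛQ ds`, and Stokes' formula gives, for a.e. `t`,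
`D' = ∫ (∂ₜP ∂ₛQ - ∂ₛP ∂ₜQ) ds + [P ∂ₜQ]` (`ae_hasDerivAt_lineIntegral`). Hamilton's equations turn
the first integrand into `-∂ₛH`, so `D'` is the difference of the Cartan form at the two ends
(`lineIntegral_sub_eq_integral_cartan`), which is also the rate of change of the variation of `θ_t`
along `γ`. At `t = 0` that variation and `D` are both the variation of `α`; connectedness of `J`
carries their equality to times near `T` (`IsRegularFlow.exists_theta_sub`). Applied to the curve
lying over a segment, it reads `α_t(y + v) - α_t(y) = ∫ p(y + sv) v ds` with `p` Lipschitz, whence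
`dα_t = p` with a quadratic remainder (`IsRegularFlow.exists_hasFDerivAt_alphaT`).

Differentiating `θ` along a trajectory gives `∂ₜα_t + H_t(dα_t) = 0` for a.e. time on that
trajectory (`IsRegularFlow.ae_hamiltonJacobi`), hence on a dense set near `(T, x_f)`. The left side
is differentiable at `(T, x_f)`, because `α_t` is `C²` there and `H` is differentiable at `(T,
ℓ_f)`; being zero on a dense set, it has zero derivative there (`fderiv_eq_zero_of_mem_closure`).
This determines the second derivatives of `α_t` that involve `t`, and symmetry turns them into the
formulas for `∂ₜₓΦ` and `∂ₜₜΦ`. The formula for `∂ₓₓΦ` is `σ = dp ∧ dq` evaluated on the graphs of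
two differentials.

Uniqueness of solutions identifies `flow_T(ℓ₀)` with `ℓ_f`. The symplectic pairings become Lie
derivatives because `L_f̂ φ - p₀ f̂⁰ = F̂ ∘ dφ`. For the last claim, a differentiable map with a
Lipschitz left inverse has injective differential, so in equal finite dimensions the inverse is
differentiable too. -/

namespace HamOC

open Filter Function
open scoped NNReal

/-! ### Measurability, integration by parts and weak-strong limits. -/

section Analysis

set_option linter.unusedSectionVars false

/-- A function which is measurable in `t` and, for a.e. `t`, continuous in `s` agrees for a.e. `t`
with a jointly measurable one. -/
theorem exists_measurable_modification {h : ℝ → ℝ → ℝ} {μ : Measure ℝ}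
    (h1 : ∀ s, AEMeasurable (fun t => h t s) μ) (h2 : ∀ᵐ t ∂μ, Continuous (h t)) :
    ∃ k : ℝ → ℝ → ℝ, Measurable (uncurry k) ∧ ∀ᵐ t ∂μ, ∀ s, k s t = h t s := by
  have hq : ∀ᵐ t ∂μ, Continuous (h t) ∧ ∀ q : ℚ, h t q = (h1 q).mk _ t := by
    refine h2.and (ae_all_iff.2 fun q => (h1 q).ae_eq_mk)
  -- The bad times are enclosed in a measurable null set. Off it, `h t s` is the limit of measurable
  -- representatives at rationals tending to `s`.
  set N := toMeasurable μ {t | ¬ (Continuous (h t) ∧ ∀ q : ℚ, h t q = (h1 q).mk _ t)} with hN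
  have hN0 : μ N = 0 := by rw [hN, measure_toMeasurable]; exact hq
  have hNm : MeasurableSet N := measurableSet_toMeasurable _ _
  have hgood : ∀ t, t ∉ N → Continuous (h t) ∧ ∀ q : ℚ, h t q = (h1 q).mk _ t := by
    intro t ht
    by_contra hc
    exact ht (subset_toMeasurable _ _ hc)
  classical
  refine ⟨fun s t => if t ∈ N then 0 else h t s, ?_, ?_⟩
  · refine measurable_uncurry_of_continuous_of_measurable (u := fun s t => if t ∈ N then 0 else h t s)
      ?_ ?_
    · intro t
      by_cases ht : t ∈ N
      · simp only [ht, if_true]; exact continuous_const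
      · simp only [ht, if_false]; exact (hgood t ht).1
    · intro s
      obtain ⟨q, hqs⟩ : ∃ q : ℕ → ℚ, Tendsto (fun n => (q n : ℝ)) atTop (𝓝 s) := by
        have hd : DenseRange ((↑) : ℚ → ℝ) := Rat.denseRange_cast
        obtain ⟨x, hx, hxs⟩ := mem_closure_iff_seq_limit.1 (hd s)
        choose q hq using hx
        exact ⟨q, by simpa only [hq] using hxs⟩
      refine measurable_of_tendsto_metrizable
        (f := fun n t => if t ∈ N then 0 else (h1 (q n)).mk _ t)
        (fun n => Measurable.ite hNm measurable_const (h1 (q n)).measurable_mk) ?_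
      rw [tendsto_pi_nhds]
      intro t
      by_cases ht : t ∈ N
      · simp [ht]
      · simp only [ht, if_false]
        have := ((hgood t ht).1.tendsto s).comp hqs
        refine this.congr fun n => ?_
        exact (hgood t ht).2 (q n)
  · have : ∀ᵐ t ∂μ, t ∉ N := measure_eq_zero_iff_ae_notMem.1 hN0
    filter_upwards [this] with t ht s
    simp [ht]

variable {E : Type*} [NormedAddCommGroup E] [NormedSpace ℝ E] [FiniteDimensional ℝ E]

theorem aestronglyMeasurable_clm_apply {α : Type*} [MeasurableSpace α] {μ : Measure α}
    {p : α → E →L[ℝ] ℝ} {q : α → E} (hp : AEStronglyMeasurable p μ)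
    (hq : AEStronglyMeasurable q μ) : AEStronglyMeasurable (fun s => p s (q s)) μ :=
  (isBoundedBilinearMap_apply (𝕜 := ℝ) (E := E) (F := ℝ)).continuous.comp_aestronglyMeasurable
    (hp.prodMk hq)

theorem intervalIntegrable_of_bounded {f : ℝ → ℝ} {a b C : ℝ}
    (hf : AEStronglyMeasurable f volume) (hC : ∀ s, |f s| ≤ C) :
    IntervalIntegrable f volume a b := by
  rw [intervalIntegrable_iff]
  exact Measure.integrableOn_of_bounded (M := C) (by simp) hf (by simpa using ae_of_all _ hC)


theorem clm_apply_sub_le {p p' : E →L[ℝ] ℝ} {q q' : E} :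
    |p q - p' q'| ≤ ‖p‖ * ‖q - q'‖ + ‖p - p'‖ * ‖q'‖ := by
  have : p q - p' q' = p (q - q') + (p - p') q' := by simp
  rw [this]
  exact (abs_add_le _ _).trans (add_le_add (p.le_opNorm _) ((p - p').le_opNorm _))

/-- Integration by parts for Lipschitz functions. -/
theorem integral_clm_apply_deriv {p : ℝ → E →L[ℝ] ℝ} {q : ℝ → E} {K L : ℝ≥0}
    (hp : LipschitzWith K p) (hq : LipschitzWith L q) (a b : ℝ) :
    ∫ s in a..b, p s (deriv q s) = p b (q b) - p a (q a) - ∫ s in a..b, deriv p s (q s) := by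
  obtain ⟨C1, hC1⟩ := (isCompact_uIcc (a := a) (b := b)).exists_bound_of_continuousOn
    hp.continuous.continuousOn
  obtain ⟨C2, hC2⟩ := (isCompact_uIcc (a := a) (b := b)).exists_bound_of_continuousOn
    hq.continuous.continuousOn
  have hac : AbsolutelyContinuousOnInterval (fun s => p s (q s)) a b := by
    refine LipschitzOnWith.absolutelyContinuousOnInterval
      (K := (C1 * L + K * C2).toNNReal) (LipschitzOnWith.of_dist_le_mul fun x hx y hy => ?_)
    rw [Real.dist_eq]
    refine clm_apply_sub_le.trans ?_
    have hC1' := (norm_nonneg _).trans (hC1 x hx)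
    have hC2' := (norm_nonneg _).trans (hC2 y hy)
    rw [Real.coe_toNNReal _ (by positivity), add_mul]
    have e1 := hp.norm_sub_le x y
    have e2 := hq.norm_sub_le x y
    rw [Real.dist_eq, ← Real.norm_eq_abs]
    refine add_le_add ?_ ?_
    · calc ‖p x‖ * ‖q x - q y‖ ≤ C1 * (L * ‖x - y‖) :=
            mul_le_mul (hC1 x hx) e2 (norm_nonneg _) hC1'
        _ = _ := by ring
    · calc ‖p x - p y‖ * ‖q y‖ ≤ (K * ‖x - y‖) * C2 :=
            mul_le_mul e1 (hC2 y hy) (norm_nonneg _) (by positivity)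
        _ = _ := by ring
  have hI1 : IntervalIntegrable (fun s => p s (deriv q s)) volume a b := by
    refine intervalIntegrable_iff.2 (Measure.integrableOn_of_bounded (M := C1 * L) (by simp)
      (aestronglyMeasurable_clm_apply hp.continuous.aestronglyMeasurable
        (stronglyMeasurable_deriv q).aestronglyMeasurable) ?_)
    refine (ae_restrict_iff' measurableSet_uIoc).2 (ae_of_all _ fun s hs => ?_)
    exact ((p s).le_opNorm _).trans (mul_le_mul (hC1 s (uIoc_subset_uIcc hs))
      (norm_deriv_le_of_lipschitz hq) (norm_nonneg _)
      ((norm_nonneg _).trans (hC1 s (uIoc_subset_uIcc hs))))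
  have hI2 : IntervalIntegrable (fun s => deriv p s (q s)) volume a b := by
    refine intervalIntegrable_iff.2 (Measure.integrableOn_of_bounded (M := K * C2) (by simp)
      (aestronglyMeasurable_clm_apply (stronglyMeasurable_deriv p).aestronglyMeasurable
        hq.continuous.aestronglyMeasurable) ?_)
    refine (ae_restrict_iff' measurableSet_uIoc).2 (ae_of_all _ fun s hs => ?_)
    exact ((deriv p s).le_opNorm _).trans (mul_le_mul (norm_deriv_le_of_lipschitz hp)
      (hC2 s (uIoc_subset_uIcc hs)) (norm_nonneg _) K.2)
  rw [← hac.integral_deriv_eq_sub, eq_sub_iff_add_eq, ← intervalIntegral.integral_add hI1 hI2]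
  refine intervalIntegral.integral_congr_ae ?_
  filter_upwards [hp.ae_differentiableAt_real, hq.ae_differentiableAt_real] with s h1 h2 _
  rw [(h1.hasDerivAt.clm_apply h2.hasDerivAt).deriv]
  ring

/-- Weak-strong convergence: if `f n → f` boundedly a.e. and the uniformly Lipschitz functions
`g n` tend to `0` uniformly, then `∫ f n (g n)'` tends to `0`. -/
theorem tendsto_integral_clm_apply_deriv {f : ℕ → ℝ → E →L[ℝ] ℝ} {f' : ℝ → E →L[ℝ] ℝ}
    {g : ℕ → ℝ → E} {C : ℝ} {K : ℝ≥0} {L : ℕ → ℝ≥0} {c : ℕ → ℝ}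
    (hf : ∀ n, LipschitzWith (L n) (f n)) (hfC : ∀ n s, ‖f n s‖ ≤ C)
    (hlim : ∀ᵐ s, Tendsto (fun n => f n s) atTop (𝓝 (f' s)))
    (hg : ∀ n, LipschitzWith K (g n)) (hgc : ∀ n s, ‖g n s‖ ≤ c n)
    (hc : Tendsto c atTop (𝓝 0)) (a b : ℝ) :
    Tendsto (fun n => ∫ s in a..b, f n s (deriv (g n) s)) atTop (𝓝 0) := by
  have hC : 0 ≤ C := (norm_nonneg _).trans (hfC 0 0)
  have hfm : ∀ n, AEStronglyMeasurable (f n) volume :=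
    fun n => (hf n).continuous.aestronglyMeasurable
  have hf'm : AEStronglyMeasurable f' volume := aestronglyMeasurable_of_tendsto_ae _ hfm hlim
  have hf'C : ∀ᵐ s, ‖f' s‖ ≤ C := by
    filter_upwards [hlim] with s hs
    exact le_of_tendsto hs.norm (Eventually.of_forall fun n => hfC n s)
  have hconv : Tendsto (fun n => ∫ s in uIoc a b, ‖f n s - f' s‖) atTop (𝓝 0) := by
    have := tendsto_integral_of_dominated_convergence (μ := volume.restrict (uIoc a b))
      (F := fun n s => ‖f n s - f' s‖) (f := fun _ => (0 : ℝ)) (fun _ => 2 * C)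
      (fun n => ((hfm n).sub hf'm).norm.restrict) (integrableOn_const (by simp)) ?_ ?_
    · simpa using this
    · intro n
      refine ae_restrict_of_ae ?_
      filter_upwards [hf'C] with s hs
      rw [norm_norm]
      exact (norm_sub_le _ _).trans (by linarith [hfC n s])
    · refine ae_restrict_of_ae ?_
      filter_upwards [hlim] with s hs
      have := (hs.sub_const (f' s)).norm
      simpa using this
  have hdiffint : ∀ n, IntegrableOn (fun s => ‖f n s - f' s‖) (uIoc a b) := by
    intro n
    refine Measure.integrableOn_of_bounded (M := 2 * C) (by simp) ((hfm n).sub hf'm).norm ?_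
    refine ae_restrict_of_ae ?_
    filter_upwards [hf'C] with s hs
    rw [norm_norm]
    exact (norm_sub_le _ _).trans (by linarith [hfC n s])
  have hint : ∀ m n, IntervalIntegrable (fun s => f m s (deriv (g n) s)) volume a b := by
    intro m n
    refine intervalIntegrable_of_bounded (C := C * K) (aestronglyMeasurable_clm_apply (hfm m)
      (stronglyMeasurable_deriv _).aestronglyMeasurable) fun s => ?_
    exact ((f m s).le_opNorm _).trans (mul_le_mul (hfC m s)
      (norm_deriv_le_of_lipschitz (hg n)) (norm_nonneg _) hC)
  -- For fixed `m`, integration by parts moves the derivative from `g n` to `f m`. The constants `L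
  -- m` may be unbounded in `m`, which is harmless because only `n` tends to infinity here.
  have hfix : ∀ m, Tendsto (fun n => ∫ s in a..b, f m s (deriv (g n) s)) atTop (𝓝 0) := by
    intro m
    have hbd : ∀ n, |∫ s in a..b, f m s (deriv (g n) s)| ≤ c n * (2 * C + L m * |b - a|) := by
      intro n
      rw [integral_clm_apply_deriv (hf m) (hg n)]
      have hcn : 0 ≤ c n := (norm_nonneg _).trans (hgc n 0)
      have e : ∀ s, |f m s (g n s)| ≤ C * c n := fun s =>
        ((f m s).le_opNorm _).trans (mul_le_mul (hfC m s) (hgc n s) (norm_nonneg _) hC)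
      have e3 : |∫ s in a..b, deriv (f m) s (g n s)| ≤ L m * c n * |b - a| := by
        refine (Real.norm_eq_abs _).ge.trans
          (intervalIntegral.norm_integral_le_of_norm_le_const fun s _ => ?_)
        exact ((deriv (f m) s).le_opNorm _).trans (mul_le_mul
          (norm_deriv_le_of_lipschitz (hf m)) (hgc n s) (norm_nonneg _) (L m).2)
      have := abs_sub (f m b (g n b) - f m a (g n a)) (∫ s in a..b, deriv (f m) s (g n s))
      have := abs_sub (f m b (g n b)) (f m a (g n a))
      nlinarith [e a, e b]
    refine squeeze_zero_norm hbd ?_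
    simpa using hc.mul_const (2 * C + L m * |b - a|)
  rw [Metric.tendsto_atTop]
  intro ε hε
  have hK : (0 : ℝ) < 4 * (K + 1) := by positivity
  -- Replacing `f n` by `f m` costs `K` times two L¹ distances to `f'`, at most `ε / 2` in all; the
  -- integral with `f m` adds at most `ε / 4`. The `+ 1` guards against `K = 0`.
  obtain ⟨m, hm⟩ := (Metric.tendsto_atTop.1 hconv) (ε / (4 * (K + 1))) (by positivity)
  obtain ⟨n0, hn0⟩ := (Metric.tendsto_atTop.1 (hfix m)) (ε / 4) (by positivity)
  refine ⟨max m n0, fun n hn => ?_⟩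
  have h1 := hm n ((le_max_left _ _).trans hn)
  have h2 := hm m le_rfl
  have h3 := hn0 n ((le_max_right _ _).trans hn)
  rw [Real.dist_0_eq_abs] at h1 h2 h3 ⊢
  have hle : |(∫ s in a..b, f n s (deriv (g n) s)) - ∫ s in a..b, f m s (deriv (g n) s)| ≤
      K * ((∫ s in uIoc a b, ‖f n s - f' s‖) + ∫ s in uIoc a b, ‖f m s - f' s‖) := by
    rw [← intervalIntegral.integral_sub (hint n n) (hint m n)]
    refine (intervalIntegral.norm_integral_le_integral_norm_uIoc (f := fun s =>
      f n s (deriv (g n) s) - f m s (deriv (g n) s))).trans ?_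
    rw [← integral_add (hdiffint n) (hdiffint m), ← integral_const_mul]
    refine integral_mono (((hint n n).sub (hint m n)).def'.norm)
      (((hdiffint n).add (hdiffint m)).const_mul _) fun s => ?_
    have : f n s (deriv (g n) s) - f m s (deriv (g n) s) = (f n s - f m s) (deriv (g n) s) := by
      simp
    simp only [this]
    refine ((f n s - f m s).le_opNorm _).trans ?_
    rw [mul_comm]
    refine mul_le_mul (norm_deriv_le_of_lipschitz (hg n)) ?_ (norm_nonneg _) K.2
    simpa [dist_eq_norm, norm_sub_rev (f' s)] using dist_triangle (f n s) (f' s) (f m s)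
  have h1' := (le_abs_self _).trans_lt h1
  have h2' := (le_abs_self _).trans_lt h2
  have hsum : K * ((∫ s in uIoc a b, ‖f n s - f' s‖) + ∫ s in uIoc a b, ‖f m s - f' s‖) ≤ ε / 2 := by
    have hK0 : (0 : ℝ) ≤ K := K.2
    calc K * ((∫ s in uIoc a b, ‖f n s - f' s‖) + ∫ s in uIoc a b, ‖f m s - f' s‖)
        ≤ K * (ε / (4 * (K + 1)) + ε / (4 * (K + 1))) := by gcongr
      _ = (K / (K + 1)) * (ε / 2) := by field_simp; ring
      _ ≤ 1 * (ε / 2) := by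
          gcongr
          rw [div_le_one (by positivity)]; linarith
      _ = ε / 2 := one_mul _
  have := abs_sub_abs_le_abs_sub (∫ s in a..b, f n s (deriv (g n) s))
    (∫ s in a..b, f m s (deriv (g n) s))
  linarith

end Analysis

end HamOC

/-! ### Stokes' formula and exactness of the Cartan form for Lipschitz families of curves. -/

namespace HamOC

open Filter Function
open scoped NNReal

section Stokes

set_option linter.unusedSectionVars false

variable {F : Type*} [NormedAddCommGroup F] [NormedSpace ℝ F]

theorem lipschitzWith_slice_left {K : ℝ≥0} {P : ℝ → ℝ → F} (hP : LipschitzWith K (uncurry P))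
    (s : ℝ) : LipschitzWith K (fun t => P t s) := by
  refine LipschitzWith.of_dist_le_mul fun x y => ?_
  simpa [Prod.dist_eq] using hP.dist_le_mul (x, s) (y, s)

theorem lipschitzWith_slice_right {K : ℝ≥0} {P : ℝ → ℝ → F} (hP : LipschitzWith K (uncurry P))
    (t : ℝ) : LipschitzWith K (P t) := by
  refine LipschitzWith.of_dist_le_mul fun x y => ?_
  simpa [Prod.dist_eq] using hP.dist_le_mul (t, x) (t, y)

/-- Reading derivatives along one fixed sequence of increments keeps measurable limits and dominated
convergence available. -/
theorem tendsto_sequential_slope {f : ℝ → F} {t : ℝ} (hf : DifferentiableAt ℝ f t) :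
    Tendsto (fun n : ℕ => (1 / ((n : ℝ) + 1))⁻¹ • (f (t + 1 / ((n : ℝ) + 1)) - f t)) atTop
      (𝓝 (deriv f t)) :=
  (hasDerivAt_iff_tendsto_slope_zero.1 hf.hasDerivAt).comp (tendsto_nhdsWithin_iff.2
    ⟨tendsto_one_div_add_atTop_nhds_zero_nat,
      Eventually.of_forall fun n => (Nat.one_div_pos_of_nat (n := n)).ne'⟩)

/-- A Lipschitz function of `(t, s)` has a partial derivative in `t` at a.e. `s`, for a.e. `t`. -/
theorem ae_ae_differentiableAt_left [FiniteDimensional ℝ F] {K : ℝ≥0} {P : ℝ → ℝ → F}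
    (hP : LipschitzWith K (uncurry P)) :
    ∀ᵐ t : ℝ, ∀ᵐ s : ℝ, DifferentiableAt ℝ (fun τ => P τ s) t := by
  borelize F
  have hc : Continuous (uncurry fun s τ => P τ s) := hP.continuous.comp continuous_swap
  have hm := measurableSet_of_differentiableAt_with_param ℝ hc
  -- For each `s` the function of `t` is Lipschitz, so differentiable a.e.; joint measurability of
  -- the set of differentiability allows the exchange of the two quantifiers.
  refine (Measure.ae_ae_comm (p := fun s t => DifferentiableAt ℝ (fun τ => P τ s) t) hm).1 ?_
  exact ae_of_all _ fun s => (lipschitzWith_slice_left hP s).ae_differentiableAt_real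

variable {E : Type*} [NormedAddCommGroup E] [NormedSpace ℝ E] [FiniteDimensional ℝ E]
  {K : ℝ≥0} {C : ℝ} {P : ℝ → ℝ → E →L[ℝ] ℝ} {Q : ℝ → ℝ → E}

theorem intervalIntegrable_clm_apply_deriv {p : ℝ → E →L[ℝ] ℝ} {q : ℝ → E} {L : ℝ≥0}
    (hp : AEStronglyMeasurable p volume) (hpC : ∀ s, ‖p s‖ ≤ C) (hq : LipschitzWith L q)
    (a b : ℝ) : IntervalIntegrable (fun s => p s (deriv q s)) volume a b :=
  intervalIntegrable_of_bounded (C := C * L) (aestronglyMeasurable_clm_apply hp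
    (stronglyMeasurable_deriv _).aestronglyMeasurable) fun s =>
      ((p s).le_opNorm _).trans (mul_le_mul (hpC s) (norm_deriv_le_of_lipschitz hq)
        (norm_nonneg _) ((norm_nonneg _).trans (hpC 0)))

/-- The increment in `t` of `∫ P ∂ₛQ ds`. -/
theorem lineIntegral_sub (hP : LipschitzWith K (uncurry P)) (hQ : LipschitzWith K (uncurry Q))
    (hC : ∀ t s, ‖P t s‖ ≤ C) (t t' : ℝ) :
    (∫ s in (0 : ℝ)..1, P t' s (deriv (Q t') s)) - ∫ s in (0 : ℝ)..1, P t s (deriv (Q t) s) =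
      (∫ s in (0 : ℝ)..1, (P t' s - P t s) (deriv (Q t') s)) +
        (P t 1 (Q t' 1 - Q t 1) - P t 0 (Q t' 0 - Q t 0)
          - ∫ s in (0 : ℝ)..1, deriv (P t) s (Q t' s - Q t s)) := by
  have hPt := fun t => lipschitzWith_slice_right hP t
  have hQt := fun t => lipschitzWith_slice_right hQ t
  have hI : ∀ t t', IntervalIntegrable (fun s => P t s (deriv (Q t') s)) volume 0 1 := fun t t' =>
    intervalIntegrable_clm_apply_deriv (hPt t).continuous.aestronglyMeasurable (hC t) (hQt t') 0 1
  -- The function `∂ₛ(Q t' - Q t)` is bounded but not small with `t' - t`, whereas `Q t' - Q t` is;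
  -- hence the integration by parts in `s`.
  have hD := integral_clm_apply_deriv (hPt t) ((hQt t').sub (hQt t)) 0 1
  rw [← hD]
  have e1 : ∫ s in (0 : ℝ)..1, P t s (deriv (fun s => Q t' s - Q t s) s) =
      (∫ s in (0 : ℝ)..1, P t s (deriv (Q t') s)) - ∫ s in (0 : ℝ)..1, P t s (deriv (Q t) s) := by
    rw [← intervalIntegral.integral_sub (hI _ _) (hI _ _)]
    refine intervalIntegral.integral_congr_ae ?_
    filter_upwards [(hQt t).ae_differentiableAt_real, (hQt t').ae_differentiableAt_real]
      with s h1 h2 _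
    rw [deriv_fun_sub h2 h1, map_sub]
  have e2 : ∫ s in (0 : ℝ)..1, (P t' s - P t s) (deriv (Q t') s) =
      (∫ s in (0 : ℝ)..1, P t' s (deriv (Q t') s)) - ∫ s in (0 : ℝ)..1, P t s (deriv (Q t') s) := by
    rw [← intervalIntegral.integral_sub (hI _ _) (hI _ _)]
    rfl
  refine Eq.trans ?_ (congrArg₂ (· + ·) e2 e1).symm
  ring

/-- `∫ P ∂ₛQ ds` is a Lipschitz function of `t`. -/
theorem lipschitzWith_lineIntegral (hP : LipschitzWith K (uncurry P))
    (hQ : LipschitzWith K (uncurry Q)) (hC : ∀ t s, ‖P t s‖ ≤ C) :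
    LipschitzWith (2 * K * K + 2 * C * K).toNNReal
      (fun t => ∫ s in (0 : ℝ)..1, P t s (deriv (Q t) s)) := by
  have hC0 : 0 ≤ C := (norm_nonneg _).trans (hC 0 0)
  refine LipschitzWith.of_dist_le_mul fun t' t => ?_
  rw [Real.dist_eq, lineIntegral_sub hP hQ hC t t', Real.coe_toNNReal _ (by positivity)]
  have dP : ∀ s, ‖P t' s - P t s‖ ≤ K * dist t' t := fun s => by
    simpa [dist_eq_norm] using (lipschitzWith_slice_left hP s).dist_le_mul t' t
  have dQ : ∀ s, ‖Q t' s - Q t s‖ ≤ K * dist t' t := fun s => by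
    simpa [dist_eq_norm] using (lipschitzWith_slice_left hQ s).dist_le_mul t' t
  have b1 : |∫ s in (0 : ℝ)..1, (P t' s - P t s) (deriv (Q t') s)| ≤ K * dist t' t * K := by
    have := intervalIntegral.norm_integral_le_of_norm_le_const (a := (0 : ℝ)) (b := 1)
      (f := fun s => (P t' s - P t s) (deriv (Q t') s)) (C := K * dist t' t * K) fun s _ =>
      ((P t' s - P t s).le_opNorm _).trans (mul_le_mul (dP s) (norm_deriv_le_of_lipschitz
        (lipschitzWith_slice_right hQ t')) (norm_nonneg _) (by positivity))
    simpa using this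
  have b2 : |∫ s in (0 : ℝ)..1, deriv (P t) s (Q t' s - Q t s)| ≤ K * (K * dist t' t) := by
    have := intervalIntegral.norm_integral_le_of_norm_le_const (a := (0 : ℝ)) (b := 1)
      (f := fun s => deriv (P t) s (Q t' s - Q t s)) (C := K * (K * dist t' t)) fun s _ =>
      ((deriv (P t) s).le_opNorm _).trans (mul_le_mul (norm_deriv_le_of_lipschitz
        (lipschitzWith_slice_right hP t)) (dQ s) (norm_nonneg _) (by positivity))
    simpa using this
  have b3 : ∀ s, |P t s (Q t' s - Q t s)| ≤ C * (K * dist t' t) := fun s =>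
    ((P t s).le_opNorm _).trans (mul_le_mul (hC t s) (dQ s) (norm_nonneg _) hC0)
  have := b3 0
  have := b3 1
  rw [abs_le] at *
  constructor <;> nlinarith

/-- The derivative in `t` of `∫ P ∂ₛQ ds`, for Lipschitz functions (Stokes' formula). -/
theorem ae_hasDerivAt_lineIntegral (hP : LipschitzWith K (uncurry P))
    (hQ : LipschitzWith K (uncurry Q)) (hC : ∀ t s, ‖P t s‖ ≤ C) :
    ∀ᵐ t : ℝ, HasDerivAt (fun t => ∫ s in (0 : ℝ)..1, P t s (deriv (Q t) s))
      ((∫ s in (0 : ℝ)..1, (deriv (fun τ => P τ s) t (deriv (Q t) s)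
          - deriv (P t) s (deriv (fun τ => Q τ s) t)))
        + (P t 1 (deriv (fun τ => Q τ 1) t) - P t 0 (deriv (fun τ => Q τ 0) t))) t := by
  have hC0 : 0 ≤ C := (norm_nonneg _).trans (hC 0 0)
  have hPt := fun t => lipschitzWith_slice_right hP t
  have hQt := fun t => lipschitzWith_slice_right hQ t
  -- The line integral is Lipschitz in `t`, hence differentiable a.e.; its derivative then only has
  -- to be identified along a sequence of increments.
  filter_upwards [(lipschitzWith_lineIntegral hP hQ hC).ae_differentiableAt_real,
    ae_ae_differentiableAt_left hP, ae_ae_differentiableAt_left hQ,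
    (lipschitzWith_slice_left hQ 0).ae_differentiableAt_real,
    (lipschitzWith_slice_left hQ 1).ae_differentiableAt_real] with t hD hPd hQd hQ0 hQ1
  set D := fun t => ∫ s in (0 : ℝ)..1, P t s (deriv (Q t) s) with hDdef
  set δ : ℕ → ℝ := fun n => 1 / ((n : ℝ) + 1) with hδ
  have hδpos : ∀ n, 0 < δ n := fun n => Nat.one_div_pos_of_nat
  have hδ0 : Tendsto δ atTop (𝓝 0) := tendsto_one_div_add_atTop_nhds_zero_nat
  have dP : ∀ n s, ‖P (t + δ n) s - P t s‖ ≤ K * δ n := fun n s => by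
    simpa [dist_eq_norm, abs_of_pos (hδpos n)] using
      (lipschitzWith_slice_left hP s).dist_le_mul (t + δ n) t
  have dQ : ∀ n s, ‖Q (t + δ n) s - Q t s‖ ≤ K * δ n := fun n s => by
    simpa [dist_eq_norm, abs_of_pos (hδpos n)] using
      (lipschitzWith_slice_left hQ s).dist_le_mul (t + δ n) t
  -- the difference quotients of `P` and `Q` in `t`
  set f : ℕ → ℝ → E →L[ℝ] ℝ := fun n s => (δ n)⁻¹ • (P (t + δ n) s - P t s) with hf
  set r : ℕ → ℝ → E := fun n s => (δ n)⁻¹ • (Q (t + δ n) s - Q t s) with hr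
  have hfC : ∀ n s, ‖f n s‖ ≤ K := fun n s => by
    rw [hf, norm_smul, norm_inv, Real.norm_of_nonneg (hδpos n).le, inv_mul_le_iff₀ (hδpos n),
      mul_comm]
    exact dP n s
  have hrC : ∀ n s, ‖r n s‖ ≤ K := fun n s => by
    rw [hr, norm_smul, norm_inv, Real.norm_of_nonneg (hδpos n).le, inv_mul_le_iff₀ (hδpos n),
      mul_comm]
    exact dQ n s
  have hflim : ∀ᵐ s, Tendsto (fun n => f n s) atTop (𝓝 (deriv (fun τ => P τ s) t)) := by
    filter_upwards [hPd] with s hs using tendsto_sequential_slope hs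
  have hrlim : ∀ᵐ s, Tendsto (fun n => r n s) atTop (𝓝 (deriv (fun τ => Q τ s) t)) := by
    filter_upwards [hQd] with s hs using tendsto_sequential_slope hs
  have hfL : ∀ n, ∃ L, LipschitzWith L (f n) := fun n =>
    ⟨_, (lipschitzWith_smul (δ n)⁻¹).comp ((hPt (t + δ n)).sub (hPt t))⟩
  choose L hL using hfL
  have hfm : ∀ n, AEStronglyMeasurable (f n) volume := fun n => (hL n).continuous.aestronglyMeasurable
  have hrm : ∀ n, AEStronglyMeasurable (r n) volume := fun n =>
    (((hQt (t + δ n)).continuous.sub (hQt t).continuous).const_smul _).aestronglyMeasurable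
  -- Here `∂ₛ(Q (t + δ n) - Q t)` tends to zero only weakly, but the quotients `f n` converge
  -- boundedly a.e., so the weak-strong lemma applies. The Lipschitz constants of `f n` in `s` may
  -- blow up.
  have T1 : Tendsto (fun n => ∫ s in (0 : ℝ)..1, f n s (deriv (fun s => Q (t + δ n) s - Q t s) s))
      atTop (𝓝 0) :=
    tendsto_integral_clm_apply_deriv (K := K + K) (c := fun n => K * δ n) hL hfC hflim
      (fun n => (hQt (t + δ n)).sub (hQt t)) dQ (by simpa using hδ0.const_mul (K : ℝ)) 0 1
  have T2 : Tendsto (fun n => ∫ s in (0 : ℝ)..1, f n s (deriv (Q t) s)) atTop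
      (𝓝 (∫ s in (0 : ℝ)..1, deriv (fun τ => P τ s) t (deriv (Q t) s))) := by
    refine intervalIntegral.tendsto_integral_filter_of_dominated_convergence (fun _ => (K * K : ℝ))
      (Eventually.of_forall fun n => (aestronglyMeasurable_clm_apply (hfm n)
        (stronglyMeasurable_deriv _).aestronglyMeasurable).restrict)
      (Eventually.of_forall fun n => ae_of_all _ fun s _ => ?_) (by simp) ?_
    · exact ((f n s).le_opNorm _).trans (mul_le_mul (hfC n s) (norm_deriv_le_of_lipschitz (hQt t))
        (norm_nonneg _) K.2)
    · filter_upwards [hflim] with s hs _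
      exact ((ContinuousLinearMap.apply ℝ ℝ (deriv (Q t) s)).continuous.tendsto _).comp hs
  have T3 : Tendsto (fun n => ∫ s in (0 : ℝ)..1, deriv (P t) s (r n s)) atTop
      (𝓝 (∫ s in (0 : ℝ)..1, deriv (P t) s (deriv (fun τ => Q τ s) t))) := by
    refine intervalIntegral.tendsto_integral_filter_of_dominated_convergence (fun _ => (K * K : ℝ))
      (Eventually.of_forall fun n => (aestronglyMeasurable_clm_apply
        (stronglyMeasurable_deriv _).aestronglyMeasurable (hrm n)).restrict)
      (Eventually.of_forall fun n => ae_of_all _ fun s _ => ?_) (by simp) ?_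
    · exact ((deriv (P t) s).le_opNorm _).trans (mul_le_mul (norm_deriv_le_of_lipschitz (hPt t))
        (hrC n s) (norm_nonneg _) K.2)
    · filter_upwards [hrlim] with s hs _
      exact ((deriv (P t) s).continuous.tendsto _).comp hs
  have T4 : ∀ s, DifferentiableAt ℝ (fun τ => Q τ s) t →
      Tendsto (fun n => P t s (r n s)) atTop (𝓝 (P t s (deriv (fun τ => Q τ s) t))) :=
    fun s hs => ((P t s).continuous.tendsto _).comp (tendsto_sequential_slope hs)
  have hsplit : ∀ n, (δ n)⁻¹ • (D (t + δ n) - D t) =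
      (∫ s in (0 : ℝ)..1, f n s (deriv (fun s => Q (t + δ n) s - Q t s) s))
        + (∫ s in (0 : ℝ)..1, f n s (deriv (Q t) s))
        - (∫ s in (0 : ℝ)..1, deriv (P t) s (r n s)) + (P t 1 (r n 1) - P t 0 (r n 0)) := by
    intro n
    have e1 : (∫ s in (0 : ℝ)..1, f n s (deriv (fun s => Q (t + δ n) s - Q t s) s))
        + (∫ s in (0 : ℝ)..1, f n s (deriv (Q t) s))
        = (δ n)⁻¹ • ∫ s in (0 : ℝ)..1, (P (t + δ n) s - P t s) (deriv (Q (t + δ n)) s) := by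
      rw [← intervalIntegral.integral_add (intervalIntegrable_clm_apply_deriv (hfm n) (hfC n)
          ((hQt (t + δ n)).sub (hQt t)) 0 1)
        (intervalIntegrable_clm_apply_deriv (hfm n) (hfC n) (hQt t) 0 1),
        ← intervalIntegral.integral_smul]
      refine intervalIntegral.integral_congr_ae ?_
      filter_upwards [(hQt t).ae_differentiableAt_real, (hQt (t + δ n)).ae_differentiableAt_real]
        with s h1 h2 _
      have : deriv (fun s => Q (t + δ n) s - Q t s) s = deriv (Q (t + δ n)) s - deriv (Q t) s :=
        deriv_fun_sub h2 h1
      rw [this, map_sub, sub_add_cancel]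
      simp [hf]
    have e2 : (∫ s in (0 : ℝ)..1, deriv (P t) s (r n s))
        = (δ n)⁻¹ • ∫ s in (0 : ℝ)..1, deriv (P t) s (Q (t + δ n) s - Q t s) := by
      rw [← intervalIntegral.integral_smul]
      simp only [hr, map_smul]
    have := lineIntegral_sub hP hQ hC t (t + δ n)
    rw [e1, e2, hDdef]
    simp only [this, hr, map_smul, smul_eq_mul]
    ring
  have hlim := ((T1.add T2).sub T3).add ((T4 1 hQ1).sub (T4 0 hQ0))
  have huniq := tendsto_nhds_unique ((tendsto_sequential_slope hD).congr hsplit) hlim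
  have hres := hD.hasDerivAt
  rw [huniq, zero_add] at hres
  suffices hsub : (∫ s in (0 : ℝ)..1, (deriv (fun τ => P τ s) t (deriv (Q t) s)
      - deriv (P t) s (deriv (fun τ => Q τ s) t))) =
      (∫ s in (0 : ℝ)..1, deriv (fun τ => P τ s) t (deriv (Q t) s))
        - ∫ s in (0 : ℝ)..1, deriv (P t) s (deriv (fun τ => Q τ s) t) by
    rw [hsub]; exact hres
  refine intervalIntegral.integral_sub ?_ ?_
  · refine intervalIntegrable_of_bounded (C := K * K) (aestronglyMeasurable_clm_apply
      (aestronglyMeasurable_of_tendsto_ae _ hfm hflim)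
        (stronglyMeasurable_deriv _).aestronglyMeasurable) fun s => ?_
    exact ((deriv (fun τ => P τ s) t).le_opNorm _).trans (mul_le_mul
      (norm_deriv_le_of_lipschitz (lipschitzWith_slice_left hP s))
      (norm_deriv_le_of_lipschitz (hQt t)) (norm_nonneg _) K.2)
  · refine intervalIntegrable_of_bounded (C := K * K) (aestronglyMeasurable_clm_apply
      (stronglyMeasurable_deriv _).aestronglyMeasurable
      (aestronglyMeasurable_of_tendsto_ae _ hrm hrlim)) fun s => ?_
    exact ((deriv (P t) s).le_opNorm _).trans (mul_le_mul (norm_deriv_le_of_lipschitz (hPt t))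
      (norm_deriv_le_of_lipschitz (lipschitzWith_slice_left hQ s)) (norm_nonneg _) K.2)

/-- If, for each `s` and a.e. `t`, `h t` has a first order expansion along the curve
`s ↦ (Q t s, P t s)` whose coefficients are the `t`-derivatives of the curve, then its derivative
is given by the chain rule for a.e. `t` and a.e. `s`. -/
theorem ae_ae_deriv_eq_of_expansion {μ : Measure ℝ} [SFinite μ]
    (hP : LipschitzWith K (uncurry P)) (hQ : LipschitzWith K (uncurry Q)) {h : ℝ → ℝ → ℝ}
    (h1 : ∀ s, AEMeasurable (fun t => h t s) μ) (h2 : ∀ᵐ t ∂μ, Continuous (h t))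
    (h3 : ∀ s, ∀ᵐ t ∂μ, (fun s' => h t s' - h t s
      - ((P t s' - P t s) (deriv (fun τ => Q τ s) t)
        - deriv (fun τ => P τ s) t (Q t s' - Q t s))) =o[𝓝 s] (fun s' => s' - s)) :
    ∀ᵐ t ∂μ, ∀ᵐ s, DifferentiableAt ℝ (h t) s → deriv (h t) s =
      deriv (P t) s (deriv (fun τ => Q τ s) t) - deriv (fun τ => P τ s) t (deriv (Q t) s) := by
  obtain ⟨k, hk, hkh⟩ := exists_measurable_modification h1 h2
  borelize E (E →L[ℝ] ℝ)
  have : SecondCountableTopology (E →L[ℝ] ℝ) := inferInstance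
  have : SecondCountableTopology E := inferInstance
  set δ : ℕ → ℝ := fun n => 1 / ((n : ℝ) + 1) with hδ
  have hδpos : ∀ n, 0 < δ n := fun n => Nat.one_div_pos_of_nat
  have hδ0 : Tendsto δ atTop (𝓝 0) := tendsto_one_div_add_atTop_nhds_zero_nat
  -- the remainder of the expansion along the sequence `s + δ n`
  set R : ℕ → ℝ × ℝ → ℝ := fun n z => (δ n)⁻¹ * (k (z.1 + δ n) z.2 - k z.1 z.2
      - ((P z.2 (z.1 + δ n) - P z.2 z.1) (deriv (fun τ => Q τ z.1) z.2)
        - deriv (fun τ => P τ z.1) z.2 (Q z.2 (z.1 + δ n) - Q z.2 z.1))) with hR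
  have mQ : Measurable fun z : ℝ × ℝ => deriv (fun τ => Q τ z.1) z.2 :=
    measurable_deriv_with_param (f := fun s τ => Q τ s) (hQ.continuous.comp continuous_swap)
  have mP : Measurable fun z : ℝ × ℝ => deriv (fun τ => P τ z.1) z.2 :=
    measurable_deriv_with_param (f := fun s τ => P τ s) (hP.continuous.comp continuous_swap)
  have mapp : ∀ {f : ℝ × ℝ → E →L[ℝ] ℝ} {g : ℝ × ℝ → E}, Measurable f → Measurable g →
      Measurable fun z => f z (g z) := fun hf hg =>
    (isBoundedBilinearMap_apply (𝕜 := ℝ) (E := E) (F := ℝ)).continuous.measurable.comp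
      (hf.prodMk hg)
  have hRm : ∀ n, Measurable (R n) := by
    intro n
    have c1 : Measurable fun z : ℝ × ℝ => P z.2 (z.1 + δ n) - P z.2 z.1 :=
      ((hP.continuous.comp (f := fun z : ℝ × ℝ => (z.2, z.1 + δ n)) (by fun_prop)).sub
        (hP.continuous.comp (f := fun z : ℝ × ℝ => (z.2, z.1)) (by fun_prop))).measurable
    have c2 : Measurable fun z : ℝ × ℝ => Q z.2 (z.1 + δ n) - Q z.2 z.1 :=
      ((hQ.continuous.comp (f := fun z : ℝ × ℝ => (z.2, z.1 + δ n)) (by fun_prop)).sub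
        (hQ.continuous.comp (f := fun z : ℝ × ℝ => (z.2, z.1)) (by fun_prop))).measurable
    have k1 : Measurable fun z : ℝ × ℝ => k (z.1 + δ n) z.2 :=
      hk.comp (f := fun z : ℝ × ℝ => (z.1 + δ n, z.2)) (by fun_prop)
    have k2 : Measurable fun z : ℝ × ℝ => k z.1 z.2 := hk
    exact ((k1.sub k2).sub ((mapp c1 mQ).sub (mapp mP c2))).const_mul _
  -- In `h3` the exceptional set of times depends on `s`. Joint measurability, available for the
  -- modification `k`, lets Fubini convert this into a.e. `s` for a.e. `t`.
  have hset : MeasurableSet {z : ℝ × ℝ | Tendsto (fun n => R n z) atTop (𝓝 0)} :=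
    measurableSet_tendsto _ hRm
  have hfix : ∀ᵐ s : ℝ, ∀ᵐ t ∂μ, Tendsto (fun n => R n (s, t)) atTop (𝓝 0) := by
    refine ae_of_all _ fun s => ?_
    filter_upwards [h3 s, hkh] with t ht hkt
    have hs : Tendsto (fun n => s + δ n) atTop (𝓝 s) := by simpa using hδ0.const_add s
    have := (ht.comp_tendsto hs).tendsto_div_nhds_zero
    refine this.congr fun n => ?_
    simp only [hR, comp_apply, hkt, add_sub_cancel_left]
    rw [div_eq_inv_mul]
  have hswap := (Measure.ae_ae_comm (p := fun s t => Tendsto (fun n => R n (s, t)) atTop (𝓝 0))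
    hset).1 hfix
  filter_upwards [hswap, hkh] with t ht hkt
  filter_upwards [ht, (lipschitzWith_slice_right hP t).ae_differentiableAt_real,
    (lipschitzWith_slice_right hQ t).ae_differentiableAt_real] with s hs hPs hQs hhs
  have l1 := tendsto_sequential_slope hhs
  have l2 := ((ContinuousLinearMap.apply ℝ ℝ (deriv (fun τ => Q τ s) t)).continuous.tendsto _).comp
    (tendsto_sequential_slope hPs)
  have l3 := ((deriv (fun τ => P τ s) t).continuous.tendsto _).comp (tendsto_sequential_slope hQs)
  have := tendsto_nhds_unique hs ((l1.sub (l2.sub l3)).congr fun n => by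
    simp only [hR, hkt, comp_apply, ContinuousLinearMap.apply_apply, map_smul, smul_eq_mul]
    ring)
  simp only [ContinuousLinearMap.apply_apply] at this
  linarith

/-- The exactness of the Poincaré-Cartan form along a Lipschitz flow, in coordinates. -/
theorem lineIntegral_sub_eq_integral_cartan (hP : LipschitzWith K (uncurry P))
    (hQ : LipschitzWith K (uncurry Q)) (hC : ∀ t s, ‖P t s‖ ≤ C) {h : ℝ → ℝ → ℝ} {a b : ℝ}
    (h1 : ∀ s, AEMeasurable (fun t => h t s) (volume.restrict (uIcc a b)))
    (h2 : ∀ᵐ t ∂(volume.restrict (uIcc a b)), LocallyLipschitz (h t))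
    (h3 : ∀ s, ∀ᵐ t ∂(volume.restrict (uIcc a b)), (fun s' => h t s' - h t s
      - ((P t s' - P t s) (deriv (fun τ => Q τ s) t)
        - deriv (fun τ => P τ s) t (Q t s' - Q t s))) =o[𝓝 s] (fun s' => s' - s))
    {g : ℝ → ℝ → ℝ} (hg : ∀ s, ∀ᵐ t ∂(volume.restrict (uIcc a b)),
      g t s = P t s (deriv (fun τ => Q τ s) t) - h t s) :
    (∫ s in (0 : ℝ)..1, P b s (deriv (Q b) s)) - ∫ s in (0 : ℝ)..1, P a s (deriv (Q a) s) =
      ∫ t in a..b, (g t 1 - g t 0) := by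
  have hac : AbsolutelyContinuousOnInterval (fun t => ∫ s in (0 : ℝ)..1, P t s (deriv (Q t) s)) a b :=
    ((lipschitzWith_lineIntegral hP hQ hC).lipschitzOnWith
      (s := uIcc a b)).absolutelyContinuousOnInterval
  have hae := ae_ae_deriv_eq_of_expansion hP hQ h1
    (h2.mono fun t ht => ht.continuous) h3
  rw [← hac.integral_deriv_eq_sub]
  refine intervalIntegral.integral_congr_ae ?_
  rw [ae_restrict_iff' measurableSet_uIcc] at hae h2
  have hg0 := (ae_restrict_iff' measurableSet_uIcc).1 (hg 0)
  have hg1 := (ae_restrict_iff' measurableSet_uIcc).1 (hg 1)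
  filter_upwards [ae_hasDerivAt_lineIntegral hP hQ hC, hae, h2, hg0, hg1] with t hD he hlip e0 e1 ht
  have ht' := uIoc_subset_uIcc ht
  rw [hD.deriv, e0 ht', e1 ht']
  obtain ⟨L, hL⟩ := ((hlip ht').locallyLipschitzOn
    (s := uIcc (0 : ℝ) 1)).exists_lipschitzOnWith_of_compact isCompact_uIcc
  have hac' := hL.absolutelyContinuousOnInterval
  have hFTC := hac'.integral_deriv_eq_sub
  -- The interior term of Stokes' formula is minus the `s`-derivative of `h`, so it integrates to `h
  -- t 0 - h t 1`. Together with the boundary term in `P ∂ₜQ` this is the variation of `g`.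
  have : ∫ s in (0 : ℝ)..1, deriv (h t) s = - ∫ s in (0 : ℝ)..1,
      (deriv (fun τ => P τ s) t (deriv (Q t) s) - deriv (P t) s (deriv (fun τ => Q τ s) t)) := by
    rw [← intervalIntegral.integral_neg]
    refine intervalIntegral.integral_congr_ae ?_
    filter_upwards [he ht', hac'.ae_differentiableAt] with s hs hd hs01
    rw [hs (hd (uIoc_subset_uIcc hs01)), neg_sub]
  linarith

end Stokes

end HamOC

/-! ### Charts of the cotangent bundle and coordinate forms of `s` and `σ`. -/

namespace HamOC

open Filter Function
open scoped NNReal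

section Boundaryless

variable {E' : Type*} [NormedAddCommGroup E'] [NormedSpace ℝ E']
  {H' : Type*} [TopologicalSpace H'] {I' : ModelWithCorners ℝ E' H'} [I'.Boundaryless]
  {N : Type*} [TopologicalSpace N] [ChartedSpace H' N]

theorem mdifferentiableAt_extChartAt_symm [IsManifold I' 1 N] {x : N} {z : E'}
    (hz : z ∈ (extChartAt I' x).target) :
    MDifferentiableAt 𝓘(ℝ, E') I' (extChartAt I' x).symm z := by
  have h := mdifferentiableWithinAt_extChartAt_symm (I := I') hz
  rwa [ModelWithCorners.Boundaryless.range_eq_univ, mdifferentiableWithinAt_univ] at h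

theorem mfderiv_extChartAt_mfderiv_symm [IsManifold I' 1 N] {x y : N}
    (hy : y ∈ (extChartAt I' x).source) (w : E') :
    mfderiv I' 𝓘(ℝ, E') (extChartAt I' x) y
      (mfderiv 𝓘(ℝ, E') I' (extChartAt I' x).symm (extChartAt I' x y) w) = w := by
  have h := mfderiv_extChartAt_comp_mfderivWithin_extChartAt_symm' (I := I') hy
  rw [ModelWithCorners.Boundaryless.range_eq_univ, mfderivWithin_univ] at h
  exact congrArg (fun A : E' →L[ℝ] E' => A w) h

theorem mfderiv_symm_mfderiv_extChartAt [IsManifold I' 1 N] {x y : N}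
    (hy : y ∈ (extChartAt I' x).source) (v : TangentSpace I' y) :
    mfderiv 𝓘(ℝ, E') I' (extChartAt I' x).symm (extChartAt I' x y)
      (mfderiv I' 𝓘(ℝ, E') (extChartAt I' x) y v) = v := by
  have h := mfderivWithin_extChartAt_symm_comp_mfderiv_extChartAt' (I := I') hy
  rw [ModelWithCorners.Boundaryless.range_eq_univ, mfderivWithin_univ] at h
  exact congrArg (fun A : E' →L[ℝ] E' => A v) h

theorem contDiffAt_extChartAt_coord_change [IsManifold I' 2 N] {x y : N}
    (hy : y ∈ (extChartAt I' x).source) :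
    ContDiffAt ℝ 2 (extChartAt I' x ∘ (extChartAt I' y).symm) (extChartAt I' y y) := by
  have h := contDiffWithinAt_ext_coord_change (n := 2) (I := I') x y
    (y := extChartAt I' y y) ⟨mem_extChartAt_target y, by
      change (extChartAt I' y).symm (extChartAt I' y y) ∈ (extChartAt I' x).source
      rwa [extChartAt_to_inv]⟩
  rwa [ModelWithCorners.Boundaryless.range_eq_univ, contDiffWithinAt_univ] at h

/-- The differential at `y` of the chart at `x`, with `T_y N` identified with the model space. -/
noncomputable def chartDeriv (I' : ModelWithCorners ℝ E' H') (x y : N) : E' →L[ℝ] E' :=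
  mfderiv I' 𝓘(ℝ, E') (extChartAt I' x) y

/-- Tangent vectors at `y` are recorded in the preferred chart at `y`, so the differential of
another chart is the derivative of a change of coordinates. -/
theorem chartDeriv_eq_fderiv [IsManifold I' 1 N] {x y : N}
    (hy : y ∈ (extChartAt I' x).source) :
    chartDeriv I' x y =
      fderiv ℝ (extChartAt I' x ∘ (extChartAt I' y).symm) (extChartAt I' y y) := by
  have h : MDifferentiableAt I' 𝓘(ℝ, E') (extChartAt I' x) y :=
    mdifferentiableAt_extChartAt (by rwa [extChartAt_source] at hy)
  refine (if_pos h).trans ?_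
  rw [ModelWithCorners.Boundaryless.range_eq_univ, fderivWithin_univ]
  rfl

end Boundaryless

section Cotangent

variable {E : Type*} [NormedAddCommGroup E] [NormedSpace ℝ E]
  {M : Type*} [TopologicalSpace M] [ChartedSpace E M] [IsManifold 𝓘(ℝ, E) ∞ M]

theorem mem_cotChart_source {ℓ0 ℓ : Cotangent E M} :
    ℓ ∈ (extChartAt (cotModel E) ℓ0).source ↔ ℓ.proj ∈ (extChartAt 𝓘(ℝ, E) ℓ0.proj).source := by
  rw [extChartAt_source, extChartAt_source, FiberBundle.chartedSpace_chartAt]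
  simp [hom_trivializationAt_apply]

theorem cotChart_fst (ℓ0 ℓ : Cotangent E M) :
    (extChartAt (cotModel E) ℓ0 ℓ).1 = extChartAt 𝓘(ℝ, E) ℓ0.proj ℓ.proj := by
  have : extChartAt (cotModel E) ℓ0 ℓ = chartAt (ModelProd E (E →L[ℝ] ℝ)) ℓ0 ℓ := rfl
  rw [this, hom_chart ℓ0 ℓ]
  rfl

/-- The fibre coordinate is precomposition with the inverse of the base trivialization, which is the
differential of the inverse base chart; the trivial factor `ℝ` contributes nothing. -/
theorem cotChart_snd {ℓ0 ℓ : Cotangent E M} (h : ℓ ∈ (extChartAt (cotModel E) ℓ0).source) (w : E) :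
    (extChartAt (cotModel E) ℓ0 ℓ).2 w = covec ℓ (mfderiv 𝓘(ℝ, E) 𝓘(ℝ, E)
      (extChartAt 𝓘(ℝ, E) ℓ0.proj).symm (extChartAt 𝓘(ℝ, E) ℓ0.proj ℓ.proj) w) := by
  have hs := mem_cotChart_source.1 h
  rw [extChartAt_source] at hs
  have e : extChartAt (cotModel E) ℓ0 ℓ = chartAt (ModelProd E (E →L[ℝ] ℝ)) ℓ0 ℓ := rfl
  have h1 := TangentBundle.symmL_trivializationAt (I := 𝓘(ℝ, E)) hs
  simp only [modelWithCornersSelf_coe, range_id, mfderivWithin_univ] at h1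
  rw [e, hom_chart ℓ0 ℓ, ← h1]
  simp [ContinuousLinearMap.inCoordinates, covec]
  rfl

/-- The coordinates of a covector, evaluated on the coordinates of a vector. -/
theorem covec_eq_cotChart_snd {ℓ0 ℓ : Cotangent E M}
    (h : ℓ ∈ (extChartAt (cotModel E) ℓ0).source) (v : E) :
    covec ℓ v = (extChartAt (cotModel E) ℓ0 ℓ).2 (chartDeriv 𝓘(ℝ, E) ℓ0.proj ℓ.proj v) := by
  have hs := mem_cotChart_source.1 h
  refine Eq.trans ?_ (cotChart_snd h _).symm
  exact congrArg (covec ℓ) (mfderiv_symm_mfderiv_extChartAt hs v).symm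

/-- The projection reads `Prod.fst` in bundle charts, and the relation comes from differentiating
that commutation. -/
theorem mfderiv_cotChart_fst {ℓ0 ℓ : Cotangent E M}
    (h : ℓ ∈ (extChartAt (cotModel E) ℓ0).source) (v : E × (E →L[ℝ] ℝ)) :
    (chartDeriv (cotModel E) ℓ0 ℓ v).1 =
      chartDeriv 𝓘(ℝ, E) ℓ0.proj ℓ.proj (mfderiv (cotModel E) 𝓘(ℝ, E) (Bundle.TotalSpace.proj : Cotangent E M → M) ℓ v) := by
  have hs := mem_cotChart_source.1 h
  have hproj : MDifferentiableAt (cotModel E) 𝓘(ℝ, E)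
      (Bundle.TotalSpace.proj : Cotangent E M → M) ℓ :=
    (Bundle.contMDiff_proj (n := 1) _).mdifferentiable one_ne_zero ℓ
  have hc : MDifferentiableAt 𝓘(ℝ, E) 𝓘(ℝ, E) (extChartAt 𝓘(ℝ, E) ℓ0.proj) ℓ.proj :=
    mdifferentiableAt_extChartAt (by rwa [extChartAt_source] at hs)
  have hΦ : MDifferentiableAt (cotModel E) 𝓘(ℝ, E × (E →L[ℝ] ℝ)) (extChartAt (cotModel E) ℓ0) ℓ :=
    mdifferentiableAt_extChartAt (by rwa [extChartAt_source] at h)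
  have hfst : MDifferentiableAt 𝓘(ℝ, E × (E →L[ℝ] ℝ)) 𝓘(ℝ, E)
      (Prod.fst : E × (E →L[ℝ] ℝ) → E) (extChartAt (cotModel E) ℓ0 ℓ) :=
    differentiableAt_fst.mdifferentiableAt
  have e : (Prod.fst : E × (E →L[ℝ] ℝ) → E) ∘ extChartAt (cotModel E) ℓ0 =
      extChartAt 𝓘(ℝ, E) ℓ0.proj ∘ (Bundle.TotalSpace.proj : Cotangent E M → M) :=
    funext fun ℓ' => cotChart_fst ℓ0 ℓ'
  have h1 := mfderiv_comp ℓ hc hproj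
  have h2 := mfderiv_comp ℓ hfst hΦ
  rw [e, h1] at h2
  have h3 := congrArg (fun A : (E × (E →L[ℝ] ℝ)) →L[ℝ] E => A v) h2
  refine Eq.trans ?_ h3.symm
  have hf : mfderiv 𝓘(ℝ, E × (E →L[ℝ] ℝ)) 𝓘(ℝ, E) (Prod.fst : E × (E →L[ℝ] ℝ) → E)
      (extChartAt (cotModel E) ℓ0 ℓ) = ContinuousLinearMap.fst ℝ E (E →L[ℝ] ℝ) := by
    rw [mfderiv_eq_fderiv]; exact fderiv_fst
  exact (congrArg (fun A : E × (E →L[ℝ] ℝ) →L[ℝ] E =>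
    A (mfderiv (cotModel E) 𝓘(ℝ, E × (E →L[ℝ] ℝ)) (extChartAt (cotModel E) ℓ0) ℓ v)) hf).symm

/-- The Liouville form is `p dq` in every chart of the cotangent bundle. -/
theorem liouville_eq_cotChart {ℓ0 ℓ : Cotangent E M}
    (h : ℓ ∈ (extChartAt (cotModel E) ℓ0).source) (v : E × (E →L[ℝ] ℝ)) :
    liouville ℓ v = (extChartAt (cotModel E) ℓ0 ℓ).2 (chartDeriv (cotModel E) ℓ0 ℓ v).1 := by
  rw [mfderiv_cotChart_fst h]
  exact covec_eq_cotChart_snd h _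

/-- The symplectic form is `dp ∧ dq` in every chart of the cotangent bundle. -/
theorem symplForm_eq_cotChart {ℓ0 ℓ : Cotangent E M}
    (h : ℓ ∈ (extChartAt (cotModel E) ℓ0).source) (v w : E × (E →L[ℝ] ℝ)) :
    symplForm ℓ v w =
      (chartDeriv (cotModel E) ℓ0 ℓ v).2 (chartDeriv (cotModel E) ℓ0 ℓ w).1
      - (chartDeriv (cotModel E) ℓ0 ℓ w).2 (chartDeriv (cotModel E) ℓ0 ℓ v).1 := by
  set τ : E × (E →L[ℝ] ℝ) → E × (E →L[ℝ] ℝ) :=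
    extChartAt (cotModel E) ℓ0 ∘ (extChartAt (cotModel E) ℓ).symm with hτ
  set z0 : E × (E →L[ℝ] ℝ) := extChartAt (cotModel E) ℓ ℓ with hz0
  have hτ2 : ContDiffAt ℝ 2 τ z0 := contDiffAt_extChartAt_coord_change h
  rw [chartDeriv_eq_fderiv h, symplForm_apply]
  have hnear : ∀ᶠ z in 𝓝 z0, z ∈ (extChartAt (cotModel E) ℓ).target ∧
      (extChartAt (cotModel E) ℓ).symm z ∈ (extChartAt (cotModel E) ℓ0).source := by
    refine Filter.Eventually.and (extChartAt_target_mem_nhds (I := cotModel E) ℓ) ?_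
    have hc : ContinuousAt (extChartAt (cotModel E) ℓ).symm z0 := continuousAt_extChartAt_symm ℓ
    refine hc.preimage_mem_nhds ?_
    have e : (extChartAt (cotModel E) ℓ).symm z0 = ℓ := extChartAt_to_inv ℓ
    rw [e]
    exact extChartAt_source_mem_nhds' h
  -- The change of coordinates `τ` preserves `p dq`, since both charts compute the same Liouville
  -- form.
  have key : ∀ᶠ z in 𝓝 z0, ∀ v : E × (E →L[ℝ] ℝ), z.2 v.1 = (τ z).2 (fderiv ℝ τ z v).1 := by
    filter_upwards [hnear] with z hz v
    have h1 : (extChartAt (cotModel E) ℓ).symm z ∈ (extChartAt (cotModel E) ℓ).source :=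
      (extChartAt (cotModel E) ℓ).map_target hz.1
    have hr := (extChartAt (cotModel E) ℓ).right_inv hz.1
    have hsym := mdifferentiableAt_extChartAt_symm (I' := cotModel E) hz.1
    have hΦ : MDifferentiableAt (cotModel E) 𝓘(ℝ, E × (E →L[ℝ] ℝ)) (extChartAt (cotModel E) ℓ0)
        ((extChartAt (cotModel E) ℓ).symm z) :=
      mdifferentiableAt_extChartAt (by rw [← extChartAt_source (cotModel E)]; exact hz.2)
    have hcomp := mfderiv_comp z hΦ hsym
    have e1 := liouville_eq_cotChart h1
      (mfderiv 𝓘(ℝ, E × (E →L[ℝ] ℝ)) (cotModel E) (extChartAt (cotModel E) ℓ).symm z v)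
    have e2 := liouville_eq_cotChart hz.2
      (mfderiv 𝓘(ℝ, E × (E →L[ℝ] ℝ)) (cotModel E) (extChartAt (cotModel E) ℓ).symm z v)
    have e3 := mfderiv_extChartAt_mfderiv_symm h1 v
    rw [hr] at e3
    have e4 : fderiv ℝ τ z v = chartDeriv (cotModel E) ℓ0 ((extChartAt (cotModel E) ℓ).symm z)
        (mfderiv 𝓘(ℝ, E × (E →L[ℝ] ℝ)) (cotModel E) (extChartAt (cotModel E) ℓ).symm z v) := by
      refine Eq.trans ?_ (congrArg (fun A : E × (E →L[ℝ] ℝ) →L[ℝ] E × (E →L[ℝ] ℝ) => A v) hcomp)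
      exact congrArg (fun A : E × (E →L[ℝ] ℝ) →L[ℝ] E × (E →L[ℝ] ℝ) => A v) mfderiv_eq_fderiv.symm
    rw [e4]
    refine Eq.trans ?_ (e1.symm.trans e2)
    exact congrArg₂ (fun (a : E × (E →L[ℝ] ℝ)) (b : E × (E →L[ℝ] ℝ)) => a.2 b.1) hr.symm e3.symm
  have hd1 : DifferentiableAt ℝ τ z0 := hτ2.differentiableAt (by norm_num)
  have hd2 : DifferentiableAt ℝ (fderiv ℝ τ) z0 :=
    (hτ2.fderiv_right (m := 1) (by norm_num)).differentiableAt (by norm_num)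
  have hsymm := (hτ2.isSymmSndFDerivAt (by simp)).eq
  -- This is the derivative of the preceding identity in the direction `w`. The second derivative of
  -- `τ` is symmetric in `v` and `w`, so it drops out on antisymmetrizing.
  have hdir : ∀ v w : E × (E →L[ℝ] ℝ), w.2 v.1 =
      (fderiv ℝ τ z0 w).2 (fderiv ℝ τ z0 v).1 + (τ z0).2 (fderiv ℝ (fderiv ℝ τ) z0 w v).1 := by
    intro v w
    have l1 : HasFDerivAt (fun z : E × (E →L[ℝ] ℝ) => z.2 v.1)
        ((ContinuousLinearMap.apply ℝ ℝ v.1).comp (ContinuousLinearMap.snd ℝ E (E →L[ℝ] ℝ))) z0 :=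
      ((ContinuousLinearMap.apply ℝ ℝ v.1).comp
        (ContinuousLinearMap.snd ℝ E (E →L[ℝ] ℝ))).hasFDerivAt
    have l2 : HasFDerivAt (fun z => fderiv ℝ τ z v) ((fderiv ℝ (fderiv ℝ τ) z0).flip v) z0 := by
      have := hd2.hasFDerivAt.clm_apply (hasFDerivAt_const v z0)
      simpa using this
    have l3 := hd1.hasFDerivAt.snd.clm_apply l2.fst
    have l4 := l3.congr_of_eventuallyEq (key.mono fun z hz => hz v)
    have := congrArg (fun A : E × (E →L[ℝ] ℝ) →L[ℝ] ℝ => A w) (l1.unique l4)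
    simpa [add_comm] using this
  have a1 := hdir v w
  have a2 := hdir w v
  rw [hsymm v w] at a2
  rw [a1, a2]
  exact add_sub_add_right_eq_sub _ _ _

end Cotangent

end HamOC

namespace HamOC

open Filter Function
open scoped NNReal

section ChartCalculus

set_option linter.unusedSectionVars false

variable {E' : Type*} [NormedAddCommGroup E'] [NormedSpace ℝ E']
  {H' : Type*} [TopologicalSpace H'] {I' : ModelWithCorners ℝ E' H'} [I'.Boundaryless]
  {N : Type*} [TopologicalSpace N] [ChartedSpace H' N]

theorem chartDeriv_surjective [IsManifold I' 1 N] {x y : N}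
    (hy : y ∈ (extChartAt I' x).source) : Surjective (chartDeriv I' x y) :=
  fun w => ⟨_, mfderiv_extChartAt_mfderiv_symm hy w⟩

/-- Producing `L` on the model space avoids transport between the tangent space at `y` and the one
at the image of `y` under the chart and its inverse. -/
theorem exists_hasFDerivAt_comp_extChartAt_symm [IsManifold I' 1 N] {f : N → ℝ} {x y : N}
    (hf : MDifferentiableAt I' 𝓘(ℝ, ℝ) f y) (hy : y ∈ (extChartAt I' x).source) :
    ∃ L : E' →L[ℝ] ℝ, HasFDerivAt (f ∘ (extChartAt I' x).symm) L (extChartAt I' x y) ∧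
      ∀ v : E', L (chartDeriv I' x y v) = (mfderiv I' 𝓘(ℝ, ℝ) f y : E' →L[ℝ] ℝ) v := by
  have hl := (extChartAt I' x).left_inv hy
  have hs := mdifferentiableAt_extChartAt_symm (I' := I') ((extChartAt I' x).map_source hy)
  have hf' : MDifferentiableAt I' 𝓘(ℝ, ℝ) f ((extChartAt I' x).symm (extChartAt I' x y)) := by
    rwa [hl]
  have hc := mfderiv_comp _ hf' hs
  have hd : DifferentiableAt ℝ (f ∘ (extChartAt I' x).symm) (extChartAt I' x y) :=
    (hf'.comp _ hs).differentiableAt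
  refine ⟨_, hd.hasFDerivAt, fun v => ?_⟩
  rw [← mfderiv_eq_fderiv]
  refine (congrArg (fun A : E' →L[ℝ] ℝ => A (chartDeriv I' x y v)) hc).trans ?_
  have e := mfderiv_symm_mfderiv_extChartAt hy v
  refine (congrArg (fun w : E' => (mfderiv I' 𝓘(ℝ, ℝ) f
    ((extChartAt I' x).symm (extChartAt I' x y)) : E' →L[ℝ] ℝ) w) e).trans ?_
  exact congrArg (fun y' => (mfderiv I' 𝓘(ℝ, ℝ) f y' : E' →L[ℝ] ℝ) v) hl

theorem HasVelocity.hasDerivAt_extChartAt [IsManifold I' 1 N] {γ : ℝ → N} {t : ℝ} {v : E'} {x : N}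
    (h : HasVelocity I' γ t v) (hx : γ t ∈ (extChartAt I' x).source) :
    HasDerivAt (fun τ => extChartAt I' x (γ τ)) (chartDeriv I' x (γ t) v) t := by
  have hm : MDifferentiableAt I' 𝓘(ℝ, E') (extChartAt I' x) (γ t) :=
    mdifferentiableAt_extChartAt (by rwa [extChartAt_source] at hx)
  have hc : HasFDerivAt (fun τ => extChartAt I' x (γ τ))
      ((chartDeriv I' x (γ t)).comp ((1 : ℝ →L[ℝ] ℝ).smulRight v)) t :=
    (hm.hasMFDerivAt.comp t h).hasFDerivAt
  simpa using hc.hasDerivAt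

/-- A curve whose coordinates are continuous is continuous. -/
theorem continuous_of_extChartAt {X : Type*} [TopologicalSpace X] {c : X → N} {x : N}
    (hc : ∀ s, c s ∈ (extChartAt I' x).source) (hcont : Continuous fun s => extChartAt I' x (c s)) :
    Continuous c := by
  rw [continuous_iff_continuousAt]
  intro s
  have h1 : ContinuousAt (extChartAt I' x).symm (extChartAt I' x (c s)) :=
    continuousAt_extChartAt_symm' (hc s)
  have h2 := ContinuousAt.comp (f := fun s => extChartAt I' x (c s)) h1 hcont.continuousAt
  refine h2.congr (Eventually.of_forall fun s' => ?_)
  exact (extChartAt I' x).left_inv (hc s')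

/-- `LocLipOn` measures near `c s0` in the chart at that point, while the curve is Lipschitz in the
chart at `x`; the `C¹` change of coordinates is locally Lipschitz and absorbs the difference. -/
theorem LocLipOn.locallyLipschitz_comp [IsManifold I' 2 N] [IsManifold I' 1 N]
    {f : N → ℝ} {O : Set N} {c : ℝ → N}
    {x : N} {K : ℝ≥0} (hf : LocLipOn I' 𝓘(ℝ, ℝ) f O) (hcO : ∀ s, c s ∈ O)
    (hc : ∀ s, c s ∈ (extChartAt I' x).source)
    (hL : LipschitzWith K fun s => extChartAt I' x (c s)) : LocallyLipschitz (f ∘ c) := by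
  intro s0
  have hcont := continuous_of_extChartAt hc hL.continuous
  obtain ⟨C, u, hu, -, -, hC⟩ := hf (c s0) (hcO s0)
  have h1 : ContDiffAt ℝ 1 (extChartAt I' (c s0) ∘ (extChartAt I' x).symm)
      (extChartAt I' x (c s0)) := by
    have h := contDiffWithinAt_ext_coord_change (n := 1) (I := I') (c s0) x
      (y := extChartAt I' x (c s0)) ⟨(extChartAt I' x).map_source (hc s0), by
        change (extChartAt I' x).symm (extChartAt I' x (c s0)) ∈ (extChartAt I' (c s0)).source
        rw [(extChartAt I' x).left_inv (hc s0)]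
        exact mem_extChartAt_source _⟩
    rwa [ModelWithCorners.Boundaryless.range_eq_univ, contDiffWithinAt_univ] at h
  obtain ⟨K', w, hw, hK'⟩ := h1.exists_lipschitzOnWith
  have hu' : c ⁻¹' u ∈ 𝓝 s0 := by
    have : Tendsto c (𝓝 s0) (𝓝[O] (c s0)) :=
      tendsto_nhdsWithin_iff.2 ⟨hcont.continuousAt, Eventually.of_forall hcO⟩
    exact this hu
  have hw' : (fun s => extChartAt I' x (c s)) ⁻¹' w ∈ 𝓝 s0 := hL.continuous.continuousAt hw
  refine ⟨C.toNNReal * (K' * K), _, inter_mem hu' hw', ?_⟩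
  refine LipschitzOnWith.of_dist_le_mul fun y hy z hz => ?_
  have e1 := hC (c y) hy.1 (c z) hz.1
  have e2 := hK'.dist_le_mul _ hy.2 _ hz.2
  simp only [comp_apply, (extChartAt I' x).left_inv (hc _)] at e2
  have e3 := hL.dist_le_mul y z
  rw [dist_eq_norm] at e2
  have e1' : dist ((f ∘ c) y) ((f ∘ c) z) ≤
      C * ‖extChartAt I' (c s0) (c y) - extChartAt I' (c s0) (c z)‖ := e1
  refine e1'.trans ?_
  push_cast
  calc C * ‖extChartAt I' (c s0) (c y) - extChartAt I' (c s0) (c z)‖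
      ≤ (C.toNNReal : ℝ) * ‖extChartAt I' (c s0) (c y) - extChartAt I' (c s0) (c z)‖ :=
        mul_le_mul_of_nonneg_right (Real.le_coe_toNNReal C) (norm_nonneg _)
    _ ≤ (C.toNNReal : ℝ) * (K' * (K * dist y z)) := by gcongr; exact e2.trans (by gcongr)
    _ = _ := by ring

end ChartCalculus

/-! ### The integral of the Liouville form along a curve. -/

section LineIntegral

variable {E : Type*} [NormedAddCommGroup E] [NormedSpace ℝ E]
  {M : Type*} [TopologicalSpace M] [ChartedSpace E M] [IsManifold 𝓘(ℝ, E) ∞ M]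

/-- A covector as a linear form on the model space, through the preferred chart at its base
point. -/
def covecForm (ℓ : Cotangent E M) : E →L[ℝ] ℝ := covec ℓ

theorem covecForm_eq_cotChart_snd {ℓ0 ℓ : Cotangent E M}
    (h : ℓ ∈ (extChartAt (cotModel E) ℓ0).source) (v : E) :
    covecForm ℓ v = (extChartAt (cotModel E) ℓ0 ℓ).2 (chartDeriv 𝓘(ℝ, E) ℓ0.proj ℓ.proj v) :=
  covec_eq_cotChart_snd h v

/-- The integral of the Liouville form along a curve `[0, 1] → T^*M`. -/
noncomputable def liouvilleIntegral (c : ℝ → Cotangent E M) : ℝ :=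
  ∫ s in (0 : ℝ)..1,
    covecForm (c s) (deriv (fun s' => extChartAt 𝓘(ℝ, E) (c s).proj (c s').proj) s)

/-- The definition uses at each `s` the chart at `c s`, which moves with `s`. Since `p dq` does not
depend on the chart, any chart containing the curve gives the same integrand wherever the curve is
differentiable. -/
theorem liouvilleIntegral_eq_cotChart {c : ℝ → Cotangent E M} {ℓ0 : Cotangent E M}
    [FiniteDimensional ℝ E]
    {K : ℝ≥0} (hc : ∀ s, c s ∈ (extChartAt (cotModel E) ℓ0).source)
    (hL : LipschitzWith K fun s => extChartAt (cotModel E) ℓ0 (c s)) :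
    liouvilleIntegral c = ∫ s in (0 : ℝ)..1, (extChartAt (cotModel E) ℓ0 (c s)).2
      (deriv (fun s => (extChartAt (cotModel E) ℓ0 (c s)).1) s) := by
  have hcont := continuous_of_extChartAt hc hL.continuous
  have hpc : Continuous fun s => (c s).proj :=
    (FiberBundle.continuous_proj (E →L[ℝ] ℝ)
      (fun x : M => TangentSpace 𝓘(ℝ, E) x →L[ℝ] Bundle.Trivial M ℝ x)).comp hcont
  refine intervalIntegral.integral_congr_ae ?_
  filter_upwards [hL.ae_differentiableAt_real] with s hs _
  rw [covecForm_eq_cotChart_snd (hc s)]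
  congr 1
  have hsrc := mem_cotChart_source.1 (hc s)
  have hd1 : DifferentiableAt ℝ (fun s' => extChartAt 𝓘(ℝ, E) ℓ0.proj (c s').proj) s := by
    have : (fun s' => extChartAt 𝓘(ℝ, E) ℓ0.proj (c s').proj) =
        fun s' => (extChartAt (cotModel E) ℓ0 (c s')).1 := funext fun s' => (cotChart_fst _ _).symm
    rw [this]; exact hs.fst
  have hs0 := mem_extChartAt_source (I := 𝓘(ℝ, E)) (c s).proj
  have hτ : DifferentiableAt ℝ (extChartAt 𝓘(ℝ, E) (c s).proj ∘ (extChartAt 𝓘(ℝ, E) ℓ0.proj).symm)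
      (extChartAt 𝓘(ℝ, E) ℓ0.proj (c s).proj) := by
    have h := contDiffWithinAt_ext_coord_change (n := 1) (I := 𝓘(ℝ, E)) (c s).proj ℓ0.proj
      (y := extChartAt 𝓘(ℝ, E) ℓ0.proj (c s).proj)
      ⟨(extChartAt 𝓘(ℝ, E) ℓ0.proj).map_source hsrc, by
        change (extChartAt 𝓘(ℝ, E) ℓ0.proj).symm (extChartAt 𝓘(ℝ, E) ℓ0.proj (c s).proj) ∈
          (extChartAt 𝓘(ℝ, E) (c s).proj).source
        rw [(extChartAt 𝓘(ℝ, E) ℓ0.proj).left_inv hsrc]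
        exact hs0⟩
    rw [ModelWithCorners.Boundaryless.range_eq_univ, contDiffWithinAt_univ] at h
    exact h.differentiableAt (by norm_num)
  have hd2 : DifferentiableAt ℝ (fun s' => extChartAt 𝓘(ℝ, E) (c s).proj (c s').proj) s := by
    have h := DifferentiableAt.comp (f := fun s' => extChartAt 𝓘(ℝ, E) ℓ0.proj (c s').proj)
      s hτ hd1
    refine h.congr_of_eventuallyEq (Eventually.of_forall fun s' => ?_)
    simp only [comp_apply]
    rw [(extChartAt 𝓘(ℝ, E) ℓ0.proj).left_inv (mem_cotChart_source.1 (hc s'))]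
  have hcd := contDiffAt_extChartAt_coord_change (I' := 𝓘(ℝ, E)) hsrc
  have hcomp := (hcd.differentiableAt (by norm_num)).hasFDerivAt.comp_hasDerivAt (x := s)
    (f := fun s' => extChartAt 𝓘(ℝ, E) (c s).proj (c s').proj) hd2.hasDerivAt
  rw [chartDeriv_eq_fderiv hsrc, ← hcomp.deriv]
  refine Filter.EventuallyEq.deriv_eq ?_
  filter_upwards [hpc.continuousAt.preimage_mem_nhds
    (extChartAt_source_mem_nhds (I := 𝓘(ℝ, E)) (c s).proj)] with s' hs'
  rw [cotChart_fst]
  simp only [comp_apply]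
  rw [(extChartAt 𝓘(ℝ, E) (c s).proj).left_inv hs']

theorem symplForm_hamVec [FiniteDimensional ℝ E] (h : Cotangent E M → ℝ) (ℓ : Cotangent E M)
    (w : E × (E →L[ℝ] ℝ)) :
    symplForm ℓ w (hamVec h ℓ) =
      (mfderiv (cotModel E) 𝓘(ℝ, ℝ) h ℓ : E × (E →L[ℝ] ℝ) →L[ℝ] ℝ) w :=
  ((existsUnique_symplDual ℓ (mfderiv (cotModel E) 𝓘(ℝ, ℝ) h ℓ)).choose_spec.1 w).symm

end LineIntegral

end HamOC

/-! ### The Cartan identity for the flow near a given time. -/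

namespace HamOC

open Filter Function
open scoped NNReal

theorem hasDerivAt_fst {F G : Type*} [NormedAddCommGroup F] [NormedSpace ℝ F]
    [NormedAddCommGroup G] [NormedSpace ℝ G] {f : ℝ → F × G} {v : F × G} {t : ℝ}
    (h : HasDerivAt f v t) : HasDerivAt (fun τ => (f τ).1) v.1 t := by
  simpa using (HasFDerivAt.fst h.hasFDerivAt).hasDerivAt

theorem hasDerivAt_snd {F G : Type*} [NormedAddCommGroup F] [NormedSpace ℝ F]
    [NormedAddCommGroup G] [NormedSpace ℝ G] {f : ℝ → F × G} {v : F × G} {t : ℝ}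
    (h : HasDerivAt f v t) : HasDerivAt (fun τ => (f τ).2) v.2 t := by
  simpa using (HasFDerivAt.snd h.hasFDerivAt).hasDerivAt

section FlowCalculus

variable {E : Type*} [NormedAddCommGroup E] [NormedSpace ℝ E] [FiniteDimensional ℝ E]
  {M : Type*} [TopologicalSpace M] [ChartedSpace E M] [IsManifold 𝓘(ℝ, E) ∞ M]
  {H : ℝ → Cotangent E M → ℝ} {J : Set ℝ} {O Λ : Set (Cotangent E M)}
  {flow : ℝ → Cotangent E M → Cotangent E M}

/-- The differential of a Hamiltonian in a chart, through its Hamiltonian vector. -/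
theorem exists_hasFDerivAt_cotChart {h : Cotangent E M → ℝ} {ℓ0 ℓ : Cotangent E M}
    (hh : MDifferentiableAt (cotModel E) 𝓘(ℝ, ℝ) h ℓ)
    (hℓ : ℓ ∈ (extChartAt (cotModel E) ℓ0).source) :
    ∃ L : E × (E →L[ℝ] ℝ) →L[ℝ] ℝ,
      HasFDerivAt (h ∘ (extChartAt (cotModel E) ℓ0).symm) L (extChartAt (cotModel E) ℓ0 ℓ) ∧
      ∀ w, L w = w.2 (chartDeriv (cotModel E) ℓ0 ℓ (hamVec h ℓ)).1
        - (chartDeriv (cotModel E) ℓ0 ℓ (hamVec h ℓ)).2 w.1 := by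
  obtain ⟨L, hL, hL'⟩ := exists_hasFDerivAt_comp_extChartAt_symm hh hℓ
  refine ⟨L, hL, fun w => ?_⟩
  obtain ⟨v, rfl⟩ := chartDeriv_surjective hℓ w
  rw [hL' v, ← symplForm_hamVec]
  exact symplForm_eq_cotChart hℓ v (hamVec h ℓ)

/-- Boundedness and measurability come from the Lipschitz-Carathéodory representative, with which
the Cartan form agrees a.e. -/
theorem IsRegularFlow.intervalIntegrable_cartanAlong (hflow : IsRegularFlow H J O Λ flow)
    {ℓ : Cotangent E M} (hℓ : ℓ ∈ Λ) {a b : ℝ} (hab : uIcc a b ⊆ J) :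
    IntervalIntegrable (fun t => cartanAlong H flow t ℓ) volume a b := by
  obtain ⟨G, hG, hGe⟩ := hflow.cartan_lipCaratheodory
  obtain ⟨C, hC⟩ := hG.bounded ℓ hℓ
  have hsub : uIoc a b ⊆ J := uIoc_subset_uIcc.trans hab
  have hGi : IntegrableOn (fun t => G t ℓ) (uIoc a b) := by
    have : IsFiniteMeasure (volume.restrict (uIoc a b)) := ⟨by simp [uIoc]⟩
    refine Integrable.of_bound ((hG.aemeasurable ℓ hℓ).mono_measure
      (Measure.restrict_mono hsub le_rfl)).aestronglyMeasurable C ?_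
    refine (ae_restrict_iff' measurableSet_uIoc).2 ?_
    filter_upwards [hC] with t ht hts using ht (hsub hts)
  rw [intervalIntegrable_iff]
  refine hGi.congr ?_
  refine (ae_restrict_iff' measurableSet_uIoc).2 ?_
  filter_upwards [hGe ℓ hℓ] with t ht hts using (ht (hsub hts)).symm

/-- Near a given time, the variation of `θ` along a curve of `Λ` is the variation of the integral
of the Liouville form along the image of the curve under the flow. -/
theorem IsRegularFlow.exists_liouvilleIntegral_sub (hflow : IsRegularFlow H J O Λ flow)
    (hJ : IsOpen J) {ℓ0 : Cotangent E M} (hℓ0 : ℓ0 ∈ Λ) {t0 : ℝ} (ht0 : t0 ∈ J) :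
    ∃ ε > 0, ∃ V ∈ 𝓝[Λ] ℓ0, Ioo (t0 - ε) (t0 + ε) ⊆ J ∧
      (∀ t ∈ Ioo (t0 - ε) (t0 + ε), ∀ ℓ ∈ V,
        flow t ℓ ∈ (extChartAt (cotModel E) (flow t0 ℓ0)).source) ∧
      (∃ K : ℝ≥0, ∀ t ∈ Ioo (t0 - ε) (t0 + ε), ∀ ℓ ∈ V, ∀ t' ∈ Ioo (t0 - ε) (t0 + ε), ∀ ℓ' ∈ V,
        ‖extChartAt (cotModel E) (flow t0 ℓ0) (flow t ℓ)
          - extChartAt (cotModel E) (flow t0 ℓ0) (flow t' ℓ')‖ ≤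
        K * max |t - t'| ‖extChartAt (cotModel E) ℓ0 ℓ - extChartAt (cotModel E) ℓ0 ℓ'‖) ∧
      ∀ γ : ℝ → Cotangent E M, (∀ s, γ s ∈ V) →
        (∃ K : ℝ≥0, LipschitzWith K fun s => extChartAt (cotModel E) ℓ0 (γ s)) →
        ∀ t1 ∈ Ioo (t0 - ε) (t0 + ε), ∀ t2 ∈ Ioo (t0 - ε) (t0 + ε),
          liouvilleIntegral (fun s => flow t2 (γ s)) - liouvilleIntegral (fun s => flow t1 (γ s))
            = ∫ t in t1..t2, (cartanAlong H flow t (γ 1) - cartanAlong H flow t (γ 0)) := by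
  set Φ := extChartAt (cotModel E) (flow t0 ℓ0) with hΦ
  obtain ⟨K0, u, hu, husrc, humaps, huK⟩ := hflow.flow_locLip (t0, ℓ0) ⟨ht0, hℓ0⟩
  simp only at humaps huK
  -- a product neighbourhood inside `u`
  obtain ⟨ε, hε, V, hV, hεJ, hVΛ, hVu, hVball⟩ : ∃ ε > 0, ∃ V ∈ 𝓝[Λ] ℓ0,
      Icc (t0 - ε) (t0 + ε) ⊆ J ∧ V ⊆ Λ ∧
      (∀ t ∈ Icc (t0 - ε) (t0 + ε), ∀ ℓ ∈ V, (t, ℓ) ∈ u) ∧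
      ∀ ℓ ∈ V, ‖extChartAt (cotModel E) ℓ0 ℓ - extChartAt (cotModel E) ℓ0 ℓ0‖ ≤ 1 := by
    rw [nhdsWithin_prod_eq, hJ.nhdsWithin_eq ht0] at hu
    obtain ⟨w, hw, V, hV, hwV⟩ := Filter.mem_prod_iff.1 hu
    obtain ⟨δ, hδ, hδw⟩ := Metric.mem_nhds_iff.1 (inter_mem hw (hJ.mem_nhds ht0))
    have hball : {ℓ | ‖extChartAt (cotModel E) ℓ0 ℓ - extChartAt (cotModel E) ℓ0 ℓ0‖ ≤ 1} ∈
        𝓝 ℓ0 := by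
      have := (continuousAt_extChartAt (I := cotModel E) ℓ0) (Metric.closedBall_mem_nhds _ one_pos)
      filter_upwards [this] with ℓ hℓ
      simpa [dist_eq_norm] using hℓ
    have hIcc : Icc (t0 - δ / 2) (t0 + δ / 2) ⊆ w ∩ J := fun t ht => hδw (by
      rw [Metric.mem_ball, Real.dist_eq, abs_lt]
      constructor <;> linarith [ht.1, ht.2])
    refine ⟨δ / 2, by positivity, _, inter_mem (inter_mem hV self_mem_nhdsWithin)
      (mem_nhdsWithin_of_mem_nhds hball), fun t ht => (hIcc ht).2, fun ℓ hℓ => hℓ.1.2,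
      fun t ht ℓ hℓ => hwV ⟨(hIcc ht).1, hℓ.1.1⟩, fun ℓ hℓ => hℓ.2⟩
  have hsrc : ∀ t ∈ Icc (t0 - ε) (t0 + ε), ∀ ℓ ∈ V, flow t ℓ ∈ Φ.source :=
    fun t ht ℓ hℓ => humaps (hVu t ht ℓ hℓ)
  have hlip : ∀ t ∈ Icc (t0 - ε) (t0 + ε), ∀ ℓ ∈ V, ∀ t' ∈ Icc (t0 - ε) (t0 + ε), ∀ ℓ' ∈ V,
      ‖Φ (flow t ℓ) - Φ (flow t' ℓ')‖ ≤ K0.toNNReal *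
        max |t - t'| ‖extChartAt (cotModel E) ℓ0 ℓ - extChartAt (cotModel E) ℓ0 ℓ'‖ := by
    intro t ht ℓ hℓ t' ht' ℓ' hℓ'
    have := huK (t, ℓ) (hVu t ht ℓ hℓ) (t', ℓ') (hVu t' ht' ℓ' hℓ')
    refine this.trans ?_
    have e : ‖extChartAt (𝓘(ℝ, ℝ).prod (cotModel E)) (t0, ℓ0) (t, ℓ)
        - extChartAt (𝓘(ℝ, ℝ).prod (cotModel E)) (t0, ℓ0) (t', ℓ')‖ =
        max |t - t'| ‖extChartAt (cotModel E) ℓ0 ℓ - extChartAt (cotModel E) ℓ0 ℓ'‖ := by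
      rw [extChartAt_prod]
      rfl
    rw [e]
    exact mul_le_mul_of_nonneg_right (Real.le_coe_toNNReal K0) (le_max_of_le_left (abs_nonneg _))
  have hIoo : Ioo (t0 - ε) (t0 + ε) ⊆ Icc (t0 - ε) (t0 + ε) := Ioo_subset_Icc_self
  refine ⟨ε, hε, V, hV, hIoo.trans hεJ, fun t ht => hsrc t (hIoo ht), ⟨K0.toNNReal,
    fun t ht ℓ hℓ t' ht' ℓ' hℓ' => hlip t (hIoo ht) ℓ hℓ t' (hIoo ht') ℓ' hℓ'⟩, ?_⟩
  rintro γ hγV ⟨Kγ, hKγ⟩ t1 ht1 t2 ht2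
  have hle : t0 - ε ≤ t0 + ε := by linarith
  have ht0' : t0 ∈ Icc (t0 - ε) (t0 + ε) := ⟨by linarith, by linarith⟩
  -- extend the flow along `γ` to all times
  set κ : ℝ → ℝ := fun t => projIcc (t0 - ε) (t0 + ε) hle t with hκ
  have hκmem : ∀ t, κ t ∈ Icc (t0 - ε) (t0 + ε) := fun t => (projIcc _ _ hle t).2
  have hκlip : ∀ t t', |κ t - κ t'| ≤ |t - t'| := fun t t' => by
    have := (LipschitzWith.projIcc hle).dist_le_mul t t'
    rwa [NNReal.coe_one, one_mul, Subtype.dist_eq, Real.dist_eq, Real.dist_eq] at this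
  have hκid : ∀ t ∈ Icc (t0 - ε) (t0 + ε), κ t = t := fun t ht => by
    simp only [hκ, projIcc_of_mem hle ht]
  set z : ℝ → ℝ → E × (E →L[ℝ] ℝ) := fun t s => Φ (flow (κ t) (γ s)) with hz
  -- The factor `max 1 Kγ` serves both variables: the clamp `κ` is 1-Lipschitz in `t`, and `γ` is
  -- `Kγ`-Lipschitz in `s` in its chart.
  have hzlip : LipschitzWith (K0.toNNReal * max 1 Kγ) (uncurry z) := by
    refine LipschitzWith.of_dist_le_mul ?_
    rintro ⟨t, s⟩ ⟨t', s'⟩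
    rw [dist_eq_norm]
    refine (hlip _ (hκmem t) _ (hγV s) _ (hκmem t') _ (hγV s')).trans ?_
    push_cast
    rw [mul_assoc]
    refine mul_le_mul_of_nonneg_left (max_le ?_ ?_) (NNReal.coe_nonneg _)
    · refine (hκlip t t').trans ?_
      have h1 : |t - t'| ≤ dist (t, s) (t', s') := by
        rw [Prod.dist_eq, ← Real.dist_eq]; exact le_max_left _ _
      exact h1.trans (le_mul_of_one_le_left dist_nonneg (le_max_left _ _))
    · have h1 := hKγ.dist_le_mul s s'
      rw [dist_eq_norm] at h1
      refine h1.trans (mul_le_mul (le_max_right _ _) ?_ dist_nonneg (by positivity))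
      rw [Prod.dist_eq]; exact le_max_right _ _
  set Q : ℝ → ℝ → E := fun t s => (z t s).1 with hQ
  set P : ℝ → ℝ → E →L[ℝ] ℝ := fun t s => (z t s).2 with hP
  have hQlip : LipschitzWith (K0.toNNReal * max 1 Kγ) (uncurry Q) := by
    have := LipschitzWith.prod_fst.comp hzlip
    rwa [one_mul] at this
  have hPlip : LipschitzWith (K0.toNNReal * max 1 Kγ) (uncurry P) := by
    have := LipschitzWith.prod_snd.comp hzlip
    rwa [one_mul] at this
  have hPC : ∀ t s, ‖P t s‖ ≤ ‖Φ (flow t0 ℓ0)‖ + K0.toNNReal * max (2 * ε) 1 := by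
    intro t s
    have hmem : ℓ0 ∈ V := mem_of_mem_nhdsWithin hℓ0 hV
    have h1 := hlip _ (hκmem t) _ (hγV s) _ ht0' _ hmem
    have h2 : max |κ t - t0| ‖extChartAt (cotModel E) ℓ0 (γ s) - extChartAt (cotModel E) ℓ0 ℓ0‖ ≤
        max (2 * ε) 1 := by
      refine max_le_max ?_ (hVball _ (hγV s))
      have := hκmem t
      rw [abs_le]; constructor <;> linarith [this.1, this.2]
    have h3 : ‖P t s‖ ≤ ‖z t s‖ := norm_snd_le _
    have h4 := norm_le_norm_add_norm_sub' (z t s) (Φ (flow t0 ℓ0))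
    have h5 := h1.trans (mul_le_mul_of_nonneg_left h2 (NNReal.coe_nonneg K0.toNNReal))
    exact h3.trans (h4.trans (by gcongr))
  have hsubI : uIcc t1 t2 ⊆ Ioo (t0 - ε) (t0 + ε) := ordConnected_Ioo.uIcc_subset ht1 ht2
  have hmeas : MeasurableSet (uIcc t1 t2) := measurableSet_uIcc
  -- the velocity of the flow, in coordinates
  have hode : ∀ s, ∀ᵐ t, t ∈ uIcc t1 t2 →
      MDifferentiableAt (cotModel E) 𝓘(ℝ, ℝ) (H t) (flow t (γ s)) ∧
      HasDerivAt (fun τ => z τ s) (chartDeriv (cotModel E) (flow t0 ℓ0) (flow t (γ s))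
        (hamVec (H t) (flow t (γ s)))) t := by
    intro s
    filter_upwards [hflow.flow_ode (γ s) (hVΛ (hγV s))] with t ht htI
    have htI' := hsubI htI
    obtain ⟨h1, h2⟩ := ht (hεJ (hIoo htI'))
    refine ⟨h1, ?_⟩
    have h3 := HasVelocity.hasDerivAt_extChartAt (x := flow t0 ℓ0) h2
      (hsrc t (hIoo htI') _ (hγV s))
    refine h3.congr_of_eventuallyEq ?_
    filter_upwards [Ioo_mem_nhds htI'.1 htI'.2] with τ hτ
    simp only [hz, hκid τ (hIoo hτ)]
    rfl
  set h : ℝ → ℝ → ℝ := fun t s => H t (flow (κ t) (γ s)) with hh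
  have hg : ∀ s, ∀ᵐ t ∂(volume.restrict (uIcc t1 t2)), cartanAlong H flow t (γ s) =
      P t s (deriv (fun τ => Q τ s) t) - h t s := by
    intro s
    rw [ae_restrict_iff' hmeas]
    filter_upwards [hode s] with t ht htI
    obtain ⟨-, h2⟩ := ht htI
    have htI' := hIoo (hsubI htI)
    rw [(hasDerivAt_fst h2).deriv]
    simp only [hh, hP, hz, hκid t htI', cartanAlong]
    exact congrArg (· - H t (flow t (γ s)))
      (liouville_eq_cotChart (hsrc t htI' _ (hγV s)) (hamVec (H t) (flow t (γ s))))
  have hB : ∀ t ∈ Ioo (t0 - ε) (t0 + ε), liouvilleIntegral (fun s => flow t (γ s)) =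
      ∫ s in (0 : ℝ)..1, P t s (deriv (Q t) s) := by
    intro t ht
    have hzt : ∀ s, z t s = Φ (flow t (γ s)) := fun s => by simp only [hz, hκid t (hIoo ht)]
    have := liouvilleIntegral_eq_cotChart (c := fun s => flow t (γ s)) (ℓ0 := flow t0 ℓ0)
      (K := K0.toNNReal * max 1 Kγ) (fun s => hsrc t (hIoo ht) _ (hγV s))
      (by simpa only [← hΦ, ← hzt] using lipschitzWith_slice_right hzlip t)
    rw [this]
    simp only [hP, hQ, hzt]
    rfl
  rw [hB t1 ht1, hB t2 ht2]
  refine lineIntegral_sub_eq_integral_cartan (g := fun t s => cartanAlong H flow t (γ s))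
    hPlip hQlip hPC (h := h) ?_ ?_ ?_ hg
  · intro s
    -- Measurability of `H` in `t` is not a hypothesis: along the flow it is recovered from `H = P
    -- ∂ₜQ - G`, with `G` the measurable representative of the Cartan form.
    obtain ⟨G, hG, hGe⟩ := hflow.cartan_lipCaratheodory
    have m1 : AEMeasurable (fun t => G t (γ s)) (volume.restrict (uIcc t1 t2)) :=
      (hG.aemeasurable _ (hVΛ (hγV s))).mono_measure
        (Measure.restrict_mono (hsubI.trans (hIoo.trans hεJ)) le_rfl)
    have m2 : AEMeasurable (fun t => P t s (deriv (fun τ => Q τ s) t))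
        (volume.restrict (uIcc t1 t2)) :=
      (aestronglyMeasurable_clm_apply
        (lipschitzWith_slice_left hPlip s).continuous.aestronglyMeasurable
        (stronglyMeasurable_deriv _).aestronglyMeasurable).aemeasurable.restrict
    refine (m2.sub m1).congr ?_
    have hGe' := (ae_restrict_iff' hmeas).2 ((hGe _ (hVΛ (hγV s))).mono fun t ht htI =>
      ht (hεJ (hIoo (hsubI htI))))
    filter_upwards [hg s, hGe'] with t e1 e2
    simp only [Pi.sub_apply]
    linarith
  · rw [ae_restrict_iff' hmeas]
    filter_upwards [hflow.locLip_H] with t ht htI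
    have htI' := hIoo (hsubI htI)
    exact LocLipOn.locallyLipschitz_comp (ht (hεJ htI'))
      (fun s => hflow.flow_mem _ (hεJ (hκmem t)) _ (hVΛ (hγV s)))
      (fun s => hsrc _ (hκmem t) _ (hγV s)) (lipschitzWith_slice_right hzlip t)
  · intro s
    rw [ae_restrict_iff' hmeas]
    filter_upwards [hode s] with t ht htI
    obtain ⟨h1, h2⟩ := ht htI
    have htI' := hIoo (hsubI htI)
    -- The coefficients of `dH_t` in the chart are the coordinates of its Hamiltonian vector, which
    -- are `∂ₜQ` and `∂ₜP` by the flow equation. Since `z t` is Lipschitz in `s`, the remainder is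
    -- small with respect to `s' - s`.
    obtain ⟨L, hL, hLw⟩ := exists_hasFDerivAt_cotChart h1 (hsrc t htI' _ (hγV s))
    have hzs : z t s = Φ (flow t (γ s)) := by simp only [hz, hκid t htI']
    rw [← hΦ, ← hzs] at hL
    have hcz : Continuous (z t) := (lipschitzWith_slice_right hzlip t).continuous
    have o1 := hL.isLittleO.comp_tendsto (hcz.tendsto s)
    have o2 : (fun s' => z t s' - z t s) =O[𝓝 s] (fun s' => s' - s) := by
      refine Asymptotics.IsBigO.of_bound (K0.toNNReal * max 1 Kγ : ℝ≥0) (Eventually.of_forall ?_)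
      intro s'
      simpa [dist_eq_norm] using (lipschitzWith_slice_right hzlip t).dist_le_mul s' s
    refine (o1.trans_isBigO o2).congr_left fun s' => ?_
    have hhs : ∀ s, h t s = (H t ∘ Φ.symm) (z t s) := fun s => by
      simp only [hh, hz, comp_apply]
      rw [Φ.left_inv (hsrc _ (hκmem t) _ (hγV s))]
    rw [hhs s', hhs s]
    simp only [comp_apply]
    rw [hLw, (hasDerivAt_fst h2).deriv, (hasDerivAt_snd h2).deriv]
    rfl

end FlowCalculus

end HamOC

/-! ### Propagation from time zero: `θ_t` is a primitive of the Liouville form. -/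

namespace HamOC

open Filter Function
open scoped NNReal

section Propagation

variable {E : Type*} [NormedAddCommGroup E] [NormedSpace ℝ E]
  {M : Type*} [TopologicalSpace M] [ChartedSpace E M] [IsManifold 𝓘(ℝ, E) ∞ M]

/-- The coordinates of the differential of a function. -/
theorem cotChart_dSection {f : M → ℝ} {x : M} {ℓ0 : Cotangent E M}
    (hf : MDifferentiableAt 𝓘(ℝ, E) 𝓘(ℝ, ℝ) f x)
    (hx : x ∈ (extChartAt 𝓘(ℝ, E) ℓ0.proj).source) :
    extChartAt (cotModel E) ℓ0 (dSection E f x) = (extChartAt 𝓘(ℝ, E) ℓ0.proj x,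
      fderiv ℝ (f ∘ (extChartAt 𝓘(ℝ, E) ℓ0.proj).symm) (extChartAt 𝓘(ℝ, E) ℓ0.proj x)) := by
  have hmem : dSection E f x ∈ (extChartAt (cotModel E) ℓ0).source :=
    mem_cotChart_source.2 hx
  refine Prod.ext (cotChart_fst _ _) (ContinuousLinearMap.ext fun w => ?_)
  refine (cotChart_snd hmem w).trans ?_
  have hl := (extChartAt 𝓘(ℝ, E) ℓ0.proj).left_inv hx
  have hs := mdifferentiableAt_extChartAt_symm (I' := 𝓘(ℝ, E))
    ((extChartAt 𝓘(ℝ, E) ℓ0.proj).map_source hx)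
  have hf' : MDifferentiableAt 𝓘(ℝ, E) 𝓘(ℝ, ℝ) f ((extChartAt 𝓘(ℝ, E) ℓ0.proj).symm
      (extChartAt 𝓘(ℝ, E) ℓ0.proj x)) := by rwa [hl]
  have hc := mfderiv_comp _ hf' hs
  rw [mfderiv_eq_fderiv] at hc
  refine Eq.trans ?_ (congrArg (fun A : E →L[ℝ] ℝ => A w) hc).symm
  exact congrArg (fun y => (mfderiv 𝓘(ℝ, E) 𝓘(ℝ, ℝ) f y : E →L[ℝ] ℝ)
    ((mfderiv 𝓘(ℝ, E) 𝓘(ℝ, E) (extChartAt 𝓘(ℝ, E) ℓ0.proj).symm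
      (extChartAt 𝓘(ℝ, E) ℓ0.proj x) : E →L[ℝ] E) w)) hl.symm

theorem contDiffAt_comp_extChartAt_symm {f : M → ℝ} {x x0 : M} {n : WithTop ℕ∞} (hn : n ≤ ∞)
    (hf : ContMDiffAt 𝓘(ℝ, E) 𝓘(ℝ, ℝ) n f x) (hx : x ∈ (extChartAt 𝓘(ℝ, E) x0).source) :
    ContDiffAt ℝ n (f ∘ (extChartAt 𝓘(ℝ, E) x0).symm) (extChartAt 𝓘(ℝ, E) x0 x) := by
  have h1 : ContMDiffAt 𝓘(ℝ, E) 𝓘(ℝ, E) n (extChartAt 𝓘(ℝ, E) x0).symm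
      (extChartAt 𝓘(ℝ, E) x0 x) :=
    ((contMDiffOn_extChartAt_symm (I := 𝓘(ℝ, E)) (n := ∞) x0).of_le hn).contMDiffAt
      ((isOpen_extChartAt_target x0).mem_nhds ((extChartAt 𝓘(ℝ, E) x0).map_source hx))
  have h2 := ContMDiffAt.comp (extChartAt 𝓘(ℝ, E) x0 x) (g := f)
    (f := (extChartAt 𝓘(ℝ, E) x0).symm) (by rwa [(extChartAt 𝓘(ℝ, E) x0).left_inv hx]) h1
  exact h2.contDiffAt

variable [FiniteDimensional ℝ E]
  {H : ℝ → Cotangent E M → ℝ} {J : Set ℝ} {O : Set (Cotangent E M)}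
  {flow : ℝ → Cotangent E M → Cotangent E M}

/-- Along a curve in the graph of `dα`, the integral of the Liouville form is the variation of
`α`. -/
theorem liouvilleIntegral_dSection {α : M → ℝ} {A : Set M} (hA : IsOpen A)
    (hα : ContMDiffOn 𝓘(ℝ, E) 𝓘(ℝ, ℝ) ∞ α A) {ℓ0 : Cotangent E M} {γ : ℝ → Cotangent E M}
    {K : ℝ≥0} (hγ : ∀ s, γ s ∈ dSection E α '' A)
    (hsrc : ∀ s, γ s ∈ (extChartAt (cotModel E) ℓ0).source)
    (hK : LipschitzWith K fun s => extChartAt (cotModel E) ℓ0 (γ s)) :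
    liouvilleIntegral γ = α (γ 1).proj - α (γ 0).proj := by
  rw [liouvilleIntegral_eq_cotChart hsrc hK]
  set φ := extChartAt 𝓘(ℝ, E) ℓ0.proj with hφ
  have hps : ∀ s, (γ s).proj ∈ φ.source := fun s => mem_cotChart_source.1 (hsrc s)
  have hpA : ∀ s, (γ s).proj ∈ A ∧ γ s = dSection E α (γ s).proj := by
    intro s
    obtain ⟨x, hx, hxe⟩ := hγ s
    rw [← hxe]
    exact ⟨hx, rfl⟩
  have hcd : ∀ s, ContDiffAt ℝ 1 (α ∘ φ.symm) (φ (γ s).proj) := fun s =>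
    contDiffAt_comp_extChartAt_symm (by simp)
      ((hα.contMDiffAt (hA.mem_nhds (hpA s).1)).of_le (by simp)) (hps s)
  have hcoord : ∀ s, extChartAt (cotModel E) ℓ0 (γ s) =
      (φ (γ s).proj, fderiv ℝ (α ∘ φ.symm) (φ (γ s).proj)) := by
    intro s
    conv_lhs => rw [(hpA s).2]
    exact cotChart_dSection ((hα.contMDiffAt (hA.mem_nhds (hpA s).1)).mdifferentiableAt
      (by simp)) (hps s)
  have hQ : LipschitzWith K fun s => φ (γ s).proj := by
    have := LipschitzWith.prod_fst.comp hK
    rw [one_mul] at this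
    simpa only [comp_def, hcoord] using this
  -- This makes `α` along the curve absolutely continuous on `[0, 1]`, so the integral of its
  -- derivative is its variation.
  have hll : LocallyLipschitz fun s => α (γ s).proj := by
    intro s0
    obtain ⟨K', w, hw, hK'⟩ := (hcd s0).exists_lipschitzOnWith
    refine ⟨K' * K, _, hQ.continuous.continuousAt hw, ?_⟩
    have := hK'.comp hQ.lipschitzOnWith (s := (fun s => φ (γ s).proj) ⁻¹' w)
      (mapsTo_preimage _ _)
    have e : (α ∘ φ.symm) ∘ (fun s => φ (γ s).proj) = fun s => α (γ s).proj := funext fun s => by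
      simp only [comp_apply]
      rw [φ.left_inv (hps s)]
    rwa [e] at this
  obtain ⟨L, hL⟩ := (hll.locallyLipschitzOn
    (s := uIcc (0 : ℝ) 1)).exists_lipschitzOnWith_of_compact isCompact_uIcc
  rw [← hL.absolutelyContinuousOnInterval.integral_deriv_eq_sub]
  refine intervalIntegral.integral_congr_ae ?_
  filter_upwards [hQ.ae_differentiableAt_real] with s hs _
  simp only [hcoord]
  have h1 := ((hcd s).differentiableAt (by norm_num)).hasFDerivAt.comp_hasDerivAt (x := s)
    (f := fun s => φ (γ s).proj) hs.hasDerivAt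
  rw [← h1.deriv]
  congr 1
  funext s'
  simp only [comp_apply]
  rw [φ.left_inv (hps s')]

/-- The function `θ_t` is a primitive of the Liouville form on the image of `Λ`, near a
trajectory. -/
theorem IsRegularFlow.exists_theta_sub {α : M → ℝ} {A : Set M}
    (hflow : IsRegularFlow H J O (dSection E α '' A) flow) (hJ : IsOpen J) (hJ' : J.OrdConnected)
    (hA : IsOpen A) (hα : ContMDiffOn 𝓘(ℝ, E) 𝓘(ℝ, ℝ) ∞ α A)
    {ℓ0 : Cotangent E M} (hℓ0 : ℓ0 ∈ dSection E α '' A) {T : ℝ} (hT : T ∈ J) (h0 : (0 : ℝ) ∈ J) :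
    ∃ ε > 0, ∃ V ∈ 𝓝[dSection E α '' A] ℓ0, V ⊆ dSection E α '' A ∧
      Ioo (T - ε) (T + ε) ⊆ J ∧
      (∀ t ∈ Ioo (T - ε) (T + ε), ∀ ℓ ∈ V,
        flow t ℓ ∈ (extChartAt (cotModel E) (flow T ℓ0)).source) ∧
      (∃ K : ℝ≥0, ∀ t ∈ Ioo (T - ε) (T + ε), ∀ ℓ ∈ V, ∀ t' ∈ Ioo (T - ε) (T + ε), ∀ ℓ' ∈ V,
        ‖extChartAt (cotModel E) (flow T ℓ0) (flow t ℓ)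
          - extChartAt (cotModel E) (flow T ℓ0) (flow t' ℓ')‖ ≤
        K * max |t - t'| ‖extChartAt (cotModel E) ℓ0 ℓ - extChartAt (cotModel E) ℓ0 ℓ'‖) ∧
      ∀ γ : ℝ → Cotangent E M, (∀ s, γ s ∈ V) →
        (∃ K : ℝ≥0, LipschitzWith K fun s => extChartAt (cotModel E) ℓ0 (γ s)) →
        ∀ t ∈ Ioo (T - ε) (T + ε),
          theta H flow α t (γ 1) - theta H flow α t (γ 0) =
            liouvilleIntegral (fun s => flow t (γ s)) := by
  set Λ := dSection E α '' A with hΛ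
  -- the statement at a fixed time
  set Good : ℝ → Prop := fun t => ∃ V ∈ 𝓝[Λ] ℓ0, ∀ γ : ℝ → Cotangent E M, (∀ s, γ s ∈ V) →
      (∃ K : ℝ≥0, LipschitzWith K fun s => extChartAt (cotModel E) ℓ0 (γ s)) →
      theta H flow α t (γ 1) - theta H flow α t (γ 0) =
        liouvilleIntegral (fun s => flow t (γ s)) with hGood
  have htheta : ∀ ℓ ∈ Λ, ∀ t1 ∈ J, ∀ t2 ∈ J, theta H flow α t2 ℓ - theta H flow α t1 ℓ =
      ∫ t in t1..t2, cartanAlong H flow t ℓ := by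
    intro ℓ hℓ t1 ht1 t2 ht2
    have := intervalIntegral.integral_interval_sub_left
      (hflow.intervalIntegrable_cartanAlong hℓ (hJ'.uIcc_subset h0 ht2))
      (hflow.intervalIntegrable_cartanAlong hℓ (hJ'.uIcc_subset h0 ht1))
    rw [← this]
    simp only [theta]
    ring
  -- Between `t1` and `t2` both sides change by the integral of the difference of the Cartan form at
  -- the ends of `γ`.
  have hstep : ∀ (γ : ℝ → Cotangent E M), (∀ s, γ s ∈ Λ) → ∀ t1 ∈ J, ∀ t2 ∈ J,
      liouvilleIntegral (fun s => flow t2 (γ s)) - liouvilleIntegral (fun s => flow t1 (γ s))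
        = ∫ t in t1..t2, (cartanAlong H flow t (γ 1) - cartanAlong H flow t (γ 0)) →
      theta H flow α t1 (γ 1) - theta H flow α t1 (γ 0) =
        liouvilleIntegral (fun s => flow t1 (γ s)) →
      theta H flow α t2 (γ 1) - theta H flow α t2 (γ 0) =
        liouvilleIntegral (fun s => flow t2 (γ s)) := by
    intro γ hγ t1 ht1 t2 ht2 h1 h2
    rw [intervalIntegral.integral_sub
      (hflow.intervalIntegrable_cartanAlong (hγ 1) (hJ'.uIcc_subset ht1 ht2))
      (hflow.intervalIntegrable_cartanAlong (hγ 0) (hJ'.uIcc_subset ht1 ht2)),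
      ← htheta _ (hγ 1) t1 ht1 t2 ht2, ← htheta _ (hγ 0) t1 ht1 t2 ht2] at h1
    linarith
  -- At time zero the flow is the identity on `Λ`, and `θ₀ = α ∘ π` is a primitive of the Liouville
  -- form on the graph of `dα`.
  have hgood0 : Good 0 := by
    refine ⟨(extChartAt (cotModel E) ℓ0).source ∩ Λ, inter_mem
      (mem_nhdsWithin_of_mem_nhds (extChartAt_source_mem_nhds ℓ0)) self_mem_nhdsWithin, ?_⟩
    rintro γ hγ ⟨K, hK⟩
    have : (fun s => flow 0 (γ s)) = γ := funext fun s => hflow.flow_zero _ (hγ s).2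
    rw [this, liouvilleIntegral_dSection hA hα (fun s => (hγ s).2) (fun s => (hγ s).1) hK]
    simp [theta]
  have hlocal : ∀ t0 ∈ J, ∃ ε > 0, ∀ t1 ∈ Ioo (t0 - ε) (t0 + ε), ∀ t2 ∈ Ioo (t0 - ε) (t0 + ε),
      Good t1 → Good t2 := by
    intro t0 ht0
    obtain ⟨ε, hε, V, hV, hεJ, -, -, hmain⟩ := hflow.exists_liouvilleIntegral_sub hJ hℓ0 ht0
    refine ⟨ε, hε, ?_⟩
    rintro t1 ht1 t2 ht2 ⟨V', hV', h⟩
    refine ⟨V ∩ V' ∩ Λ, inter_mem (inter_mem hV hV') self_mem_nhdsWithin, ?_⟩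
    intro γ hγ hK
    exact hstep γ (fun s => (hγ s).2) t1 (hεJ ht1) t2 (hεJ ht2)
      (hmain γ (fun s => (hγ s).1.1) hK t1 ht1 t2 ht2) (h γ (fun s => (hγ s).1.2) hK)
  have hgood : ∀ t ∈ J, Good t := by
    intro t ht
    -- The neighbourhood of `ℓ0` may shrink with each step, so what propagates is the implication
    -- between two times: it is transitive and holds both ways between nearby times, and `J` is
    -- connected.
    refine (isPreconnected_iff_ordConnected.2 hJ').induction₂' (fun a b => Good a → Good b) ?_
      (fun a b c _ _ _ h1 h2 h => h2 (h1 h)) h0 ht hgood0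
    intro t0 ht0
    obtain ⟨ε, hε, h⟩ := hlocal t0 ht0
    have h0 : t0 ∈ Ioo (t0 - ε) (t0 + ε) := ⟨by linarith, by linarith⟩
    filter_upwards [mem_nhdsWithin_of_mem_nhds (Ioo_mem_nhds h0.1 h0.2)] with t1 ht1
    exact ⟨h t0 h0 t1 ht1, h t1 ht1 t0 h0⟩
  obtain ⟨ε, hε, V, hV, hεJ, hsrc, hlip, hmain⟩ := hflow.exists_liouvilleIntegral_sub hJ hℓ0 hT
  obtain ⟨V', hV', h⟩ := hgood T hT
  have hTε : T ∈ Ioo (T - ε) (T + ε) := ⟨by linarith, by linarith⟩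
  obtain ⟨K, hK⟩ := hlip
  -- One neighbourhood serves all times near `T`: on `V'` the identity holds at `T`, and on `V` the
  -- increments from `T` are known.
  refine ⟨ε, hε, V ∩ V' ∩ Λ, inter_mem (inter_mem hV hV') self_mem_nhdsWithin, fun ℓ hℓ => hℓ.2,
    hεJ, fun t ht ℓ hℓ => hsrc t ht ℓ hℓ.1.1, ⟨K, fun t ht ℓ hℓ t' ht' ℓ' hℓ' =>
      hK t ht ℓ hℓ.1.1 t' ht' ℓ' hℓ'.1.1⟩, ?_⟩
  intro γ hγ hKγ t ht
  exact hstep γ (fun s => (hγ s).2) T hT t (hεJ ht)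
    (hmain γ (fun s => (hγ s).1.1) hKγ T hTε t ht) (h γ (fun s => (hγ s).1.2) hKγ)

end Propagation

end HamOC

/-! ### Derivatives at limits of zeros, sections `df`, and the reference Hamiltonian. -/

namespace HamOC

open Filter Function
open scoped NNReal

/-- A set dense near `x` determines derivatives at `x` uniquely, and relative to it `f` has
derivative zero. Differentiability is needed at `x` alone, which is what allows a Hamiltonian that
is irregular at other points. -/
theorem fderiv_eq_zero_of_mem_closure {F G : Type*} [NormedAddCommGroup F] [NormedSpace ℝ F]
    [NormedAddCommGroup G] [NormedSpace ℝ G] {f : F → G} {f' : F →L[ℝ] G} {x : F} {S : Set F}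
    (hf : HasFDerivAt f f' x) (hS : ∀ z ∈ S, f z = 0) (hx : ∀ᶠ z in 𝓝 x, z ∈ closure S) :
    f' = 0 := by
  have hu : UniqueDiffWithinAt ℝ S x := (uniqueDiffWithinAt_univ.inter hx).mono_closure
    (t := S) (by simp)
  have hx0 : f x = 0 := by
    have hxS : x ∈ closure S := mem_of_mem_nhds hx
    have : (𝓝[S] x).NeBot := mem_closure_iff_nhdsWithin_neBot.1 hxS
    have h1 : Tendsto f (𝓝[S] x) (𝓝 (f x)) := hf.continuousAt.tendsto.mono_left nhdsWithin_le_nhds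
    refine tendsto_nhds_unique h1 (tendsto_const_nhds.congr' ?_)
    filter_upwards [self_mem_nhdsWithin] with z hz using (hS z hz).symm
  have h1 : HasFDerivWithinAt f (0 : F →L[ℝ] G) S x :=
    (hasFDerivWithinAt_const (0 : G) x S).congr hS hx0
  exact hu.eq hf.hasFDerivWithinAt h1

section Sections

variable {E : Type*} [NormedAddCommGroup E] [NormedSpace ℝ E]
  {M : Type*} [TopologicalSpace M] [ChartedSpace E M] [IsManifold 𝓘(ℝ, E) ∞ M]

theorem chartDeriv_self {E' : Type*} [NormedAddCommGroup E'] [NormedSpace ℝ E']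
    {H' : Type*} [TopologicalSpace H'] {I' : ModelWithCorners ℝ E' H'} [I'.Boundaryless]
    {N : Type*} [TopologicalSpace N] [ChartedSpace H' N] [IsManifold I' 1 N] (x : N) :
    chartDeriv I' x x = ContinuousLinearMap.id ℝ E' := by
  rw [chartDeriv_eq_fderiv (mem_extChartAt_source x)]
  have h : extChartAt I' x ∘ (extChartAt I' x).symm =ᶠ[𝓝 (extChartAt I' x x)] id := by
    filter_upwards [extChartAt_target_mem_nhds (I := I') x] with z hz
    exact (extChartAt I' x).right_inv hz
  rw [h.fderiv_eq, fderiv_id]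

/-- The coordinates of a section `df`, near a point. -/
theorem eventually_cotChart_dSection {f : M → ℝ} {x : M}
    (hf : ContMDiffAt 𝓘(ℝ, E) 𝓘(ℝ, ℝ) 2 f x) :
    ∀ᶠ y in 𝓝 x, extChartAt (cotModel E) (dSection E f x) (dSection E f y) =
      (extChartAt 𝓘(ℝ, E) x y,
        fderiv ℝ (f ∘ (extChartAt 𝓘(ℝ, E) x).symm) (extChartAt 𝓘(ℝ, E) x y)) := by
  have hev := (contMDiffAt_iff_contMDiffAt_nhds (n := 2) (by simp)).1 hf
  filter_upwards [hev, extChartAt_source_mem_nhds (I := 𝓘(ℝ, E)) x] with y h1 h2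
  exact cotChart_dSection (h1.mdifferentiableAt (by simp)) h2

/-- In the chart at `df(x)` the section is the graph of the derivative of the coordinate expression
of `f`, so its differential pairs the identity with the second derivative. -/
theorem hasFDerivAt_cotChart_dSection {f : M → ℝ} {x : M}
    (hf : ContMDiffAt 𝓘(ℝ, E) 𝓘(ℝ, ℝ) 2 f x) :
    HasFDerivAt (fun z : E => extChartAt (cotModel E) (dSection E f x)
      (dSection E f ((extChartAt 𝓘(ℝ, E) x).symm z)))
      ((ContinuousLinearMap.id ℝ E).prod
        (fderiv ℝ (fderiv ℝ (f ∘ (extChartAt 𝓘(ℝ, E) x).symm)) (extChartAt 𝓘(ℝ, E) x x)))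
      (extChartAt 𝓘(ℝ, E) x x) := by
  have hc := contDiffAt_comp_extChartAt_symm ENat.LEInfty.out hf
    (mem_extChartAt_source (I := 𝓘(ℝ, E)) x)
  have hd : DifferentiableAt ℝ (fderiv ℝ (f ∘ (extChartAt 𝓘(ℝ, E) x).symm))
      (extChartAt 𝓘(ℝ, E) x x) :=
    (hc.fderiv_right (m := 1) (by norm_num)).differentiableAt (by norm_num)
  refine ((hasFDerivAt_id _).prodMk hd.hasFDerivAt).congr_of_eventuallyEq ?_
  have hcont : Tendsto (extChartAt 𝓘(ℝ, E) x).symm (𝓝 (extChartAt 𝓘(ℝ, E) x x)) (𝓝 x) := by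
    have := (continuousAt_extChartAt_symm (I := 𝓘(ℝ, E)) x).tendsto
    rwa [extChartAt_to_inv] at this
  filter_upwards [hcont.eventually (eventually_cotChart_dSection hf),
    extChartAt_target_mem_nhds (I := 𝓘(ℝ, E)) x] with z h1 h2
  rw [h1, (extChartAt 𝓘(ℝ, E) x).right_inv h2]
  rfl

theorem continuousAt_dSection {f : M → ℝ} {x : M}
    (hf : ContMDiffAt 𝓘(ℝ, E) 𝓘(ℝ, ℝ) 2 f x) : ContinuousAt (dSection E f) x := by
  have h1 := (hasFDerivAt_cotChart_dSection hf).continuousAt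
  have h2 := ContinuousAt.comp (f := extChartAt 𝓘(ℝ, E) x) (x := x) h1 (continuousAt_extChartAt x)
  have h3 : ContinuousAt (extChartAt (cotModel E) (dSection E f x)).symm
      (extChartAt (cotModel E) (dSection E f x) (dSection E f x)) := continuousAt_extChartAt_symm _
  have h4 := ContinuousAt.comp (x := x) (f := (fun z : E => extChartAt (cotModel E) (dSection E f x)
      (dSection E f ((extChartAt 𝓘(ℝ, E) x).symm z))) ∘ extChartAt 𝓘(ℝ, E) x)
      (g := (extChartAt (cotModel E) (dSection E f x)).symm)
      (by simpa only [comp_apply, extChartAt_to_inv] using h3) h2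
  refine h4.congr ?_
  filter_upwards [extChartAt_source_mem_nhds (I := 𝓘(ℝ, E)) x] with y hy
  simp only [comp_apply]
  rw [(extChartAt 𝓘(ℝ, E) x).left_inv hy]
  exact (extChartAt (cotModel E) (dSection E f x)).left_inv (mem_cotChart_source.2 hy)

theorem mdifferentiableAt_dSection {f : M → ℝ} {x : M}
    (hf : ContMDiffAt 𝓘(ℝ, E) 𝓘(ℝ, ℝ) 2 f x) :
    MDifferentiableAt 𝓘(ℝ, E) (cotModel E) (dSection E f) x := by
  rw [mdifferentiableAt_iff]
  exact ⟨continuousAt_dSection hf,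
    (hasFDerivAt_cotChart_dSection hf).differentiableAt.differentiableWithinAt⟩

/-- The differential of the section `df`, in coordinates. -/
theorem sectionPush_dSection {f : M → ℝ} {x : M}
    (hf : ContMDiffAt 𝓘(ℝ, E) 𝓘(ℝ, ℝ) 2 f x) (v : E) :
    (sectionPush (dSection E f) x v : E × (E →L[ℝ] ℝ)) =
      (v, fderiv ℝ (fderiv ℝ (f ∘ (extChartAt 𝓘(ℝ, E) x).symm)) (extChartAt 𝓘(ℝ, E) x x) v) := by
  have h1 : (mfderiv 𝓘(ℝ, E) (cotModel E) (dSection E f) x : E →L[ℝ] E × (E →L[ℝ] ℝ)) =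
      (ContinuousLinearMap.id ℝ E).prod
        (fderiv ℝ (fderiv ℝ (f ∘ (extChartAt 𝓘(ℝ, E) x).symm)) (extChartAt 𝓘(ℝ, E) x x)) := by
    refine (if_pos (mdifferentiableAt_dSection hf)).trans ?_
    rw [modelWithCornersSelf_coe, range_id, fderivWithin_univ]
    exact (hasFDerivAt_cotChart_dSection hf).fderiv
  exact congrArg (fun A : E →L[ℝ] E × (E →L[ℝ] ℝ) => A v) h1

end Sections

section Reference

variable {E : Type*} [NormedAddCommGroup E] [NormedSpace ℝ E]
  {M : Type*} [TopologicalSpace M] [ChartedSpace E M] [IsManifold 𝓘(ℝ, E) ∞ M] {m : ℕ}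

/-- The pairing is smooth because it evaluates the tautological section `ℓ ↦ ℓ` on the vector field
pulled back by `π`. -/
theorem ControlProblem.mdifferentiableAt_preHam (P : ControlProblem E M m) (p0 : ℝ)
    {u : EuclideanSpace ℝ (Fin m)} (hu : u ∈ P.V) {ℓ : Cotangent E M} (hℓ : ℓ.proj ∈ P.D) :
    MDifferentiableAt (cotModel E) 𝓘(ℝ, ℝ) (fun ℓ => P.preHam p0 ℓ u) ℓ := by
  have hproj : ContMDiffAt (cotModel E) 𝓘(ℝ, E) ∞
      (Bundle.TotalSpace.proj : Cotangent E M → M) ℓ := Bundle.contMDiff_proj _ ℓ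
  have hpair : ContMDiffAt (cotModel E) (𝓘(ℝ, E).prod 𝓘(ℝ, EuclideanSpace ℝ (Fin m))) ∞
      (fun ℓ : Cotangent E M => (ℓ.proj, u)) ℓ := hproj.prodMk contMDiffAt_const
  have hnhds : P.D ×ˢ P.V ∈ 𝓝 (ℓ.proj, u) :=
    (P.isOpen_D.prod P.isOpen_V).mem_nhds ⟨hℓ, hu⟩
  have hf := ContMDiffAt.comp ℓ (f := fun ℓ : Cotangent E M => (ℓ.proj, u))
    (P.f_smooth.contMDiffAt hnhds) hpair
  have hf0 := ContMDiffAt.comp ℓ (f := fun ℓ : Cotangent E M => (ℓ.proj, u))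
    (P.f0_smooth.contMDiffAt hnhds) hpair
  have hid : ContMDiffAt (cotModel E) (cotModel E) ∞ (fun ℓ : Cotangent E M =>
      (⟨ℓ.proj, ℓ.snd⟩ : Cotangent E M)) ℓ := contMDiffAt_id
  have happ := ContMDiffAt.clm_bundle_apply (b := fun ℓ : Cotangent E M => ℓ.proj)
    (E₁ := fun x : M => TangentSpace 𝓘(ℝ, E) x) (E₂ := Bundle.Trivial M ℝ)
    (ϕ := fun ℓ : Cotangent E M => ℓ.snd) (v := fun ℓ : Cotangent E M => P.f ℓ.proj u) hid hf
  rw [Bundle.contMDiffAt_totalSpace] at happ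
  have h1 : ContMDiffAt (cotModel E) 𝓘(ℝ, ℝ) ∞
      (fun ℓ : Cotangent E M => covec ℓ (P.f ℓ.proj u)) ℓ := happ.2
  exact (h1.mdifferentiableAt (by simp)).sub ((hf0.mdifferentiableAt (by simp)).const_smul p0)

variable [FiniteDimensional ℝ E]

/-- The projection of the Hamiltonian vector of the reference Hamiltonian is the dynamics. -/
theorem ControlProblem.hamVec_refHam_fst (P : ControlProblem E M m) (p0 : ℝ)
    {u : ℝ → EuclideanSpace ℝ (Fin m)} {t : ℝ} (hu : u t ∈ P.V) {ℓ : Cotangent E M}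
    (hℓ : ℓ.proj ∈ P.D) :
    (hamVec (P.refHam p0 u t) ℓ : E × (E →L[ℝ] ℝ)).1 = P.f ℓ.proj (u t) := by
  have hmd : MDifferentiableAt (cotModel E) 𝓘(ℝ, ℝ) (P.refHam p0 u t) ℓ :=
    P.mdifferentiableAt_preHam p0 hu hℓ
  obtain ⟨L, hL, hLw⟩ := exists_hasFDerivAt_cotChart hmd (mem_extChartAt_source ℓ)
  rw [chartDeriv_self] at hLw
  set hv : E × (E →L[ℝ] ℝ) := hamVec (P.refHam p0 u t) ℓ with hhv
  replace hLw : ∀ w, L w = w.2 hv.1 - hv.2 w.1 := hLw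
  set z0 : E × (E →L[ℝ] ℝ) := extChartAt (cotModel E) ℓ ℓ with hz0
  set F : M → E := fun x => P.f x (u t) with hF
  -- the restriction to the fibre is affine
  have hfib : ∀ᶠ p in 𝓝 z0.2, (P.refHam p0 u t ∘ (extChartAt (cotModel E) ℓ).symm) (z0.1, p) =
      p (F ℓ.proj) - p0 * P.f0 ℓ.proj (u t) := by
    have hc : ContinuousAt (fun p : E →L[ℝ] ℝ => (z0.1, p)) z0.2 := by fun_prop
    have ht : (extChartAt (cotModel E) ℓ).target ∈ 𝓝 (z0.1, z0.2) :=
      extChartAt_target_mem_nhds (I := cotModel E) ℓ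
    filter_upwards [hc ht] with p hp
    have hp' : (z0.1, p) ∈ (extChartAt (cotModel E) ℓ).target := hp
    set ℓ' := (extChartAt (cotModel E) ℓ).symm (z0.1, p) with hℓ'
    have hsrc : ℓ' ∈ (extChartAt (cotModel E) ℓ).source := (extChartAt (cotModel E) ℓ).map_target hp'
    have hr : extChartAt (cotModel E) ℓ ℓ' = (z0.1, p) := (extChartAt (cotModel E) ℓ).right_inv hp'
    have hproj : ℓ'.proj = ℓ.proj := by
      have h1 := cotChart_fst ℓ ℓ'
      rw [hr, hz0, cotChart_fst] at h1
      exact (extChartAt 𝓘(ℝ, E) ℓ.proj).injOn (mem_cotChart_source.1 hsrc)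
        (mem_extChartAt_source _) h1.symm
    have hcov : ∀ v : E, covecForm ℓ' v = p v := by
      intro v
      rw [covecForm_eq_cotChart_snd hsrc, hr, hproj, chartDeriv_self]
      rfl
    have hval : P.refHam p0 u t ℓ' = covecForm ℓ' (F ℓ'.proj) - p0 * P.f0 ℓ'.proj (u t) :=
      rfl
    rw [comp_apply, ← hℓ', hval, hcov, hproj]
  change hv.1 = F ℓ.proj
  -- In the fibre direction `p`, the differential is `p` applied to the base component of the
  -- Hamiltonian vector; by the affine expression it is also `p` applied to the dynamics. Covectors
  -- separate vectors.
  refine (SeparatingDual.eq_iff_forall_dual_eq (R := ℝ)).2 fun p => ?_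
  have h1 : HasFDerivAt (fun p : E →L[ℝ] ℝ => (z0.1, p))
      (ContinuousLinearMap.inr ℝ E (E →L[ℝ] ℝ)) z0.2 := hasFDerivAt_prodMk_right _ _
  have h2 := (HasFDerivAt.comp (g := P.refHam p0 u t ∘ (extChartAt (cotModel E) ℓ).symm)
    z0.2 hL h1).congr_of_eventuallyEq (f₁ := fun p => p (F ℓ.proj)
      - p0 * P.f0 ℓ.proj (u t)) (hfib.mono fun p hp => hp.symm)
  have h3 : HasFDerivAt (fun p : E →L[ℝ] ℝ => p (F ℓ.proj) - p0 * P.f0 ℓ.proj (u t))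
      (ContinuousLinearMap.apply ℝ ℝ (F ℓ.proj)) z0.2 :=
    (ContinuousLinearMap.apply ℝ ℝ (F ℓ.proj)).hasFDerivAt.sub_const _
  have h4 := congrArg (fun A : (E →L[ℝ] ℝ) →L[ℝ] ℝ => A p) (h2.unique h3)
  simp only [ContinuousLinearMap.comp_apply, ContinuousLinearMap.inr_apply, hLw, map_zero,
    sub_zero] at h4
  exact h4

end Reference

end HamOC

/-! ### The Lipschitz inverse of the projected flow, in coordinates. -/

namespace HamOC

open Filter Function
open scoped NNReal

theorem hasFDerivAt_of_sub_le_sq {E : Type*} [NormedAddCommGroup E] [NormedSpace ℝ E] {f : E → ℝ}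
    {L : E →L[ℝ] ℝ} {x : E} {K : ℝ}
    (h : ∀ᶠ v in 𝓝 (0 : E), |f (x + v) - f x - L v| ≤ K * ‖v‖ ^ 2) : HasFDerivAt f L x := by
  rw [hasFDerivAt_iff_isLittleO_nhds_zero]
  have h1 : (fun v => f (x + v) - f x - L v) =O[𝓝 0] fun v : E => ‖v‖ ^ 2 :=
    Asymptotics.IsBigO.of_bound K (h.mono fun v hv => by simpa using hv)
  refine h1.trans_isLittleO ?_
  have h2 : (fun v : E => ‖v‖ ^ 2) =o[𝓝 0] fun v => ‖v‖ := by
    have := Asymptotics.isLittleO_pow_id (𝕜 := ℝ) (n := 2) (by norm_num)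
    exact this.comp_tendsto tendsto_norm_zero
  exact h2.trans_isBigO (Asymptotics.isBigO_norm_left.2 (Asymptotics.isBigO_refl _ _))

section Inverse

variable {E : Type*} [NormedAddCommGroup E] [NormedSpace ℝ E]
  {M : Type*} [TopologicalSpace M] [ChartedSpace E M] [IsManifold 𝓘(ℝ, E) ∞ M] [Nonempty M]
  {H : ℝ → Cotangent E M → ℝ} {J : Set ℝ} {O Λ : Set (Cotangent E M)}
  {flow : ℝ → Cotangent E M → Cotangent E M} {T T₁ : ℝ} {ξ : ℝ → M}

theorem IsProjBiLipschitz.projFlowInv_eq (hproj : IsProjBiLipschitz T T₁ ξ Λ flow) {t : ℝ}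
    (ht : t ∈ Icc 0 T₁) {ℓ : Cotangent E M} (hℓ : ℓ ∈ Λ) :
    projFlowInv flow Λ t (flow t ℓ).proj = ℓ := by
  have hex : ∃ ℓ' ∈ Λ, (fun ℓ => (flow t ℓ).proj) ℓ' = (flow t ℓ).proj := ⟨ℓ, hℓ, rfl⟩
  have h1 := invFunOn_mem hex
  have h2 := invFunOn_eq hex
  have h3 := hproj.injOn (x₁ := (t, projFlowInv flow Λ t (flow t ℓ).proj)) (x₂ := (t, ℓ))
    ⟨ht, h1⟩ ⟨ht, hℓ⟩ (Prod.ext rfl h2)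
  exact congrArg Prod.snd h3

theorem projFlowInv_spec {t : ℝ} {x : M} (hx : (t, x) ∈ projFlow flow '' (Icc 0 T₁ ×ˢ Λ)) :
    projFlowInv flow Λ t x ∈ Λ ∧ (flow t (projFlowInv flow Λ t x)).proj = x := by
  obtain ⟨⟨t', ℓ⟩, ⟨-, hℓ⟩, he⟩ := hx
  obtain rfl : t' = t := congrArg Prod.fst he
  have hx : (flow t' ℓ).proj = x := congrArg Prod.snd he
  have hex : ∃ ℓ' ∈ Λ, (fun ℓ => (flow t' ℓ).proj) ℓ' = x := ⟨ℓ, hℓ, hx⟩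
  exact ⟨invFunOn_mem hex, invFunOn_eq hex⟩

/-- The image of `I × Λ` is only relatively open in `I × M`, but `0 < T < T₁` makes it a full
neighbourhood of the final point; hence a ball in which time varies on both sides of `T`. -/
theorem IsProjBiLipschitz.exists_lipschitz_inverse (hproj : IsProjBiLipschitz T T₁ ξ Λ flow)
    (h0 : 0 < T) (hT : T < T₁) {ℓ0 : Cotangent E M} (hℓ0 : ℓ0 ∈ Λ) {V : Set (Cotangent E M)}
    (hV : V ∈ 𝓝[Λ] ℓ0) :
    ∃ δ > 0, ∃ K : ℝ≥0,
      (∀ z ∈ Metric.ball (T, extChartAt 𝓘(ℝ, E) (flow T ℓ0).proj (flow T ℓ0).proj) δ,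
        z.1 ∈ Ioo 0 T₁ ∧ z.2 ∈ (extChartAt 𝓘(ℝ, E) (flow T ℓ0).proj).target ∧
        projFlowInv flow Λ z.1 ((extChartAt 𝓘(ℝ, E) (flow T ℓ0).proj).symm z.2) ∈ V ∧
        (flow z.1 (projFlowInv flow Λ z.1
          ((extChartAt 𝓘(ℝ, E) (flow T ℓ0).proj).symm z.2))).proj =
            (extChartAt 𝓘(ℝ, E) (flow T ℓ0).proj).symm z.2) ∧
      LipschitzOnWith K (fun z : ℝ × E => extChartAt (cotModel E) ℓ0 (projFlowInv flow Λ z.1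
        ((extChartAt 𝓘(ℝ, E) (flow T ℓ0).proj).symm z.2)))
        (Metric.ball (T, extChartAt 𝓘(ℝ, E) (flow T ℓ0).proj (flow T ℓ0).proj) δ) := by
  set xf := (flow T ℓ0).proj with hxf
  set ψ := extChartAt 𝓘(ℝ, E) xf with hψ
  have hTI : T ∈ Icc 0 T₁ := ⟨h0.le, hT.le⟩
  have hmem : (T, xf) ∈ projFlow flow '' (Icc 0 T₁ ×ˢ Λ) := ⟨(T, ℓ0), ⟨hTI, hℓ0⟩, rfl⟩
  obtain ⟨W, hW, hWe⟩ := hproj.isOpen_image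
  have himage : projFlow flow '' (Icc 0 T₁ ×ˢ Λ) ∈ 𝓝 (T, xf) := by
    rw [hWe] at hmem ⊢
    exact inter_mem (hW.mem_nhds hmem.1) (prod_mem_nhds (Icc_mem_nhds h0 hT) univ_mem)
  have hinv : projFlowInv flow Λ T xf = ℓ0 := hproj.projFlowInv_eq hTI hℓ0
  obtain ⟨K, w, hw, -, hwmaps, hwK⟩ := hproj.locLip_inv (T, xf) hmem
  rw [nhdsWithin_eq_nhds.2 himage] at hw
  simp only [hinv] at hwmaps hwK
  -- the parametrization by coordinates
  have hσ : Tendsto (fun z : ℝ × E => (z.1, ψ.symm z.2)) (𝓝 (T, ψ xf)) (𝓝 (T, xf)) := by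
    have h1 : Tendsto ψ.symm (𝓝 (ψ xf)) (𝓝 xf) := by
      have := (continuousAt_extChartAt_symm (I := 𝓘(ℝ, E)) xf).tendsto
      rwa [extChartAt_to_inv] at this
    exact (continuousAt_fst.tendsto (x := (T, ψ xf))).prodMk_nhds
      (h1.comp continuousAt_snd.tendsto)
  have htgt : ∀ᶠ z : ℝ × E in 𝓝 (T, ψ xf), z.2 ∈ ψ.target :=
    continuousAt_snd (extChartAt_target_mem_nhds (I := 𝓘(ℝ, E)) xf)
  have hlip : ∀ z z' : ℝ × E, z.2 ∈ ψ.target → z'.2 ∈ ψ.target →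
      (z.1, ψ.symm z.2) ∈ w → (z'.1, ψ.symm z'.2) ∈ w →
      ‖extChartAt (cotModel E) ℓ0 (projFlowInv flow Λ z.1 (ψ.symm z.2)) -
        extChartAt (cotModel E) ℓ0 (projFlowInv flow Λ z'.1 (ψ.symm z'.2))‖ ≤
      K.toNNReal * ‖z - z'‖ := by
    intro z z' hz hz' hzw hzw'
    have h1 := hwK _ hzw _ hzw'
    have e1 : ‖extChartAt (𝓘(ℝ, ℝ).prod 𝓘(ℝ, E)) (T, xf) (z.1, ψ.symm z.2)
        - extChartAt (𝓘(ℝ, ℝ).prod 𝓘(ℝ, E)) (T, xf) (z'.1, ψ.symm z'.2)‖ = ‖z - z'‖ := by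
      rw [extChartAt_prod]
      change ‖(z.1, ψ (ψ.symm z.2)) - (z'.1, ψ (ψ.symm z'.2))‖ = _
      rw [ψ.right_inv hz, ψ.right_inv hz']
    rw [e1, extChartAt_prod] at h1
    refine (le_trans ?_ h1).trans (mul_le_mul_of_nonneg_right (Real.le_coe_toNNReal K)
      (norm_nonneg _))
    exact norm_snd_le ((z.1, extChartAt (cotModel E) ℓ0 (projFlowInv flow Λ z.1 (ψ.symm z.2))) -
        ((z'.1, extChartAt (cotModel E) ℓ0 (projFlowInv flow Λ z'.1 (ψ.symm z'.2))) :
          ℝ × (E × (E →L[ℝ] ℝ))))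
  have hwz := hσ.eventually hw
  have hsrc : ∀ᶠ z : ℝ × E in 𝓝 (T, ψ xf),
      projFlowInv flow Λ z.1 (ψ.symm z.2) ∈ (extChartAt (cotModel E) ℓ0).source := by
    filter_upwards [hwz] with z hz
    have := hwmaps hz
    rw [extChartAt_prod] at this
    exact this.2
  have hz0 : projFlowInv flow Λ T (ψ.symm (ψ xf)) = ℓ0 := by rw [extChartAt_to_inv, hinv]
  have hchart : Tendsto (fun z : ℝ × E =>
      extChartAt (cotModel E) ℓ0 (projFlowInv flow Λ z.1 (ψ.symm z.2))) (𝓝 (T, ψ xf))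
      (𝓝 (extChartAt (cotModel E) ℓ0 ℓ0)) := by
    rw [tendsto_iff_norm_sub_tendsto_zero]
    have hb : Tendsto (fun z : ℝ × E => K.toNNReal * ‖z - (T, ψ xf)‖) (𝓝 (T, ψ xf)) (𝓝 0) := by
      have : Continuous fun z : ℝ × E => (K.toNNReal : ℝ) * ‖z - (T, ψ xf)‖ := by fun_prop
      simpa using this.tendsto (T, ψ xf)
    refine squeeze_zero' (Eventually.of_forall fun z => norm_nonneg _) ?_ hb
    filter_upwards [hwz, htgt] with z h1 h2
    have := hlip z (T, ψ xf) h2 htgt.self_of_nhds h1 hwz.self_of_nhds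
    rwa [hz0] at this
  -- The Lipschitz bound controls only chart coordinates; since the inverse stays in the source of
  -- the chart, this gives convergence in the cotangent bundle, hence membership in `V`.
  have hten : Tendsto (fun z : ℝ × E => projFlowInv flow Λ z.1 (ψ.symm z.2)) (𝓝 (T, ψ xf))
      (𝓝[Λ] ℓ0) := by
    refine tendsto_nhdsWithin_iff.2 ⟨?_, ?_⟩
    · have h1 := (continuousAt_extChartAt_symm (I := cotModel E) ℓ0).tendsto
      rw [extChartAt_to_inv] at h1
      refine (h1.comp hchart).congr' ?_
      filter_upwards [hsrc] with z hz
      exact (extChartAt (cotModel E) ℓ0).left_inv hz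
    · filter_upwards [hσ.eventually himage] with z hz using (projFlowInv_spec hz).1
  have htime : ∀ᶠ z : ℝ × E in 𝓝 (T, ψ xf), z.1 ∈ Ioo 0 T₁ :=
    continuousAt_fst (Ioo_mem_nhds h0 hT)
  have hall := htime.and (htgt.and ((hten.eventually hV).and ((hσ.eventually himage).and hwz)))
  obtain ⟨δ, hδ, hball⟩ := Metric.eventually_nhds_iff_ball.1 hall
  refine ⟨δ, hδ, K.toNNReal, fun z hz => ?_, LipschitzOnWith.of_dist_le_mul fun z hz z' hz' => ?_⟩
  · obtain ⟨h1, h2, h3, h4, -⟩ := hball z hz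
    exact ⟨h1, h2, h3, (projFlowInv_spec h4).2⟩
  · rw [dist_eq_norm, dist_eq_norm]
    exact hlip z z' (hball z hz).2.1 (hball z' hz').2.1 (hball z hz).2.2.2.2
      (hball z' hz').2.2.2.2

end Inverse

end HamOC

/-! ### The spatial differential of `α_t`. -/

namespace HamOC

open Filter Function
open scoped NNReal

variable {E : Type*} [NormedAddCommGroup E] [NormedSpace ℝ E] [FiniteDimensional ℝ E]
  {M : Type*} [TopologicalSpace M] [ChartedSpace E M] [IsManifold 𝓘(ℝ, E) ∞ M] [Nonempty M]
  {H : ℝ → Cotangent E M → ℝ} {J : Set ℝ} {O : Set (Cotangent E M)}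
  {flow : ℝ → Cotangent E M → Cotangent E M} {T T₁ : ℝ} {ξ : ℝ → M} {α : M → ℝ} {A : Set M}

/-- In coordinates, the section `flow_t ∘ (π flow_t)⁻¹` is Lipschitz in time and space, and is the
spatial differential of `α_t`. -/
theorem IsRegularFlow.exists_hasFDerivAt_alphaT
    (hflow : IsRegularFlow H J O (dSection E α '' A) flow) (hJ : IsOpen J) (hJ' : J.OrdConnected)
    (hA : IsOpen A) (hα : ContMDiffOn 𝓘(ℝ, E) 𝓘(ℝ, ℝ) ∞ α A)
    (hT0 : 0 < T) (hT : T < T₁) (hT₁ : Icc 0 T₁ ⊆ J)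
    (hproj : IsProjBiLipschitz T T₁ ξ (dSection E α '' A) flow)
    {ℓ0 : Cotangent E M} (hℓ0 : ℓ0 ∈ dSection E α '' A) :
    ∃ δ > 0, ∃ K : ℝ≥0, ∃ ρ : ℝ × E → Cotangent E M, ∃ p : ℝ × E → (E →L[ℝ] ℝ),
      (∀ z, ρ z = projFlowInv flow (dSection E α '' A) z.1
        ((extChartAt 𝓘(ℝ, E) (flow T ℓ0).proj).symm z.2)) ∧
      (∀ z ∈ Metric.ball (T, extChartAt 𝓘(ℝ, E) (flow T ℓ0).proj (flow T ℓ0).proj) δ,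
        z.1 ∈ Ioo 0 T₁ ∧ z.2 ∈ (extChartAt 𝓘(ℝ, E) (flow T ℓ0).proj).target ∧
        ρ z ∈ dSection E α '' A ∧
        (flow z.1 (ρ z)).proj = (extChartAt 𝓘(ℝ, E) (flow T ℓ0).proj).symm z.2 ∧
        flow z.1 (ρ z) ∈ (extChartAt (cotModel E) (flow T ℓ0)).source ∧
        extChartAt (cotModel E) (flow T ℓ0) (flow z.1 (ρ z)) = (z.2, p z) ∧
        HasFDerivAt (fun y => alphaT H flow α A z.1
          ((extChartAt 𝓘(ℝ, E) (flow T ℓ0).proj).symm y)) (p z) z.2) ∧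
      LipschitzOnWith K p
        (Metric.ball (T, extChartAt 𝓘(ℝ, E) (flow T ℓ0).proj (flow T ℓ0).proj) δ) := by
  have hTJ : T ∈ J := hT₁ ⟨hT0.le, hT.le⟩
  have h0J : (0 : ℝ) ∈ J := hT₁ ⟨le_rfl, (hT0.trans hT).le⟩
  obtain ⟨ε, hε, V, hV, hVΛ, -, hsrc, ⟨K1, hK1⟩, hθ⟩ :=
    hflow.exists_theta_sub hJ hJ' hA hα hℓ0 hTJ h0J
  obtain ⟨δ0, hδ0, K2, hinv, hK2⟩ := hproj.exists_lipschitz_inverse hT0 hT hℓ0 hV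
  set xf := (flow T ℓ0).proj with hxf
  set ψ := extChartAt 𝓘(ℝ, E) xf with hψ
  set Φf := extChartAt (cotModel E) (flow T ℓ0) with hΦf
  set Λ := dSection E α '' A with hΛ
  set ρ : ℝ × E → Cotangent E M := fun z => projFlowInv flow Λ z.1 (ψ.symm z.2) with hρ
  set p : ℝ × E → (E →L[ℝ] ℝ) := fun z => (Φf (flow z.1 (ρ z))).2 with hp
  have hδ : 0 < min δ0 ε := lt_min hδ0 hε
  have hb0 : ∀ z ∈ Metric.ball (T, ψ xf) (min δ0 ε), z ∈ Metric.ball (T, ψ xf) δ0 :=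
    Metric.ball_subset_ball (min_le_left _ _)
  have hbt : ∀ z ∈ Metric.ball (T, ψ xf) (min δ0 ε), z.1 ∈ Ioo (T - ε) (T + ε) := by
    intro z hz
    have h1 : dist z.1 T < ε :=
      (le_max_left _ _).trans_lt (lt_of_lt_of_le (Metric.mem_ball.1 hz) (min_le_right _ _))
    rw [← Real.ball_eq_Ioo]
    exact h1
  have hchart : ∀ z ∈ Metric.ball (T, ψ xf) (min δ0 ε), Φf (flow z.1 (ρ z)) = (z.2, p z) := by
    intro z hz
    obtain ⟨-, h2, -, h4⟩ := hinv z (hb0 z hz)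
    refine Prod.ext ?_ rfl
    refine (cotChart_fst (flow T ℓ0) (flow z.1 (ρ z))).trans ?_
    rw [h4, ψ.right_inv h2]
  have hplip : ∀ z ∈ Metric.ball (T, ψ xf) (min δ0 ε), ∀ z' ∈ Metric.ball (T, ψ xf) (min δ0 ε),
      ‖Φf (flow z.1 (ρ z)) - Φf (flow z'.1 (ρ z'))‖ ≤ K1 * max 1 K2 * ‖z - z'‖ := by
    intro z hz z' hz'
    have h1 := hK1 z.1 (hbt z hz) (ρ z) (hinv z (hb0 z hz)).2.2.1 z'.1 (hbt z' hz') (ρ z')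
      (hinv z' (hb0 z' hz')).2.2.1
    have h2 := hK2.dist_le_mul z (hb0 z hz) z' (hb0 z' hz')
    rw [dist_eq_norm, dist_eq_norm] at h2
    refine h1.trans ?_
    rw [mul_assoc]
    refine mul_le_mul_of_nonneg_left (max_le ?_ (h2.trans ?_)) K1.2
    · have h3 : |z.1 - z'.1| ≤ ‖z - z'‖ := norm_fst_le (z - z')
      have h4 : (1 : ℝ) ≤ max 1 (K2 : ℝ) := le_max_left _ _
      exact h3.trans (le_mul_of_one_le_left (norm_nonneg _) h4)
    · exact mul_le_mul_of_nonneg_right (le_max_right _ _) (norm_nonneg _)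
  have hplip2 : LipschitzOnWith (K1 * max 1 K2) p (Metric.ball (T, ψ xf) (min δ0 ε)) := by
    refine LipschitzOnWith.of_dist_le_mul fun z hz z' hz' => ?_
    rw [dist_eq_norm, dist_eq_norm]
    have h1 := hplip z hz z' hz'
    rw [hchart z hz, hchart z' hz'] at h1
    refine (norm_snd_le ((z.2, p z) - (z'.2, p z'))).trans (h1.trans_eq ?_)
    push_cast
    rfl
  refine ⟨min δ0 ε, hδ, K1 * max 1 K2, ρ, p, fun z => rfl, fun z hz => ?_, hplip2⟩
  obtain ⟨h1, h2, h3, h4⟩ := hinv z (hb0 z hz)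
  refine ⟨h1, h2, hVΛ h3, h4, hsrc _ (hbt z hz) _ h3, hchart z hz, ?_⟩
  obtain ⟨t, y⟩ := z
  -- The increment of `α_t` over the segment from `y` to `y + v` is the integral of `p` applied to
  -- `v`; freezing `p` at the initial point costs its Lipschitz constant times `‖v‖²`.
  refine hasFDerivAt_of_sub_le_sq (K := K1 * max 1 K2) ?_
  have hev : ∀ᶠ v in 𝓝 (0 : E), (t, y + v) ∈ Metric.ball (T, ψ xf) (min δ0 ε) := by
    have hc : Continuous fun v : E => (t, y + v) := by fun_prop
    exact hc.continuousAt.eventually (Metric.isOpen_ball.mem_nhds (by simpa using hz))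
  filter_upwards [hev] with v hv
  -- Clamping the parameter keeps the segment in the ball for every real `s`, since the primitive
  -- property is stated for curves defined on all of `ℝ`.
  set c : ℝ → ℝ := fun s => max 0 (min 1 s) with hc
  have hclip : LipschitzWith 1 c := (LipschitzWith.id.const_min 1).const_max 0
  have hc01 : ∀ s, c s ∈ Icc (0 : ℝ) 1 := fun s =>
    ⟨le_max_left _ _, max_le zero_le_one (min_le_left _ _)⟩
  have hcs : ∀ s ∈ Icc (0 : ℝ) 1, c s = s := fun s hs => by simp [hc, hs.1, hs.2]
  set ζ : ℝ → ℝ × E := fun s => (t, y + c s • v) with hζ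
  have hζb : ∀ s, ζ s ∈ Metric.ball (T, ψ xf) (min δ0 ε) := by
    intro s
    have h := (convex_ball (T, ψ xf) (min δ0 ε)).add_smul_sub_mem hz hv (hc01 s)
    simpa [hζ] using h
  have hζlip : ∀ s s', ‖ζ s - ζ s'‖ ≤ ‖v‖ * |s - s'| := by
    intro s s'
    have e : ζ s - ζ s' = (0, (c s - c s') • v) := by
      simp [hζ, sub_smul]
    have h5 := hclip.dist_le_mul s s'
    rw [Real.dist_eq, Real.dist_eq, NNReal.coe_one, one_mul] at h5
    rw [e, Prod.norm_mk, norm_zero, norm_smul, Real.norm_eq_abs,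
      max_eq_right (by positivity), mul_comm]
    exact mul_le_mul_of_nonneg_left h5 (norm_nonneg _)
  have hγ := hθ (fun s => ρ (ζ s)) (fun s => (hinv _ (hb0 _ (hζb s))).2.2.1)
    ⟨K2 * ‖v‖₊, LipschitzWith.of_dist_le_mul fun s s' => by
      have h5 := hK2.dist_le_mul _ (hb0 _ (hζb s)) _ (hb0 _ (hζb s'))
      refine h5.trans ?_
      rw [dist_eq_norm (ζ s), Real.dist_eq]
      push_cast
      rw [mul_assoc]
      exact mul_le_mul_of_nonneg_left (hζlip s s') K2.2⟩ t (hbt _ hz)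
  have hζ0 : ζ 0 = (t, y) := by simp [hζ, hcs 0 (by simp)]
  have hζ1 : ζ 1 = (t, y + v) := by simp [hζ, hcs 1 (by simp)]
  have e1 : ∀ w : E, theta H flow α t (ρ (t, w)) = alphaT H flow α A t (ψ.symm w) := fun w => rfl
  rw [hζ0, hζ1, e1, e1, liouvilleIntegral_eq_cotChart (ℓ0 := flow T ℓ0)
    (K := K1 * max 1 K2 * ‖v‖₊)
    (fun s => hsrc t (hbt _ hz) _ (hinv _ (hb0 _ (hζb s))).2.2.1)
    (LipschitzWith.of_dist_le_mul fun s s' => by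
      have h5 := hplip _ (hζb s) _ (hζb s')
      rw [dist_eq_norm, Real.dist_eq]
      refine h5.trans ?_
      push_cast
      rw [mul_assoc ((K1 : ℝ) * max 1 (K2 : ℝ))]
      exact mul_le_mul_of_nonneg_left (hζlip s s') (by positivity))] at hγ
  have hint : (∫ s in (0:ℝ)..1, (extChartAt (cotModel E) (flow T ℓ0) (flow t (ρ (ζ s)))).2
      (deriv (fun s => (extChartAt (cotModel E) (flow T ℓ0) (flow t (ρ (ζ s)))).1) s)) =
      ∫ s in (0:ℝ)..1, p (ζ s) v := by
    have hfun : (fun s => (extChartAt (cotModel E) (flow T ℓ0) (flow t (ρ (ζ s)))).1) =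
        fun s => y + c s • v := funext fun s => congrArg Prod.fst (hchart _ (hζb s))
    rw [hfun]
    refine intervalIntegral.integral_congr_ae ?_
    -- The clamped segment may have a corner at `s = 1`; the value `s = 0` is already outside the
    -- half-open interval.
    have hne : ∀ᵐ s : ℝ, s ≠ 1 := by simp [ae_iff]
    filter_upwards [hne] with s hs1 hs
    rw [uIoc_of_le zero_le_one] at hs
    have hd : HasDerivAt (fun s => y + c s • v) v s := by
      have h6 : HasDerivAt (fun s : ℝ => y + s • v) ((1 : ℝ) • v) s :=
        ((hasDerivAt_id s).smul_const v).const_add y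
      rw [one_smul] at h6
      refine h6.congr_of_eventuallyEq ?_
      filter_upwards [Ioo_mem_nhds hs.1 (lt_of_le_of_ne hs.2 hs1)] with r hr
      rw [hcs r ⟨hr.1.le, hr.2.le⟩]
    rw [hd.deriv]
  have hpc : Continuous fun s => p (ζ s) v := by
    have h6 : Continuous ζ := by
      have := hclip.continuous
      fun_prop
    have h7 := hplip2.continuousOn.comp_continuous h6 hζb
    exact h7.clm_apply continuous_const
  rw [hint] at hγ
  have hsub : (∫ s in (0:ℝ)..1, p (ζ s) v) - p (t, y) v
      = ∫ s in (0:ℝ)..1, (p (ζ s) - p (t, y)) v := by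
    simp only [ContinuousLinearMap.sub_apply]
    rw [intervalIntegral.integral_sub (hpc.intervalIntegrable _ _)
      (continuous_const.intervalIntegrable _ _)]
    simp
  change |alphaT H flow α A t (ψ.symm (y + v)) - alphaT H flow α A t (ψ.symm y) - p (t, y) v| ≤ _
  rw [hγ, hsub, ← Real.norm_eq_abs]
  have hbd : ∀ s ∈ uIoc (0:ℝ) 1, ‖(p (ζ s) - p (t, y)) v‖ ≤ K1 * max 1 K2 * ‖v‖ ^ 2 := by
    intro s hs
    rw [uIoc_of_le zero_le_one] at hs
    refine (ContinuousLinearMap.le_opNorm _ _).trans ?_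
    have h5 := hplip2.dist_le_mul _ (hζb s) _ hz
    rw [dist_eq_norm, dist_eq_norm, ← hζ0] at h5
    have h8 := hζlip s 0
    rw [hζ0] at h5 h8
    have h9 : ‖v‖ * |s - 0| ≤ ‖v‖ := by
      rw [sub_zero, abs_of_pos hs.1]
      exact mul_le_of_le_one_right (norm_nonneg _) hs.2
    push_cast at h5
    have h10 := h5.trans (mul_le_mul_of_nonneg_left (h8.trans h9) (by positivity))
    calc _ ≤ _ := mul_le_mul_of_nonneg_right h10 (norm_nonneg v)
      _ = _ := by rw [show ((max 1 K2 : ℝ≥0) : ℝ) = max 1 (K2 : ℝ) from rfl]; ring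
  have := intervalIntegral.norm_integral_le_of_norm_le_const hbd
  simpa using this

end HamOC

/-! ### The Hamilton–Jacobi equation along trajectories. -/

namespace HamOC

open Filter Function
open scoped NNReal

theorem LocLipOn.continuousOn {E' : Type*} [NormedAddCommGroup E'] [NormedSpace ℝ E']
    {H' : Type*} [TopologicalSpace H'] {I' : ModelWithCorners ℝ E' H'}
    {N : Type*} [TopologicalSpace N] [ChartedSpace H' N]
    {E'' : Type*} [NormedAddCommGroup E''] [NormedSpace ℝ E'']
    {H'' : Type*} [TopologicalSpace H''] {I'' : ModelWithCorners ℝ E'' H''}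
    {N' : Type*} [TopologicalSpace N'] [ChartedSpace H'' N'] {g : N → N'} {s : Set N}
    (hg : LocLipOn I' I'' g s) : ContinuousOn g s := by
  intro x hx
  obtain ⟨K, w, hw, -, hmaps, hK⟩ := hg x hx
  have hxw : x ∈ w := mem_of_mem_nhdsWithin hx hw
  have hc : Tendsto (fun y => extChartAt I'' (g x) (g y)) (𝓝[s] x)
      (𝓝 (extChartAt I'' (g x) (g x))) := by
    rw [tendsto_iff_norm_sub_tendsto_zero]
    have hb : Tendsto (fun y => K * ‖extChartAt I' x y - extChartAt I' x x‖) (𝓝[s] x) (𝓝 0) := by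
      have h1 : ContinuousAt (fun y => K * ‖extChartAt I' x y - extChartAt I' x x‖) x :=
        continuousAt_const.mul (((continuousAt_extChartAt x).sub continuousAt_const).norm)
      have h2 := h1.tendsto
      simp only [sub_self, norm_zero, mul_zero] at h2
      exact h2.mono_left nhdsWithin_le_nhds
    refine squeeze_zero' (Eventually.of_forall fun _ => norm_nonneg _) ?_ hb
    filter_upwards [hw] with y hy using hK y hy x hxw
  have h3 := (continuousAt_extChartAt_symm (I := I'') (g x)).tendsto
  have h4 := h3.comp hc
  rw [extChartAt_to_inv] at h4
  refine h4.congr' ?_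
  filter_upwards [hw] with y hy using (extChartAt I'' (g x)).left_inv (hmaps hy)

variable {E : Type*} [NormedAddCommGroup E] [NormedSpace ℝ E] [FiniteDimensional ℝ E]
  {M : Type*} [TopologicalSpace M] [ChartedSpace E M] [IsManifold 𝓘(ℝ, E) ∞ M]
  {H : ℝ → Cotangent E M → ℝ} {J : Set ℝ} {O Λ : Set (Cotangent E M)}
  {flow : ℝ → Cotangent E M → Cotangent E M} {T T₁ : ℝ} {ξ : ℝ → M} {α : M → ℝ} {A : Set M}

theorem IsRegularFlow.continuousOn_flow (hflow : IsRegularFlow H J O Λ flow)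
    {ℓ : Cotangent E M} (hℓ : ℓ ∈ Λ) : ContinuousOn (fun t => flow t ℓ) J :=
  hflow.flow_locLip.continuousOn.comp (f := fun t : ℝ => (t, ℓ)) (by fun_prop)
    fun _ ht => ⟨ht, hℓ⟩

/-- The Hamilton–Jacobi equation for `α_t`, along the trajectories of the flow. -/
theorem IsRegularFlow.ae_hamiltonJacobi [Nonempty M]
    (hflow : IsRegularFlow H J O (dSection E α '' A) flow)
    (hT₁ : Icc 0 T₁ ⊆ J) (hproj : IsProjBiLipschitz T T₁ ξ (dSection E α '' A) flow)
    (ℓf : Cotangent E M) {ℓ : Cotangent E M} (hℓ : ℓ ∈ dSection E α '' A) :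
    ∀ᵐ t : ℝ, t ∈ Ioo 0 T₁ → flow t ℓ ∈ (extChartAt (cotModel E) ℓf).source →
      ∀ L : ℝ × E →L[ℝ] ℝ,
        HasFDerivAt (fun z : ℝ × E => alphaT H flow α A z.1
          ((extChartAt 𝓘(ℝ, E) ℓf.proj).symm z.2)) L
          (t, (extChartAt (cotModel E) ℓf (flow t ℓ)).1) →
        (∀ v, L (0, v) = (extChartAt (cotModel E) ℓf (flow t ℓ)).2 v) →
        L (1, 0) = -H t (flow t ℓ) := by
  have hcont := hflow.continuousOn_flow hℓ
  -- Lebesgue differentiation of the integral defining `θ`. The exceptional times depend on `ℓ`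
  -- only, so every candidate `L` at the remaining times is covered.
  have hae : ∀ᵐ t : ℝ, t ∈ Ioo 0 T₁ →
      HasDerivAt (fun s => theta H flow α s ℓ) (cartanAlong H flow t ℓ) t := by
    by_cases h0 : 0 < T₁
    · have hint : IntervalIntegrable (fun t => cartanAlong H flow t ℓ) volume 0 T₁ :=
        hflow.intervalIntegrable_cartanAlong hℓ (by rwa [uIcc_of_le h0.le])
      filter_upwards [hint.ae_hasDerivAt_integral] with t ht hts
      rw [uIcc_of_le h0.le] at ht
      exact (ht (Ioo_subset_Icc_self hts) 0 ⟨le_rfl, h0.le⟩).const_add _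
    · refine Eventually.of_forall fun t ht => absurd (ht.1.trans ht.2) h0
  filter_upwards [hae, hflow.flow_ode ℓ hℓ] with t hθ hode ht hsrc L hL hLp
  have htJ : t ∈ J := hT₁ (Ioo_subset_Icc_self ht)
  obtain ⟨-, hvel⟩ := hode htJ
  set Φf := extChartAt (cotModel E) ℓf with hΦf
  set h : E × (E →L[ℝ] ℝ) := hamVec (H t) (flow t ℓ) with hh
  have hQ : HasDerivAt (fun s => (Φf (flow s ℓ)).1) (chartDeriv (cotModel E) ℓf (flow t ℓ) h).1 t :=
    hasDerivAt_fst (HasVelocity.hasDerivAt_extChartAt (v := h) hvel hsrc)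
  have hz : HasDerivAt (fun s => (s, (Φf (flow s ℓ)).1))
      ((1 : ℝ), (chartDeriv (cotModel E) ℓf (flow t ℓ) h).1) t := (hasDerivAt_id t).prodMk hQ
  have hcomp := hL.comp_hasDerivAt t hz
  have hct : ContinuousAt (fun s => flow s ℓ) t :=
    hcont.continuousAt (Filter.mem_of_superset (Icc_mem_nhds ht.1 ht.2) hT₁)
  have hsrc' : ∀ᶠ s in 𝓝 t, flow s ℓ ∈ Φf.source :=
    hct.eventually ((isOpen_extChartAt_source (I := cotModel E) ℓf).mem_nhds hsrc)
  -- Along the trajectory `α_s` takes the value `θ_s(ℓ)`. Its derivative is `L(1, 0) + p Q'` by the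
  -- chain rule and `p Q' - H` by the Cartan form, and `p Q'` cancels.
  have heq : (fun s => theta H flow α s ℓ) =ᶠ[𝓝 t]
      (fun z : ℝ × E => alphaT H flow α A z.1 ((extChartAt 𝓘(ℝ, E) ℓf.proj).symm z.2)) ∘
        fun s => (s, (Φf (flow s ℓ)).1) := by
    filter_upwards [hsrc', Ioo_mem_nhds ht.1 ht.2] with s hs hs'
    have e1 : (extChartAt 𝓘(ℝ, E) ℓf.proj).symm (Φf (flow s ℓ)).1 = (flow s ℓ).proj := by
      refine (congrArg _ (cotChart_fst ℓf (flow s ℓ))).trans ?_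
      exact (extChartAt 𝓘(ℝ, E) ℓf.proj).left_inv (mem_cotChart_source.1 hs)
    change _ = theta H flow α s (projFlowInv flow (dSection E α '' A) s
      ((extChartAt 𝓘(ℝ, E) ℓf.proj).symm (Φf (flow s ℓ)).1))
    rw [e1, hproj.projFlowInv_eq (Ioo_subset_Icc_self hs') hℓ]
  have h1 := (hcomp.congr_of_eventuallyEq heq).unique (hθ ht)
  have h2 : cartanAlong H flow t ℓ =
      (Φf (flow t ℓ)).2 (chartDeriv (cotModel E) ℓf (flow t ℓ) h).1 - H t (flow t ℓ) :=
    congrArg (· - H t (flow t ℓ)) (liouville_eq_cotChart hsrc h)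
  rw [h2, ← hLp] at h1
  have h3 : ((1 : ℝ), (chartDeriv (cotModel E) ℓf (flow t ℓ) h).1) =
      (1, 0) + (0, (chartDeriv (cotModel E) ℓf (flow t ℓ) h).1) := by simp
  rw [h3, map_add] at h1
  linarith

end HamOC

/-! ### Differentiating the Hamilton–Jacobi equation at the final point. -/

namespace HamOC

open Filter Function
open scoped NNReal

variable {E : Type*} [NormedAddCommGroup E] [NormedSpace ℝ E] [FiniteDimensional ℝ E]
  {M : Type*} [TopologicalSpace M] [ChartedSpace E M] [IsManifold 𝓘(ℝ, E) ∞ M]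
  {H : ℝ → Cotangent E M → ℝ} {J : Set ℝ} {O Λ : Set (Cotangent E M)}
  {flow : ℝ → Cotangent E M → Cotangent E M} {T T₁ : ℝ} {ξ : ℝ → M} {α : M → ℝ} {A : Set M}

/-- The differential of a time-dependent Hamiltonian, in canonical coordinates. -/
theorem exists_hasFDerivAt_timeDep {ℓ : Cotangent E M}
    (hH : MDifferentiableAt (𝓘(ℝ, ℝ).prod (cotModel E)) 𝓘(ℝ, ℝ)
      (fun z : ℝ × Cotangent E M => H z.1 z.2) (T, ℓ)) :
    ∃ L : ℝ × (E × (E →L[ℝ] ℝ)) →L[ℝ] ℝ,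
      HasFDerivAt (fun w : ℝ × (E × (E →L[ℝ] ℝ)) => H w.1 ((extChartAt (cotModel E) ℓ).symm w.2)) L
        (T, extChartAt (cotModel E) ℓ ℓ) ∧
      ∀ (τ : ℝ) (w : E × (E →L[ℝ] ℝ)), L (τ, w) = τ * deriv (fun t => H t ℓ) T +
        (w.2 (hamVec (H T) ℓ : E × (E →L[ℝ] ℝ)).1 - (hamVec (H T) ℓ : E × (E →L[ℝ] ℝ)).2 w.1) := by
  obtain ⟨L, hL, -⟩ := exists_hasFDerivAt_comp_extChartAt_symm (x := (T, ℓ)) hH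
    (mem_extChartAt_source _)
  rw [extChartAt_prod] at hL
  have hL' : HasFDerivAt (fun w : ℝ × (E × (E →L[ℝ] ℝ)) =>
      H w.1 ((extChartAt (cotModel E) ℓ).symm w.2)) L (T, extChartAt (cotModel E) ℓ ℓ) := hL
  refine ⟨L, hL', fun τ w => ?_⟩
  have hsrc := mem_extChartAt_source (I := cotModel E) ℓ
  have h1 : HasDerivAt (fun t => H t ℓ) (L (1, 0)) T := by
    have h2 : HasDerivAt (fun t : ℝ => (t, extChartAt (cotModel E) ℓ ℓ))
        ((1 : ℝ), (0 : E × (E →L[ℝ] ℝ))) T := (hasDerivAt_id T).prodMk (hasDerivAt_const _ _)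
    have h3 := hL'.comp_hasDerivAt T h2
    refine h3.congr_of_eventuallyEq (Eventually.of_forall fun t => ?_)
    exact congrArg (H t) ((extChartAt (cotModel E) ℓ).left_inv hsrc).symm
  have hmd : MDifferentiableAt (cotModel E) 𝓘(ℝ, ℝ) (H T) ℓ := by
    have h2 : MDifferentiableAt (cotModel E) (𝓘(ℝ, ℝ).prod (cotModel E))
        (fun ℓ : Cotangent E M => (T, ℓ)) ℓ :=
      mdifferentiableAt_const.prodMk mdifferentiableAt_id
    exact hH.comp ℓ h2
  obtain ⟨L2, hL2, hL2v⟩ := exists_hasFDerivAt_cotChart hmd hsrc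
  have h4 : HasFDerivAt (H T ∘ (extChartAt (cotModel E) ℓ).symm)
      (L.comp (ContinuousLinearMap.inr ℝ ℝ _)) (extChartAt (cotModel E) ℓ ℓ) :=
    hL'.comp (f := fun w => (T, w)) _ (hasFDerivAt_prodMk_right T _)
  have h5 := h4.unique hL2
  have h6 : L (0, w) = L2 w := congrArg (fun B : E × (E →L[ℝ] ℝ) →L[ℝ] ℝ => B w) h5
  have h7 : ((τ, w) : ℝ × (E × (E →L[ℝ] ℝ))) = τ • (1, 0) + (0, w) := by simp
  rw [h7, map_add, map_smul, h6, hL2v, h1.deriv, chartDeriv_self]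
  rfl

/-- Near the final point, `dα_T = flow_T ∘ (π flow_T)⁻¹`; and the second derivatives of `α_t` at
the final point are related by differentiating the Hamilton–Jacobi equation. -/
theorem IsRegularFlow.dSection_alphaT_and_fderiv_hamiltonJacobi [Nonempty M]
    (hflow : IsRegularFlow H J O (dSection E α '' A) flow) (hJ : IsOpen J) (hJ' : J.OrdConnected)
    (hA : IsOpen A) (hα : ContMDiffOn 𝓘(ℝ, E) 𝓘(ℝ, ℝ) ∞ α A)
    (hT0 : 0 < T) (hT : T < T₁) (hT₁ : Icc 0 T₁ ⊆ J)
    (hproj : IsProjBiLipschitz T T₁ ξ (dSection E α '' A) flow)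
    {ℓ0 : Cotangent E M} (hℓ0 : ℓ0 ∈ dSection E α '' A)
    (hHf : MDifferentiableAt (𝓘(ℝ, ℝ).prod (cotModel E)) 𝓘(ℝ, ℝ)
      (fun z : ℝ × Cotangent E M => H z.1 z.2) (T, flow T ℓ0))
    (hac : ContDiffAt ℝ 2 (fun z : ℝ × E => alphaT H flow α A z.1
      ((extChartAt 𝓘(ℝ, E) (flow T ℓ0).proj).symm z.2))
      (T, extChartAt 𝓘(ℝ, E) (flow T ℓ0).proj (flow T ℓ0).proj)) :
    (∀ᶠ x in 𝓝 (flow T ℓ0).proj, dSection E (alphaT H flow α A T) x =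
      flow T (projFlowInv flow (dSection E α '' A) T x)) ∧
    ∀ (τ : ℝ) (v : E),
      fderiv ℝ (fderiv ℝ (fun z : ℝ × E => alphaT H flow α A z.1
        ((extChartAt 𝓘(ℝ, E) (flow T ℓ0).proj).symm z.2)))
        (T, extChartAt 𝓘(ℝ, E) (flow T ℓ0).proj (flow T ℓ0).proj) (τ, v) (1, 0) =
      -(τ * deriv (fun t => H t (flow T ℓ0)) T) -
      (fderiv ℝ (fderiv ℝ (fun z : ℝ × E => alphaT H flow α A z.1
        ((extChartAt 𝓘(ℝ, E) (flow T ℓ0).proj).symm z.2)))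
        (T, extChartAt 𝓘(ℝ, E) (flow T ℓ0).proj (flow T ℓ0).proj) (τ, v)
        (0, (hamVec (H T) (flow T ℓ0) : E × (E →L[ℝ] ℝ)).1) -
       (hamVec (H T) (flow T ℓ0) : E × (E →L[ℝ] ℝ)).2 v) := by
  obtain ⟨δ, hδ, -, ρ, p, hρ, hball, -⟩ :=
    hflow.exists_hasFDerivAt_alphaT hJ hJ' hA hα hT0 hT hT₁ hproj hℓ0
  set xf := (flow T ℓ0).proj with hxf
  set ψ := extChartAt 𝓘(ℝ, E) xf with hψ
  set Φf := extChartAt (cotModel E) (flow T ℓ0) with hΦf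
  set Λ := dSection E α '' A with hΛ
  set ac : ℝ × E → ℝ := fun z => alphaT H flow α A z.1 (ψ.symm z.2) with hacdef
  have hTI : T ∈ Icc 0 T₁ := ⟨hT0.le, hT.le⟩
  have hinv : projFlowInv flow Λ T xf = ℓ0 := hproj.projFlowInv_eq hTI hℓ0
  have hψxf : ψ.symm (ψ xf) = xf := extChartAt_to_inv xf
  have hb0 : (T, ψ xf) ∈ Metric.ball (T, ψ xf) δ := Metric.mem_ball_self hδ
  refine ⟨?_, ?_⟩
  · have hψc : Tendsto (fun x => (T, ψ x)) (𝓝 xf) (𝓝 (T, ψ xf)) :=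
      tendsto_const_nhds.prodMk_nhds (continuousAt_extChartAt (I := 𝓘(ℝ, E)) xf)
    filter_upwards [hψc.eventually (Metric.ball_mem_nhds _ hδ),
      extChartAt_source_mem_nhds (I := 𝓘(ℝ, E)) xf] with x hx hxs
    obtain ⟨-, -, hρΛ, -, hsrc, hchart, hder⟩ := hball _ hx
    simp only [hρ, ψ.left_inv hxs] at hsrc hchart
    have hmd : MDifferentiableAt 𝓘(ℝ, E) 𝓘(ℝ, ℝ) (alphaT H flow α A T) x := by
      have h1 : MDifferentiableAt 𝓘(ℝ, E) 𝓘(ℝ, E) ψ x :=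
        mdifferentiableAt_extChartAt (by rwa [← extChartAt_source 𝓘(ℝ, E)])
      have h2 := MDifferentiableAt.comp (I' := 𝓘(ℝ, E)) x
        hder.differentiableAt.mdifferentiableAt h1
      refine h2.congr_of_eventuallyEq ?_
      filter_upwards [(isOpen_extChartAt_source (I := 𝓘(ℝ, E)) xf).mem_nhds hxs] with y hy
      exact congrArg (alphaT H flow α A T) (ψ.left_inv hy).symm
    have h3 := cotChart_dSection (ℓ0 := flow T ℓ0) hmd hxs
    have h4 : fderiv ℝ (alphaT H flow α A T ∘ ψ.symm) (ψ x) = p (T, ψ x) := hder.fderiv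
    refine Φf.injOn ?_ hsrc ?_
    · exact mem_cotChart_source.2 hxs
    · rw [hchart]
      exact h3.trans (congrArg (Prod.mk (ψ x)) h4)
  obtain ⟨L, hL, hLv⟩ := exists_hasFDerivAt_timeDep hHf
  have hdiff : ∀ᶠ z in 𝓝 (T, ψ xf), DifferentiableAt ℝ ac z :=
    (hac.eventually (by norm_num)).mono fun z hz => hz.differentiableAt (by norm_num)
  have hgood : ∀ᶠ z in 𝓝 (T, ψ xf), z ∈ Metric.ball (T, ψ xf) δ ∧ DifferentiableAt ℝ ac z :=
    Filter.Eventually.and (Metric.ball_mem_nhds _ hδ) hdiff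
  have hinr : ∀ z ∈ Metric.ball (T, ψ xf) δ, DifferentiableAt ℝ ac z →
      (fderiv ℝ ac z).comp (ContinuousLinearMap.inr ℝ ℝ E) = p z := by
    intro z hz hd
    have h1 : HasFDerivAt (fun y => ac (z.1, y))
        ((fderiv ℝ ac z).comp (ContinuousLinearMap.inr ℝ ℝ E)) z.2 :=
      hd.hasFDerivAt.comp (f := fun y => (z.1, y)) z.2 (hasFDerivAt_prodMk_right z.1 z.2)
    exact h1.unique (hball z hz).2.2.2.2.2.2
  set D2 := fderiv ℝ (fderiv ℝ ac) (T, ψ xf) with hD2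
  have hD2' : HasFDerivAt (fderiv ℝ ac) D2 (T, ψ xf) :=
    ((hac.fderiv_right (m := 1) (by norm_num)).differentiableAt (by norm_num)).hasFDerivAt
  set HC : ℝ × (E × (E →L[ℝ] ℝ)) → ℝ := fun w => H w.1 (Φf.symm w.2) with hHC
  -- The Hamilton–Jacobi expression is `∂ₜα + H ∘ g`, where `g` collects time, position and the
  -- spatial differential of `α_t`. It is differentiated only at the final point, where `H` is
  -- differentiable in `(t, ℓ)`.
  set g : ℝ × E → ℝ × (E × (E →L[ℝ] ℝ)) := fun z =>
    (z.1, z.2, (fderiv ℝ ac z).comp (ContinuousLinearMap.inr ℝ ℝ E)) with hg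
  have hg0 : g (T, ψ xf) = (T, Φf (flow T ℓ0)) := by
    have h1 := (hball _ hb0).2.2.2.2.2.1
    simp only [hρ, hψxf, hinv] at h1
    rw [h1]
    exact congrArg (fun q => (T, ψ xf, q)) (hinr _ hb0 hdiff.self_of_nhds)
  set R : (ℝ × E →L[ℝ] ℝ) →L[ℝ] (E →L[ℝ] ℝ) :=
    (ContinuousLinearMap.inr ℝ ℝ E).precomp ℝ with hR
  have hg' : HasFDerivAt g ((ContinuousLinearMap.fst ℝ ℝ E).prod
      ((ContinuousLinearMap.snd ℝ ℝ E).prod (R.comp D2))) (T, ψ xf) :=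
    hasFDerivAt_fst.prodMk (hasFDerivAt_snd.prodMk (R.hasFDerivAt.comp _ hD2'))
  have hG1 : HasFDerivAt (fun z => fderiv ℝ ac z (1, 0))
      ((ContinuousLinearMap.apply ℝ ℝ ((1 : ℝ), (0 : E))).comp D2) (T, ψ xf) :=
    (ContinuousLinearMap.apply ℝ ℝ ((1 : ℝ), (0 : E))).hasFDerivAt.comp _ hD2'
  have hL2 : HasFDerivAt HC L (g (T, ψ xf)) := by rw [hg0]; exact hL
  have hG := hG1.add (hL2.comp _ hg')
  have hG0 := fderiv_eq_zero_of_mem_closure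
    (S := {z | fderiv ℝ ac z (1, 0) + HC (g z) = 0}) hG (fun z hz => hz) ?_
  · intro τ v
    have h1 := congrArg (fun B : ℝ × E →L[ℝ] ℝ => B (τ, v)) hG0
    have h2 : D2 (τ, v) (1, 0) + L (τ, v, (D2 (τ, v)).comp (ContinuousLinearMap.inr ℝ ℝ E)) = 0 :=
      h1
    rw [hLv] at h2
    have h3 : ((D2 (τ, v)).comp (ContinuousLinearMap.inr ℝ ℝ E))
        (hamVec (H T) (flow T ℓ0) : E × (E →L[ℝ] ℝ)).1 =
        D2 (τ, v) (0, (hamVec (H T) (flow T ℓ0) : E × (E →L[ℝ] ℝ)).1) := rfl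
    rw [h3] at h2
    linarith
  -- Every `z` near the final point is a limit of zeros: the trajectory through `z` satisfies the
  -- equation at a.e. time, so at times arbitrarily close to `z.1`, and its projection then tends to
  -- `z`.
  · filter_upwards [hgood.eventually_nhds] with z hz
    obtain ⟨hzb, hzd⟩ := hz.self_of_nhds
    obtain ⟨ht, htgt, hρΛ, hzproj, hsrc, hchart, -⟩ := hball z hzb
    have hcf : ContinuousAt (fun t => flow t (ρ z)) z.1 :=
      (hflow.continuousOn_flow hρΛ).continuousAt
        (Filter.mem_of_superset (Icc_mem_nhds ht.1 ht.2) hT₁)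
    have hsrc' : ∀ᶠ t in 𝓝 z.1, flow t (ρ z) ∈ Φf.source :=
      hcf.eventually ((isOpen_extChartAt_source (I := cotModel E) _).mem_nhds hsrc)
    have hcQ : ContinuousAt (fun t => (t, (Φf (flow t (ρ z))).1)) z.1 := by
      have h1 : ContinuousAt Φf (flow z.1 (ρ z)) := continuousAt_extChartAt' hsrc
      have h2 : ContinuousAt (fun t => Φf (flow t (ρ z))) z.1 :=
        ContinuousAt.comp (f := fun t => flow t (ρ z)) h1 hcf
      exact continuousAt_id.prodMk (continuousAt_fst.comp h2)
    have hcz : (z.1, (Φf (flow z.1 (ρ z))).1) = z := by rw [hchart]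
    have hten : Tendsto (fun t => (t, (Φf (flow t (ρ z))).1)) (𝓝 z.1) (𝓝 z) := by
      have := hcQ.tendsto
      rwa [hcz] at this
    have hdense := Measure.dense_of_ae (hflow.ae_hamiltonJacobi hT₁ hproj (flow T ℓ0) hρΛ)
    have hfreq := (mem_closure_iff_frequently.1 (hdense z.1)).and_eventually
      (hsrc'.and (Filter.Eventually.and (Ioo_mem_nhds ht.1 ht.2) (hten.eventually hz)))
    refine mem_closure_iff_frequently.2 (hten.frequently (hfreq.mono ?_))
    rintro t ⟨hHJ, hts, htI, hzt, hdt⟩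
    set z' : ℝ × E := (t, (Φf (flow t (ρ z))).1) with hz'
    have hinv' : ψ.symm z'.2 = (flow t (ρ z)).proj := by
      refine (congrArg ψ.symm (cotChart_fst (flow T ℓ0) (flow t (ρ z)))).trans ?_
      exact ψ.left_inv (mem_cotChart_source.1 hts)
    have hρ' : ρ z' = ρ z := by
      rw [hρ z', hinv']
      exact hproj.projFlowInv_eq (Ioo_subset_Icc_self htI) hρΛ
    have hchart' := (hball z' hzt).2.2.2.2.2.1
    rw [hρ'] at hchart'
    have hpz : (Φf (flow t (ρ z))).2 = p z' := congrArg Prod.snd hchart'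
    have hi := hinr z' hzt hdt
    have hval := hHJ htI hts (fderiv ℝ ac z') hdt.hasFDerivAt fun v => by
      rw [hpz, ← hi]
      rfl
    have hgz : HC (g z') = H t (flow t (ρ z)) := by
      change H t (Φf.symm (z'.2, (fderiv ℝ ac z').comp (ContinuousLinearMap.inr ℝ ℝ E))) = _
      rw [hi, ← hpz]
      exact congrArg (H t) (Φf.left_inv hts)
    change fderiv ℝ ac z' (1, 0) + HC (g z') = 0
    rw [hval, hgz, neg_add_cancel]

end HamOC

/-! ### Second derivatives of sums and slices; differentiability of the inverse. -/

namespace HamOC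

open Filter Function
open scoped NNReal

section SecondDerivatives

variable {F G : Type*} [NormedAddCommGroup F] [NormedSpace ℝ F] [NormedAddCommGroup G]
  [NormedSpace ℝ G]

theorem fderiv_fderiv_comp_snd_add {b : G → ℝ} {a : F × G → ℝ} {z : F × G}
    (hb : ContDiffAt ℝ 2 b z.2) (ha : ContDiffAt ℝ 2 a z) (v w : F × G) :
    fderiv ℝ (fun z => fderiv ℝ (fun z : F × G => b z.2 + a z) z) z v w =
      fderiv ℝ (fderiv ℝ b) z.2 v.2 w.2 + fderiv ℝ (fderiv ℝ a) z v w := by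
  have hb' : ∀ᶠ y in 𝓝 z, DifferentiableAt ℝ b y.2 :=
    continuousAt_snd.eventually
      ((hb.eventually (by norm_num)).mono fun z hz => hz.differentiableAt (by norm_num))
  have ha' : ∀ᶠ y in 𝓝 z, DifferentiableAt ℝ a y :=
    (ha.eventually (by norm_num)).mono fun z hz => hz.differentiableAt (by norm_num)
  have heq : (fun z => fderiv ℝ (fun z : F × G => b z.2 + a z) z) =ᶠ[𝓝 z] fun z =>
      (ContinuousLinearMap.snd ℝ F G).precomp ℝ (fderiv ℝ b z.2) + fderiv ℝ a z := by
    filter_upwards [hb', ha'] with y h1 h2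
    exact ((h1.hasFDerivAt.comp y hasFDerivAt_snd).add h2.hasFDerivAt).fderiv
  have h1 : HasFDerivAt (fderiv ℝ b) (fderiv ℝ (fderiv ℝ b) z.2) z.2 :=
    ((hb.fderiv_right (m := 1) (by norm_num)).differentiableAt (by norm_num)).hasFDerivAt
  have h2 : HasFDerivAt (fderiv ℝ a) (fderiv ℝ (fderiv ℝ a) z) z :=
    ((ha.fderiv_right (m := 1) (by norm_num)).differentiableAt (by norm_num)).hasFDerivAt
  have h3 := (((ContinuousLinearMap.snd ℝ F G).precomp ℝ).hasFDerivAt.comp z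
    (h1.comp z hasFDerivAt_snd)).add h2
  rw [(h3.congr_of_eventuallyEq heq).fderiv]
  rfl

theorem fderiv_fderiv_slice {a : F × G → ℝ} {t : F} {y : G} (ha : ContDiffAt ℝ 2 a (t, y))
    (v w : G) :
    fderiv ℝ (fderiv ℝ fun y => a (t, y)) y v w =
      fderiv ℝ (fderiv ℝ a) (t, y) (0, v) (0, w) := by
  have hc : ContinuousAt (fun y : G => (t, y)) y := by fun_prop
  have ha' : ∀ᶠ y in 𝓝 y, DifferentiableAt ℝ a (t, y) :=
    hc.eventually ((ha.eventually (by norm_num)).mono fun z hz => hz.differentiableAt (by norm_num))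
  have heq : (fderiv ℝ fun y => a (t, y)) =ᶠ[𝓝 y] fun y =>
      (ContinuousLinearMap.inr ℝ F G).precomp ℝ (fderiv ℝ a (t, y)) := by
    filter_upwards [ha'] with y h1
    exact (h1.hasFDerivAt.comp (f := fun y => (t, y)) y (hasFDerivAt_prodMk_right t y)).fderiv
  have h2 : HasFDerivAt (fderiv ℝ a) (fderiv ℝ (fderiv ℝ a) (t, y)) (t, y) :=
    ((ha.fderiv_right (m := 1) (by norm_num)).differentiableAt (by norm_num)).hasFDerivAt
  have h3 := ((ContinuousLinearMap.inr ℝ F G).precomp ℝ).hasFDerivAt.comp y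
    (h2.comp (f := fun y => (t, y)) y (hasFDerivAt_prodMk_right t y))
  rw [(h3.congr_of_eventuallyEq heq).fderiv]
  rfl

/-- If `f' v = 0`, then `f` moves by `o(r)` along `x + r v`, and so does its image under the
Lipschitz map `g`; but that image is `x + r v` itself, so `v = 0`. -/
theorem hasFDerivAt_injective_of_lipschitz_leftInverse {f : F → G} {g : G → F} {f' : F →L[ℝ] G}
    {x : F} {K : ℝ≥0} {s : Set G} (hf : HasFDerivAt f f' x) (hs : s ∈ 𝓝 (f x))
    (hg : LipschitzOnWith K g s) (hgf : ∀ᶠ y in 𝓝 x, g (f y) = y) : Injective f' := by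
  refine (injective_iff_map_eq_zero f').2 fun v hv => ?_
  have hl : HasDerivAt (fun r : ℝ => x + r • v) v 0 := by
    have h1 := ((hasDerivAt_id (0 : ℝ)).smul_const v).const_add x
    rwa [one_smul] at h1
  have hx0 : x + (0 : ℝ) • v = x := by simp
  have hc : HasDerivAt (fun r : ℝ => f (x + r • v)) 0 0 := by
    have h1 : HasDerivAt (f ∘ fun r : ℝ => x + r • v) (f' v) 0 :=
      HasFDerivAt.comp_hasDerivAt 0 (by rwa [hx0]) hl
    rwa [hv] at h1
  have hlt : Tendsto (fun r : ℝ => x + r • v) (𝓝 0) (𝓝 x) := by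
    have := hl.continuousAt.tendsto
    rwa [hx0] at this
  have hzero : HasDerivAt (fun r : ℝ => x + r • v) 0 0 := by
    rw [hasDerivAt_iff_isLittleO] at hc ⊢
    simp only [smul_zero, sub_zero, hx0] at hc ⊢
    refine Asymptotics.IsBigO.trans_isLittleO (Asymptotics.IsBigO.of_bound (K : ℝ) ?_) hc
    filter_upwards [hlt.eventually hgf, hlt.eventually (hf.continuousAt.eventually hs)] with r h1 h2
    have h3 := hg.dist_le_mul _ h2 _ (mem_of_mem_nhds hs)
    rwa [h1, hgf.self_of_nhds, dist_eq_norm, dist_eq_norm] at h3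
  exact hl.unique hzero

end SecondDerivatives

variable {E : Type*} [NormedAddCommGroup E] [NormedSpace ℝ E] [FiniteDimensional ℝ E]
  {M : Type*} [TopologicalSpace M] [ChartedSpace E M] [IsManifold 𝓘(ℝ, E) ∞ M]
  {H : ℝ → Cotangent E M → ℝ} {J : Set ℝ} {O Λ : Set (Cotangent E M)}
  {flow : ℝ → Cotangent E M → Cotangent E M} {T T₁ : ℝ} {ξ : ℝ → M} {α β : M → ℝ} {A : Set M}

/-- `lieRef` applied to `φ` is the reference Hamiltonian composed with the section `dφ`; the chain
rule and the definition of the Hamiltonian vector do the rest. -/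
theorem ControlProblem.lieDeriv_lieRef {m : ℕ} (P : ControlProblem E M m) (p0 : ℝ)
    {u : ℝ → EuclideanSpace ℝ (Fin m)} {t : ℝ} (hu : u t ∈ P.V) {x : M} (hx : x ∈ P.D) {φ : M → ℝ}
    (hφ : ContMDiffAt 𝓘(ℝ, E) 𝓘(ℝ, ℝ) 2 φ x) {ℓ : Cotangent E M} (hℓ : dSection E φ x = ℓ)
    (v : E) :
    lieDeriv 𝓘(ℝ, E) (P.lieRef p0 u t φ) x v =
      symplForm ℓ (sectionPush (dSection E φ) x v) (hamVec (P.refHam p0 u t) ℓ) := by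
  subst hℓ
  have h1 : MDifferentiableAt (cotModel E) 𝓘(ℝ, ℝ) (P.refHam p0 u t) (dSection E φ x) :=
    P.mdifferentiableAt_preHam p0 hu hx
  have h2 := mfderiv_comp x h1 (mdifferentiableAt_dSection hφ)
  have h3 := congrArg (fun B : E →L[ℝ] ℝ => B v) h2
  exact h3.trans (symplForm_hamVec (P.refHam p0 u t) (dSection E φ x)
    (sectionPush (dSection E φ) x v)).symm

/-- If `flow_T` is differentiable at `ℓ₀` along `Λ`, then so is the inverse of `π flow_T`. -/
theorem IsProjBiLipschitz.mdifferentiableAt_projFlowInv [Nonempty M]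
    (hproj : IsProjBiLipschitz T T₁ ξ (dSection E α '' A) flow) (h0 : 0 < T) (hT : T < T₁)
    (hA : IsOpen A) {x0 xf : M} (hx0 : x0 ∈ A) (hxf : (flow T (dSection E α x0)).proj = xf)
    (hd : MDifferentiableAt 𝓘(ℝ, E) (cotModel E) (fun x => flow T (dSection E α x)) x0) :
    MDifferentiableAt 𝓘(ℝ, E) 𝓘(ℝ, E)
      (fun x => (projFlowInv flow (dSection E α '' A) T x).proj) xf := by
  subst hxf
  set Λ := dSection E α '' A with hΛ
  set ℓ0 := dSection E α x0 with hℓ0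
  have hℓΛ : ℓ0 ∈ Λ := ⟨x0, hx0, rfl⟩
  have hTI : T ∈ Icc 0 T₁ := ⟨h0.le, hT.le⟩
  obtain ⟨δ, hδ, K, hball, hK⟩ := hproj.exists_lipschitz_inverse h0 hT hℓΛ
    (V := Λ ∩ (extChartAt (cotModel E) ℓ0).source)
    (inter_mem self_mem_nhdsWithin (nhdsWithin_le_nhds (extChartAt_source_mem_nhds ℓ0)))
  set xf := (flow T ℓ0).proj with hxf
  set ψ := extChartAt 𝓘(ℝ, E) xf with hψ
  set χ := extChartAt 𝓘(ℝ, E) x0 with hχ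
  set f : E → E := fun y => ψ (flow T (dSection E α (χ.symm y))).proj with hf
  set g : E → E := fun w => χ (projFlowInv flow Λ T (ψ.symm w)).proj with hg
  have hψxf : ψ.symm (ψ xf) = xf := extChartAt_to_inv xf
  have hχx0 : χ.symm (χ x0) = x0 := extChartAt_to_inv x0
  have hfx : f (χ x0) = ψ xf := by simp only [hf, hχx0]; rfl
  have hgx : g (ψ xf) = χ x0 := by
    simp only [hg, hψxf]
    rw [hproj.projFlowInv_eq hTI hℓΛ]
    rfl
  have hcomp : MDifferentiableAt 𝓘(ℝ, E) 𝓘(ℝ, E) f (χ x0) := by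
    have h1 : MDifferentiableAt 𝓘(ℝ, E) 𝓘(ℝ, E) χ.symm (χ x0) :=
      mdifferentiableAt_extChartAt_symm (mem_extChartAt_target x0)
    have h2 : MDifferentiableAt 𝓘(ℝ, E) (cotModel E) (fun x => flow T (dSection E α x))
      (χ.symm (χ x0)) := by rwa [hχx0]
    have h3 := h2.comp (χ x0) h1
    have h4 : MDifferentiableAt (cotModel E) 𝓘(ℝ, E)
        (Bundle.TotalSpace.proj : Cotangent E M → M) (flow T (dSection E α (χ.symm (χ x0)))) :=
      (Bundle.contMDiff_proj (n := 1) _).mdifferentiable one_ne_zero _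
    have h5 := MDifferentiableAt.comp (I' := cotModel E) (χ x0) h4 h3
    have h6 : MDifferentiableAt 𝓘(ℝ, E) 𝓘(ℝ, E) ψ
        (flow T (dSection E α (χ.symm (χ x0)))).proj := by
      rw [hχx0]
      exact mdifferentiableAt_extChartAt (mem_chart_source E xf)
    exact MDifferentiableAt.comp (I' := 𝓘(ℝ, E)) (χ x0) h6 h5
  have hfd : HasFDerivAt f (fderiv ℝ f (χ x0)) (χ x0) := hcomp.differentiableAt.hasFDerivAt
  set s : Set E := {w | (T, w) ∈ Metric.ball (T, ψ xf) δ} with hs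
  have hsmem : s ∈ 𝓝 (ψ xf) := by
    have hc : Continuous fun w : E => (T, w) := by fun_prop
    exact hc.continuousAt (Metric.ball_mem_nhds _ hδ)
  have hgK : LipschitzOnWith K g s := by
    refine LipschitzOnWith.of_dist_le_mul fun w hw w' hw' => ?_
    have h1 := hK.dist_le_mul _ hw _ hw'
    have h2 : dist (T, w) (T, w') = dist w w' := by simp [Prod.dist_eq]
    rw [h2] at h1
    exact (le_max_left _ _).trans h1
  have hgf : ∀ᶠ y in 𝓝 (χ x0), g (f y) = y := by
    have h1 : Tendsto χ.symm (𝓝 (χ x0)) (𝓝 x0) := by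
      have := (continuousAt_extChartAt_symm (I := 𝓘(ℝ, E)) x0).tendsto
      rwa [extChartAt_to_inv] at this
    have h2 : Tendsto (fun y => (flow T (dSection E α (χ.symm y))).proj) (𝓝 (χ x0)) (𝓝 xf) := by
      have h3 : ContinuousAt (fun x => (flow T (dSection E α x)).proj) x0 :=
        (FiberBundle.continuous_proj (E →L[ℝ] ℝ)
          (fun x : M => TangentSpace 𝓘(ℝ, E) x →L[ℝ] Bundle.Trivial M ℝ x)).continuousAt.comp
          hd.continuousAt
      exact h3.tendsto.comp h1
    filter_upwards [h1.eventually (hA.mem_nhds hx0), h2.eventually (extChartAt_source_mem_nhds (I := 𝓘(ℝ, E)) xf),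
      extChartAt_target_mem_nhds (I := 𝓘(ℝ, E)) x0] with y hyA hys hyt
    simp only [hf, hg]
    rw [ψ.left_inv hys, hproj.projFlowInv_eq hTI ⟨_, hyA, rfl⟩]
    exact χ.right_inv hyt
  have hfg : ∀ᶠ w in 𝓝 (ψ xf), f (g w) = w := by
    filter_upwards [hsmem] with w hw
    obtain ⟨-, h2, ⟨⟨x, hxA, hx⟩, hsrc⟩, h4⟩ := hball _ hw
    simp only [hf, hg]
    rw [← hx] at h4 hsrc ⊢
    have h5 : χ.symm (χ (dSection E α x).proj) = x := χ.left_inv (mem_cotChart_source.1 hsrc)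
    rw [h5, h4, ψ.right_inv h2]
  have hinj : Injective (fderiv ℝ f (χ x0)) :=
    hasFDerivAt_injective_of_lipschitz_leftInverse hfd (by rwa [hfx]) hgK hgf
  -- An injective endomorphism in finite dimension is invertible. As `g` is continuous and `f ∘ g`
  -- is the identity near the final point, `g` is differentiable there.
  let e : E ≃L[ℝ] E := (LinearEquiv.ofInjectiveEndo
    (fderiv ℝ f (χ x0) : E →ₗ[ℝ] E) hinj).toContinuousLinearEquiv
  have hfe : HasFDerivAt f (e : E →L[ℝ] E) (g (ψ xf)) := by
    rw [hgx]
    exact hfd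
  have hgd := HasFDerivAt.of_local_left_inverse (hgK.continuousOn.continuousAt hsmem) hfe hfg
  have h1 : MDifferentiableAt 𝓘(ℝ, E) 𝓘(ℝ, E) ψ xf :=
    mdifferentiableAt_extChartAt (mem_chart_source E xf)
  have h2 := MDifferentiableAt.comp (I' := 𝓘(ℝ, E)) xf hgd.differentiableAt.mdifferentiableAt h1
  have h3 : MDifferentiableAt 𝓘(ℝ, E) 𝓘(ℝ, E) χ.symm ((g ∘ ψ) xf) := by
    refine mdifferentiableAt_extChartAt_symm ?_
    rw [comp_apply, hgx]
    exact mem_extChartAt_target x0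
  have h4 := MDifferentiableAt.comp (I' := 𝓘(ℝ, E)) xf h3 h2
  refine h4.congr_of_eventuallyEq ?_
  have hψc : Tendsto ψ (𝓝 xf) (𝓝 (ψ xf)) := continuousAt_extChartAt (I := 𝓘(ℝ, E)) xf
  filter_upwards [hψc.eventually hsmem, extChartAt_source_mem_nhds (I := 𝓘(ℝ, E)) xf]
    with x hx hxs
  obtain ⟨-, -, ⟨-, hsrc⟩, -⟩ := hball _ hx
  simp only [ψ.left_inv hxs] at hsrc
  simp only [comp_apply, hg, ψ.left_inv hxs]
  exact (χ.left_inv (mem_cotChart_source.1 hsrc)).symm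

end HamOC

/-! ### The second derivatives of `Φ` as symplectic pairings. -/

namespace HamOC

open Filter Function
open scoped NNReal

variable {E : Type*} [NormedAddCommGroup E] [NormedSpace ℝ E] [FiniteDimensional ℝ E]
  {M : Type*} [TopologicalSpace M] [ChartedSpace E M] [IsManifold 𝓘(ℝ, E) ∞ M]
  {H : ℝ → Cotangent E M → ℝ} {J : Set ℝ} {O Λ : Set (Cotangent E M)}
  {flow : ℝ → Cotangent E M → Cotangent E M} {T T₁ : ℝ} {ξ : ℝ → M} {α β : M → ℝ} {A : Set M}

theorem contDiffAt_prod_comp_extChartAt_symm {φ : ℝ × M → ℝ} {t : ℝ} {x : M}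
    (hφ : ContMDiffAt (𝓘(ℝ, ℝ).prod 𝓘(ℝ, E)) 𝓘(ℝ, ℝ) 2 φ (t, x)) :
    ContDiffAt ℝ 2 (fun z : ℝ × E => φ (z.1, (extChartAt 𝓘(ℝ, E) x).symm z.2))
      (t, extChartAt 𝓘(ℝ, E) x x) := by
  have h1 := (contMDiffAt_iff.1 hφ).2
  rw [extChartAt_prod, ModelWithCorners.Boundaryless.range_eq_univ, contDiffWithinAt_univ] at h1
  exact h1

/-- The section `dα_T` near the final point, and the second derivatives of `Φ` there, up to the
coordinate expressions of the symplectic form. -/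
theorem IsRegularFlow.secondDeriv_Phi [Nonempty M]
    (hflow : IsRegularFlow H J O (dSection E α '' A) flow) (hJ : IsOpen J) (hJ' : J.OrdConnected)
    (hA : IsOpen A) (hα : ContMDiffOn 𝓘(ℝ, E) 𝓘(ℝ, ℝ) ∞ α A)
    (hT0 : 0 < T) (hT : T < T₁) (hT₁ : Icc 0 T₁ ⊆ J)
    (hproj : IsProjBiLipschitz T T₁ ξ (dSection E α '' A) flow)
    {ℓ0 ℓf : Cotangent E M} {xf : M} (hℓ0 : ℓ0 ∈ dSection E α '' A) (hℓf : flow T ℓ0 = ℓf)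
    (hxf : ℓf.proj = xf)
    (hHf : MDifferentiableAt (𝓘(ℝ, ℝ).prod (cotModel E)) 𝓘(ℝ, ℝ)
      (fun z : ℝ × Cotangent E M => H z.1 z.2) (T, ℓf))
    (hβ : ContMDiffAt 𝓘(ℝ, E) 𝓘(ℝ, ℝ) 2 β xf)
    (hΦ : ContMDiffAt (𝓘(ℝ, ℝ).prod 𝓘(ℝ, E)) 𝓘(ℝ, ℝ) 2 (Phi H flow α A β) (T, xf)) :
    (∀ᶠ x in 𝓝 xf, dSection E (alphaT H flow α A T) x =
      flow T (projFlowInv flow (dSection E α '' A) T x)) ∧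
    dSection E (alphaT H flow α A T) xf = ℓf ∧
    ContMDiffAt 𝓘(ℝ, E) 𝓘(ℝ, ℝ) 2 (alphaT H flow α A T) xf ∧
    (∀ v : E, secondDeriv (𝓘(ℝ, ℝ).prod 𝓘(ℝ, E)) (Phi H flow α A β) (T, xf)
        ((0, v) : ℝ × E) ((0, v) : ℝ × E)
      = secondDeriv 𝓘(ℝ, E) (fun x => β x + alphaT H flow α A T x) xf v v) ∧
    (∀ v : E, secondDeriv (𝓘(ℝ, ℝ).prod 𝓘(ℝ, E)) (Phi H flow α A β) (T, xf)
        ((0, v) : ℝ × E) ((0, v) : ℝ × E)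
      = symplForm ℓf (sectionPush (dSection E (alphaT H flow α A T)) xf v)
          (sectionPush (dSection E (fun x => -β x)) xf v)) ∧
    (∀ v : E, secondDeriv (𝓘(ℝ, ℝ).prod 𝓘(ℝ, E)) (Phi H flow α A β) (T, xf)
        ((1, 0) : ℝ × E) ((0, v) : ℝ × E)
      = symplForm ℓf (hamVec (H T) ℓf)
          (sectionPush (dSection E (alphaT H flow α A T)) xf v)) ∧
    secondDeriv (𝓘(ℝ, ℝ).prod 𝓘(ℝ, E)) (Phi H flow α A β) (T, xf)
        ((1, 0) : ℝ × E) ((1, 0) : ℝ × E)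
      = -deriv (fun t => H t ℓf) T + symplForm ℓf
          (sectionPush (dSection E (alphaT H flow α A T)) xf
            (hamVec (H T) ℓf : E × (E →L[ℝ] ℝ)).1) (hamVec (H T) ℓf) := by
  subst hℓf hxf
  set ℓf := flow T ℓ0 with hℓf
  set ψ := extChartAt 𝓘(ℝ, E) ℓf.proj with hψ
  set ac : ℝ × E → ℝ := fun z => alphaT H flow α A z.1 (ψ.symm z.2) with hacdef
  set b : E → ℝ := β ∘ ψ.symm with hb
  have h2 : (2 : WithTop ℕ∞) ≤ ∞ := ENat.LEInfty.out
  have hbC : ContDiffAt ℝ 2 b (ψ ℓf.proj) :=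
    contDiffAt_comp_extChartAt_symm h2 hβ (mem_extChartAt_source _)
  have hΦC : ContDiffAt ℝ 2 (fun z : ℝ × E => b z.2 + ac z) (T, ψ ℓf.proj) :=
    contDiffAt_prod_comp_extChartAt_symm hΦ
  -- Only `Φ` is assumed `C²`; subtracting the `C²` function `β` transfers this to `α_t`.
  have hac : ContDiffAt ℝ 2 ac (T, ψ ℓf.proj) := by
    have h3 : ContDiffAt ℝ 2 (fun z : ℝ × E => b z.2) (T, ψ ℓf.proj) :=
      ContDiffAt.comp (g := b) (f := Prod.snd) (T, ψ ℓf.proj) hbC contDiffAt_snd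
    have h4 := hΦC.sub h3
    simpa using h4
  obtain ⟨hsec, hHJ⟩ := hflow.dSection_alphaT_and_fderiv_hamiltonJacobi hJ hJ' hA hα hT0 hT hT₁
    hproj hℓ0 hHf hac
  have hαT : ContMDiffAt 𝓘(ℝ, E) 𝓘(ℝ, ℝ) 2 (alphaT H flow α A T) ℓf.proj := by
    have h3 : ContMDiffAt 𝓘(ℝ, E) (𝓘(ℝ, ℝ).prod 𝓘(ℝ, E)) 2 (fun x : M => (T, x)) ℓf.proj :=
      contMDiffAt_const.prodMk contMDiffAt_id
    have h4 := (hΦ.comp ℓf.proj h3).sub hβ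
    refine h4.congr_of_eventuallyEq (Eventually.of_forall fun x => ?_)
    exact (add_sub_cancel_left (β x) (alphaT H flow α A T x)).symm
  have hsd : ∀ v w : ℝ × E, secondDeriv (𝓘(ℝ, ℝ).prod 𝓘(ℝ, E)) (Phi H flow α A β) (T, ℓf.proj) v w
      = fderiv ℝ (fderiv ℝ b) (ψ ℓf.proj) v.2 w.2 +
        fderiv ℝ (fderiv ℝ ac) (T, ψ ℓf.proj) v w := by
    intro v w
    refine Eq.trans ?_ (fderiv_fderiv_comp_snd_add (z := (T, ψ ℓf.proj)) hbC hac v w)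
    unfold secondDeriv
    rw [extChartAt_prod]
    rfl
  have haT : ∀ v w : E, fderiv ℝ (fderiv ℝ (alphaT H flow α A T ∘ ψ.symm)) (ψ ℓf.proj) v w =
      fderiv ℝ (fderiv ℝ ac) (T, ψ ℓf.proj) (0, v) (0, w) := fderiv_fderiv_slice hac
  set D2 := fderiv ℝ (fderiv ℝ ac) (T, ψ ℓf.proj) with hD2
  set h : E × (E →L[ℝ] ℝ) := hamVec (H T) ℓf with hh
  have hsymm : ∀ v w, D2 v w = D2 w v := by
    have h3 : IsSymmSndFDerivAt ℝ ac (T, ψ ℓf.proj) := hac.isSymmSndFDerivAt (by simp)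
    exact fun v w => h3 v w
  have hneg : ∀ v w : E, fderiv ℝ (fderiv ℝ ((fun x => -β x) ∘ ψ.symm)) (ψ ℓf.proj) v w =
      -fderiv ℝ (fderiv ℝ b) (ψ ℓf.proj) v w := by
    intro v w
    have h3 : fderiv ℝ ((fun x => -β x) ∘ ψ.symm) = fun y => -fderiv ℝ b y :=
      funext fun y => fderiv_fun_neg
    rw [h3, fderiv_fun_neg]
    rfl
  have hpush : ∀ v : E,
      (sectionPush (dSection E (alphaT H flow α A T)) ℓf.proj v : E × (E →L[ℝ] ℝ)) =
        (v, (D2 (0, v)).comp (ContinuousLinearMap.inr ℝ ℝ E)) := fun v =>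
    (sectionPush_dSection hαT v).trans
      (Prod.ext rfl (ContinuousLinearMap.ext fun w => haT v w))
  have hpushβ : ∀ v : E,
      (sectionPush (dSection E (fun x => -β x)) ℓf.proj v : E × (E →L[ℝ] ℝ)) =
        (v, -fderiv ℝ (fderiv ℝ b) (ψ ℓf.proj) v) := fun v =>
    (sectionPush_dSection hβ.neg v).trans
      (Prod.ext rfl (ContinuousLinearMap.ext fun w => hneg v w))
  have hσ : ∀ p q p' q' : E × (E →L[ℝ] ℝ), p = p' → q = q' →
      symplForm ℓf p q = p'.2 q'.1 - q'.2 p'.1 := by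
    rintro p q _ _ rfl rfl
    exact symplForm_apply ℓf p q
  refine ⟨hsec, ?_, hαT, fun v => ?_, fun v => ?_, fun v => ?_, ?_⟩
  · refine hsec.self_of_nhds.trans ?_
    rw [hℓf, hproj.projFlowInv_eq ⟨hT0.le, hT.le⟩ hℓ0]
  · rw [hsd]
    have h3 := fderiv_fderiv_slice hΦC v v
    rw [← fderiv_fderiv_comp_snd_add (z := (T, ψ ℓf.proj)) hbC hac]
    exact h3.symm
  -- Both pushed vectors have base component `v`, so `σ` reduces to the difference of the Hessians
  -- of `α_T` and `-β`.
  · refine Eq.trans ?_ (hσ _ _ _ _ (hpush v) (hpushβ v)).symm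
    rw [hsd]
    change _ = D2 (0, v) (0, v) - -(fderiv ℝ (fderiv ℝ b) (ψ ℓf.proj) v v)
    ring
  -- After exchanging the order of differentiation, this is the differentiated Hamilton–Jacobi
  -- equation with `τ = 0`.
  · refine Eq.trans ?_ (hσ h _ _ _ rfl (hpush v)).symm
    rw [hsd, hsymm, hHJ]
    change _ = h.2 v - D2 (0, v) (0, h.1)
    simp
  -- The equation is used twice: with `τ = 1`, `v = 0`, and then with `τ = 0`, `v = h.1` to
  -- eliminate the mixed term left by the first use.
  · refine Eq.trans ?_ (congrArg (-deriv (fun t => H t ℓf) T + ·)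
      (hσ _ h _ _ (hpush h.1) rfl).symm)
    rw [hsd, hHJ, hsymm, hHJ]
    change _ = -deriv (fun t => H t ℓf) T + (D2 (0, h.1) (0, h.1) - h.2 h.1)
    simp
    ring

/-- The linearization of `dα_T = flow_T ∘ (π flow_T)⁻¹` when `flow_T` is differentiable along
`Λ`. -/
theorem IsProjBiLipschitz.sectionPush_alphaT [Nonempty M]
    (hproj : IsProjBiLipschitz T T₁ ξ (dSection E α '' A) flow) (h0 : 0 < T) (hT : T < T₁)
    (hA : IsOpen A) {x0 xf : M} (hx0 : x0 ∈ A) (hxf : (flow T (dSection E α x0)).proj = xf)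
    (hd : MDifferentiableAt 𝓘(ℝ, E) (cotModel E) (fun x => flow T (dSection E α x)) x0)
    (hsec : ∀ᶠ x in 𝓝 xf, dSection E (alphaT H flow α A T) x =
      flow T (projFlowInv flow (dSection E α '' A) T x)) (v : E) :
    (sectionPush (dSection E (alphaT H flow α A T)) xf v : E × (E →L[ℝ] ℝ)) =
      mfderiv 𝓘(ℝ, E) (cotModel E) (fun x => flow T (dSection E α x)) x0
        (mfderiv 𝓘(ℝ, E) 𝓘(ℝ, E)
          (fun x => (projFlowInv flow (dSection E α '' A) T x).proj) xf v) := by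
  have hq := hproj.mdifferentiableAt_projFlowInv h0 hT hA hx0 hxf hd
  have hTI : T ∈ Icc 0 T₁ := ⟨h0.le, hT.le⟩
  have hℓΛ : dSection E α x0 ∈ dSection E α '' A := ⟨x0, hx0, rfl⟩
  have hqx : (projFlowInv flow (dSection E α '' A) T xf).proj = x0 := by
    rw [← hxf, hproj.projFlowInv_eq hTI hℓΛ]
    rfl
  have himage : ∀ᶠ x in 𝓝 xf, (T, x) ∈ projFlow flow '' (Icc 0 T₁ ×ˢ (dSection E α '' A)) := by
    obtain ⟨W, hW, hWe⟩ := hproj.isOpen_image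
    have hmem : (T, xf) ∈ W ∩ (Icc 0 T₁ ×ˢ univ) := by
      rw [← hWe]
      exact ⟨(T, dSection E α x0), ⟨hTI, hℓΛ⟩, Prod.ext rfl hxf⟩
    have hc : Continuous fun x : M => (T, x) := by fun_prop
    filter_upwards [hc.continuousAt (hW.mem_nhds hmem.1)] with x hx
    rw [hWe]
    exact ⟨hx, hTI, mem_univ _⟩
  have heq : dSection E (alphaT H flow α A T) =ᶠ[𝓝 xf] (fun x => flow T (dSection E α x)) ∘
      fun x => (projFlowInv flow (dSection E α '' A) T x).proj := by
    filter_upwards [hsec, himage] with x hx hi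
    obtain ⟨y, -, hy⟩ := (projFlowInv_spec hi).1
    rw [hx, comp_apply, ← hy]
    rfl
  have hd' : MDifferentiableAt 𝓘(ℝ, E) (cotModel E) (fun x => flow T (dSection E α x))
      ((projFlowInv flow (dSection E α '' A) T xf).proj) := by rwa [hqx]
  have h1 := mfderiv_comp xf hd' hq
  have h2 : mfderiv 𝓘(ℝ, E) (cotModel E) (dSection E (alphaT H flow α A T)) xf =
    mfderiv 𝓘(ℝ, E) (cotModel E) ((fun x => flow T (dSection E α x)) ∘
      fun x => (projFlowInv flow (dSection E α '' A) T x).proj) xf := heq.mfderiv_eq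
  have h3 : ∀ (y : M) (w : E), y = x0 →
      (mfderiv 𝓘(ℝ, E) (cotModel E) (fun x => flow T (dSection E α x)) y w : E × (E →L[ℝ] ℝ)) =
        mfderiv 𝓘(ℝ, E) (cotModel E) (fun x => flow T (dSection E α x)) x0 w := by
    rintro _ w rfl
    rfl
  exact (congrArg (fun B : E →L[ℝ] E × (E →L[ℝ] ℝ) => B v) (h2.trans h1)).trans (h3 _ _ hqx)

end HamOC

/-! ### Assembly at the final point. -/

theorem lemma3p8 {E : Type*} [NormedAddCommGroup E] [NormedSpace ℝ E] [FiniteDimensional ℝ E]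
    {M : Type*} [TopologicalSpace M] [T2Space M] [ParacompactSpace M] [ConnectedSpace M]
    [ChartedSpace E M] [IsManifold 𝓘(ℝ, E) ∞ M] {m : ℕ} (P : ControlProblem E M m)
    -- the reference trajectory and its Pontryagin extremal
    (p0 T : ℝ) (ξ : ℝ → M) (u : ℝ → EuclideanSpace ℝ (Fin m)) (lam : ℝ → Cotangent E M)
    (hadm : P.IsAdmissible T ξ u) (hPMP : P.IsPontryagin p0 T ξ u lam)
    -- the functions `α`, `β`; below, `Λ` is the graph of `dα` on `A`
    (α β : M → ℝ) (A B : Set M)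
    (hα : IsCostExtension E p0 P.c0 P.N0 α A) (hA : ξ 0 ∈ A) (hα0 : lam 0 = dSection E α (ξ 0))
    (hβ : IsCostExtension E p0 P.cf P.Nf β B) (hB : ξ T ∈ B)
    (hβf : lam T = dSection E (fun x => -β x) (ξ T))
    -- the Hamiltonian and its flow
    (H : ℝ → Cotangent E M → ℝ) (J : Set ℝ) (O : Set (Cotangent E M))
    (hJ : IsOpen J) (hJ' : J.OrdConnected) (hO : IsOpen O) (hΛO : dSection E α '' A ⊆ O)
    (flow : ℝ → Cotangent E M → Cotangent E M)
    (hflow : IsRegularFlow H J O (dSection E α '' A) flow)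
    (hsuper : IsSuperHamiltonian P p0 T u lam H J O (dSection E α '' A) flow)
    (T₁ : ℝ) (hT : T < T₁) (hT₁ : Icc 0 T₁ ⊆ J)
    (hproj : IsProjBiLipschitz T T₁ ξ (dSection E α '' A) flow)
    -- the derivatives of `H` at the final point exist, and the Hamiltonian vector fields of `H` and
    -- of the reference Hamiltonian agree there
    (hHf : MDifferentiableAt (𝓘(ℝ, ℝ).prod (cotModel E)) 𝓘(ℝ, ℝ)
      (fun z : ℝ × Cotangent E M => H z.1 z.2) (T, lam T))
    (hvecf : hamVec (H T) (lam T) = hamVec (P.refHam p0 u T) (lam T))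
    -- `Φ` is `C²` near the final point
    (W : Set (ℝ × M)) (hW : W ∈ 𝓝 (T, ξ T))
    (hΦ : ContMDiffOn (𝓘(ℝ, ℝ).prod 𝓘(ℝ, E)) 𝓘(ℝ, ℝ) 2 (Phi H flow α A β) W) :
    -- `dα_T = flow_T ∘ (π flow_T)⁻¹` near the final point, and `dα_T(x_f) = ℓ_f`
    (∀ᶠ x in 𝓝 (ξ T), dSection E (alphaT H flow α A T) x =
      flow T (projFlowInv flow (dSection E α '' A) T x)) ∧
    dSection E (alphaT H flow α A T) (ξ T) = lam T ∧
    -- `∂ₓₓΦ`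
    (∀ δx : TangentSpace 𝓘(ℝ, E) (ξ T),
      secondDeriv (𝓘(ℝ, ℝ).prod 𝓘(ℝ, E)) (Phi H flow α A β) (T, ξ T)
          ((0, δx) : ℝ × E) ((0, δx) : ℝ × E)
        = secondDeriv 𝓘(ℝ, E) (fun x => β x + alphaT H flow α A T x) (ξ T) δx δx ∧
      secondDeriv (𝓘(ℝ, ℝ).prod 𝓘(ℝ, E)) (Phi H flow α A β) (T, ξ T)
          ((0, δx) : ℝ × E) ((0, δx) : ℝ × E)
        = symplForm (lam T) (sectionPush (dSection E (alphaT H flow α A T)) (ξ T) δx)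
            (sectionPush (dSection E (fun x => -β x)) (ξ T) δx)) ∧
    -- `∂ₜₓΦ`
    (∀ δx : TangentSpace 𝓘(ℝ, E) (ξ T),
      secondDeriv (𝓘(ℝ, ℝ).prod 𝓘(ℝ, E)) (Phi H flow α A β) (T, ξ T)
          ((1, 0) : ℝ × E) ((0, δx) : ℝ × E)
        = -lieDeriv 𝓘(ℝ, E) (P.lieRef p0 u T (alphaT H flow α A T)) (ξ T) δx ∧
      secondDeriv (𝓘(ℝ, ℝ).prod 𝓘(ℝ, E)) (Phi H flow α A β) (T, ξ T)
          ((1, 0) : ℝ × E) ((0, δx) : ℝ × E)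
        = symplForm (lam T) (hamVec (H T) (lam T))
            (sectionPush (dSection E (alphaT H flow α A T)) (ξ T) δx)) ∧
    -- `∂ₜₜΦ`
    (secondDeriv (𝓘(ℝ, ℝ).prod 𝓘(ℝ, E)) (Phi H flow α A β) (T, ξ T)
          ((1, 0) : ℝ × E) ((1, 0) : ℝ × E)
        = -deriv (fun t => H t (lam T)) T
          + lieDeriv 𝓘(ℝ, E) (P.lieRef p0 u T (alphaT H flow α A T)) (ξ T) (P.f (ξ T) (u T)) ∧
      secondDeriv (𝓘(ℝ, ℝ).prod 𝓘(ℝ, E)) (Phi H flow α A β) (T, ξ T)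
          ((1, 0) : ℝ × E) ((1, 0) : ℝ × E)
        = -deriv (fun t => H t (lam T)) T
          + symplForm (lam T)
              (sectionPush (dSection E (alphaT H flow α A T)) (ξ T) (P.f (ξ T) (u T)))
              (hamVec (H T) (lam T))) ∧
    -- `(dα_T)_* = flow_{T*} (π flow_T)⁻¹_*` when `flow_T` is differentiable on `Λ` at `ℓ_0`
    (MDifferentiableAt 𝓘(ℝ, E) (cotModel E) (fun x => flow T (dSection E α x)) (ξ 0) →
      MDifferentiableAt 𝓘(ℝ, E) 𝓘(ℝ, E)
        (fun x => (projFlowInv flow (dSection E α '' A) T x).proj) (ξ T) ∧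
      ∀ δx : TangentSpace 𝓘(ℝ, E) (ξ T),
        (sectionPush (dSection E (alphaT H flow α A T)) (ξ T) δx : E × (E →L[ℝ] ℝ))
          = mfderiv 𝓘(ℝ, E) (cotModel E) (fun x => flow T (dSection E α x)) (ξ 0)
              (mfderiv 𝓘(ℝ, E) 𝓘(ℝ, E)
                (fun x => (projFlowInv flow (dSection E α '' A) T x).proj) (ξ T) δx)) := by
  set Λ := dSection E α '' A with hΛ
  have hT0 : 0 < T := hadm.T_pos
  have hTT : T ∈ Icc 0 T := ⟨hT0.le, le_rfl⟩
  have hTJ : T ∈ J := hT₁ ⟨hT0.le, hT.le⟩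
  have hx0 : (lam 0).proj = ξ 0 := hPMP.lift 0 ⟨le_rfl, hT0.le⟩
  have hxf : (lam T).proj = ξ T := hPMP.lift T hTT
  have hℓ0 : lam 0 ∈ Λ := ⟨ξ 0, hA, hα0.symm⟩
  -- The extremal also solves the system of `H`, because the two Hamiltonian vectors agree along it
  -- a.e.; uniqueness then places `lam T` on the flow issued from `lam 0`.
  have hlam : IsHamSolution H lam 0 T := by
    refine ⟨hPMP.solution.1, ?_⟩
    filter_upwards [hPMP.solution.2, hsuper.vec_eq_ref] with t h1 h2 ht
    refine ⟨(h2 ht).1, ?_⟩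
    rw [(h2 ht).2]
    exact (h1 ht).2
  have hℓf : flow T (lam 0) = lam T :=
    (hflow.flow_unique (lam 0) hℓ0 T hTJ lam rfl hsuper.lam_mem hlam T hTT).symm
  have hu : u T ∈ P.V := P.U_subset (hadm.u_mem T hTT)
  have hD : ξ T ∈ P.D := hadm.mem_D T hTT
  have h2 : (2 : WithTop ℕ∞) ≤ ∞ := ENat.LEInfty.out
  have hβ2 : ContMDiffAt 𝓘(ℝ, E) 𝓘(ℝ, ℝ) 2 β (ξ T) :=
    (hβ.smooth.contMDiffAt (hβ.isOpen.mem_nhds hB)).of_le h2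
  obtain ⟨hsec, hsecT, hαT, hxx, hxx', htx, htt⟩ := hflow.secondDeriv_Phi hJ hJ' hα.isOpen
    hα.smooth hT0 hT hT₁ hproj hℓ0 hℓf hxf hHf hβ2 (hΦ.contMDiffAt hW)
  have hlie : ∀ v : E, lieDeriv 𝓘(ℝ, E) (P.lieRef p0 u T (alphaT H flow α A T)) (ξ T) v =
      symplForm (lam T) (sectionPush (dSection E (alphaT H flow α A T)) (ξ T) v)
        (hamVec (H T) (lam T)) := by
    intro v
    rw [P.lieDeriv_lieRef p0 hu hD hαT hsecT v, hvecf]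
  -- This identifies the direction occurring in `∂ₜₜΦ`, the projection of the Hamiltonian vector,
  -- with the reference dynamics at the final point.
  have hfst : (hamVec (H T) (lam T) : E × (E →L[ℝ] ℝ)).1 = P.f (ξ T) (u T) := by
    have h3 : ∀ x, (lam T).proj = x →
        (hamVec (H T) (lam T) : E × (E →L[ℝ] ℝ)).1 = P.f x (u T) := by
      rintro _ rfl
      rw [hvecf]
      exact P.hamVec_refHam_fst p0 hu (by rwa [hxf])
    exact h3 _ hxf
  rw [hfst] at htt
  have hanti : ∀ p q : E × (E →L[ℝ] ℝ), symplForm (lam T) p q = -symplForm (lam T) q p := by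
    intro p q
    rw [symplForm_apply, symplForm_apply, neg_sub]
  refine ⟨hsec, hsecT, fun v => ⟨hxx v, hxx' v⟩, fun v => ⟨?_, htx v⟩, ⟨?_, htt⟩, fun hd => ?_⟩
  · rw [hlie v]
    exact (htx v).trans (hanti _ _)
  · rw [hlie (P.f (ξ T) (u T))]
    exact htt
  · have hxf' : (flow T (dSection E α (ξ 0))).proj = ξ T := by
      rw [← hα0, hℓf, hxf]
    exact ⟨hproj.mdifferentiableAt_projFlowInv hT0 hT hα.isOpen hA hxf' hd, fun v =>
      hproj.sectionPush_alphaT hT0 hT hα.isOpen hA hxf' hd hsec v⟩
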